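/- Let $k$ be an algebraically closed field, $N\simeq\mathbb Z^n$ a lattice with dual lattice $M$, and $\Sigma$ a smooth complete fan in $N_{\mathbb R}$. Let $R(\Sigma)$ be the set of smooth fans subdividing $\Sigma$, ordered by subdivision ($\Sigma''\ge\Sigma'$ if $\Sigma''$ subdivides $\Sigma'$). A toric $b$-divisor on the toric variety $X_\Sigma$ is a family $\boldsymbol D=(D_{\Sigma'})_{\Sigma'\in R(\Sigma)}$ of toric $\mathbb Q$-divisors $D_{\Sigma'}=\sum_{\tau\in\Sigma'(1)}a_\tau D_\tau$ on $X_{\Sigma'}$ that is compatible under push-forward. It is nef if $D_{\Sigma'}$ is nef (i.e. has a concave support function) for all $\Sigma'$ in a cofinal subset of $R(\Sigma)$, and Cartier if there is $\Sigma'\in R(\Sigma)$ such that $D_{\Sigma''}$ is the pull-back of $D_{\Sigma'}$ for all $\Sigma''\ge\Sigma'$. Put $$H^0(X_\Sigma,\mathcal O(\boldsymbol D))=\{f\in k(X_\Sigma)^\times : \operatorname{div}_{\Sigma'}(f)+\lfloor D_{\Sigma'}\rfloor\ge 0 \text{ for all }\Sigma'\in R(\Sigma)\}\cup\{0\},\qquad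 b\text{-}R(\boldsymbol D)=\bigoplus_{\ell\ge 0}H^0(X_\Sigma,\mathcal O(\ell\boldsymbol D)).$$ Let $\boldsymbol D$ be a nef toric $b$-divisor on $X_\Sigma$. Then there is a (unique) continuous, conical, concave function $\phi\colon N_{\mathbb R}\to\mathbb R$ with $\phi(v_\tau)=-a_\tau$ for all rays $\tau$ of all $\Sigma'\in R(\Sigma)$, where $v_\tau$ is the primitive generator of $\tau$. Let $\Delta_\phi=\{m\in M_{\mathbb R} : \langle m,v\rangle-\phi(v)\text{ is bounded below for }v\in N_{\mathbb R}\}$ be its stability set. Then: 1. $\boldsymbol D$ is Cartier if and only if $\Delta_\phi$ is a rational polytope (the convex hull of finitely many points of $M_{\mathbb Q}$). 2. If $\boldsymbol D$ is Cartier, then $b\text{-}R(\boldsymbol D)$ is a finitely generated $k$-algebra. 3. Suppose that $n\le 2$ or that the affine hull of $\Delta_\phi$ is spanned by points of $M_{\mathbb Q}$ (for instance, that $\Delta_\phi$ has non-empty interior, i.e. that $\boldsymbol D$ is big). If $b\text{-}R(\boldsymbol D)$ is a finitely generated $k$-algebra, then $\boldsymbol D$ is Cartier. In particular, under the assumption of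 3, $b\text{-}R(\boldsymbol D)$ is finitely generated if and only if $\boldsymbol D$ is Cartier, if and only if $\Delta_\phi$ is a rational polytope. -/

import Mathlib

open scoped Polynomial

noncomputable section

namespace ToricB

/-! ### Lattices

The lattice is `N = ℤⁿ`, with dual lattice `M = ℤⁿ`; the pairing is the dot product. -/

/-- The inclusion `N → N_ℝ` (and `M → M_ℝ`). -/
def toReal {n : ℕ} (v : Fin n → ℤ) : Fin n → ℝ := fun i => (v i : ℝ)

/-- The inclusion `M_ℚ → M_ℝ`. -/
def ratToReal {n : ℕ} (q : Fin n → ℚ) : Fin n → ℝ := fun i => (q i : ℝ)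

/-- Primitive lattice vectors (in particular nonzero). -/
def IsPrimitive {n : ℕ} (v : Fin n → ℤ) : Prop :=
  ∀ (d : ℤ) (w : Fin n → ℤ), v = d • w → IsUnit d

/-! ### Fans -/

/-- Cones in `N_ℝ`. -/
abbrev Cone (n : ℕ) := PointedCone ℝ (Fin n → ℝ)

/-- A cone is smooth if it is spanned by part of a `ℤ`-basis of `N`. Such a cone is
automatically rational, polyhedral and strongly convex. -/
def IsSmoothCone {n : ℕ} (σ : Cone n) : Prop :=
  ∃ (b : Module.Basis (Fin n) ℤ (Fin n → ℤ)) (s : Set (Fin n)),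
    σ = PointedCone.hull ℝ ((fun i => toReal (b i)) '' s)

/-- The ray spanned by a lattice vector. -/
def rayCone {n : ℕ} (v : Fin n → ℤ) : Cone n := PointedCone.hull ℝ {toReal v}

/-- Smooth complete fans in `N_ℝ`. -/
structure Fan (n : ℕ) where
  /-- the cones of the fan -/
  cones : Set (Cone n)
  finite : cones.Finite
  smooth : ∀ σ ∈ cones, IsSmoothCone σ
  face_mem : ∀ σ ∈ cones, ∀ τ : Cone n, τ.IsFaceOf σ → τ ∈ cones
  inter_face : ∀ σ ∈ cones, ∀ τ ∈ cones, (σ ⊓ τ).IsFaceOf σ ∧ (σ ⊓ τ).IsFaceOf τ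
  complete : ∀ x : Fin n → ℝ, ∃ σ ∈ cones, x ∈ σ

/-- `Σ(1)`, each ray being represented by its primitive generator. -/
def Fan.rays {n : ℕ} (S : Fan n) : Set (Fin n → ℤ) :=
  {v | IsPrimitive v ∧ rayCone v ∈ S.cones}

/-- `S'` is a subdivision of `S` (both have support `N_ℝ`). -/
def Fan.Subdivides {n : ℕ} (S' S : Fan n) : Prop :=
  ∀ σ' ∈ S'.cones, ∃ σ ∈ S.cones, σ' ≤ σ

/-- `R(Σ)`: the smooth fans subdividing `Σ`. -/
abbrev Model {n : ℕ} (S : Fan n) := {S' : Fan n // S'.Subdivides S}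

/-! ### Toric divisors -/

/-- Toric `ℚ`-Weil divisors `∑ a_τ D_τ` on the toric variety of `S`. The rays are finitely many,
and all Weil divisors are Cartier, since the fan is smooth. -/
abbrev ToricDivisor {n : ℕ} (S : Fan n) := S.rays → ℚ

open Classical in
/-- Push-forward of toric divisors along the morphism given by a subdivision `S''` of `S'`:
`D_τ` goes to `D_τ` if `τ` is a ray of `S'`, and to `0` otherwise. -/
def pushforward {n : ℕ} {S'' S' : Fan n} (D : ToricDivisor S'') : ToricDivisor S' :=
  fun v => if h : (v : Fin n → ℤ) ∈ S''.rays then D ⟨v, h⟩ else 0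

/-- `ψ` is the virtual support function of the toric divisor `D`: it is continuous, it is given
on every cone by an element of `M_ℚ`, and `ψ (v_τ) = - a_τ` for every ray. -/
structure IsSupportFunction {n : ℕ} {S : Fan n} (D : ToricDivisor S) (ψ : (Fin n → ℝ) → ℝ) :
    Prop where
  continuous : Continuous ψ
  linear : ∀ σ ∈ S.cones, ∃ m : Fin n → ℚ, ∀ u ∈ σ, ψ u = ratToReal m ⬝ᵥ u
  ray : ∀ v : S.rays, ψ (toReal (v : Fin n → ℤ)) = -(D v : ℝ)

/-- A toric divisor is nef: its support function is concave. -/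
def ToricDivisor.IsNef {n : ℕ} {S : Fan n} (D : ToricDivisor S) : Prop :=
  ∃ ψ, IsSupportFunction D ψ ∧ ConcaveOn ℝ Set.univ ψ

/-- `D''` (on a subdivision `S''` of `S'`) is the pull-back of `D'`: pulling back a toric
`ℚ`-Cartier divisor does not change its support function. -/
def IsPullback {n : ℕ} {S'' S' : Fan n} (D'' : ToricDivisor S'') (D' : ToricDivisor S') : Prop :=
  ∃ ψ, IsSupportFunction D' ψ ∧ IsSupportFunction D'' ψ

/-! ### Toric b-divisors -/

/-- Toric (Weil) b-divisors with `ℚ`-coefficients: elements of the inverse limit, under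
push-forward, of the groups of toric divisors on all models. -/
structure BDivisor {n : ℕ} (S : Fan n) where
  /-- the incarnation on a model -/
  inc : ∀ S' : Model S, ToricDivisor S'.1
  compat : ∀ S'' S' : Model S, S''.1.Subdivides S'.1 → pushforward (inc S'') = inc S'

/-- The multiple `ℓ D`. -/
def BDivisor.mul {n : ℕ} {S : Fan n} (l : ℕ) (D : BDivisor S) : BDivisor S where
  inc S' v := l * D.inc S' v
  compat S'' S' h := by
    funext v
    have := congrFun (D.compat S'' S' h) v
    simp only [pushforward] at this ⊢
    split_ifs at this ⊢ with hv <;> simp [← this]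

/-- Nef toric b-divisors: the incarnations are nef on a cofinal set of models. -/
def BDivisor.IsNef {n : ℕ} {S : Fan n} (D : BDivisor S) : Prop :=
  ∃ C : Set (Model S), (∀ S' : Model S, ∃ S'' ∈ C, S''.1.Subdivides S'.1) ∧
    ∀ S' ∈ C, (D.inc S').IsNef

/-- Cartier toric b-divisors: those determined on some model. -/
def BDivisor.IsCartier {n : ℕ} {S : Fan n} (D : BDivisor S) : Prop :=
  ∃ S' : Model S, ∀ S'' : Model S, S''.1.Subdivides S'.1 → IsPullback (D.inc S'') (D.inc S')

/-- `φ` is the concave function of the b-divisor `D`: the continuous concave extension to `N_ℝ`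
of the conical function on `N_ℚ` that takes the value `- a_τ` at `v_τ`, for the rays `τ` of all
models (every primitive lattice vector occurs among the `v_τ`). -/
structure BDivisor.IsConcaveFunction {n : ℕ} {S : Fan n} (D : BDivisor S)
    (φ : (Fin n → ℝ) → ℝ) : Prop where
  continuous : Continuous φ
  concave : ConcaveOn ℝ Set.univ φ
  conical : ∀ (t : ℝ) (x : Fin n → ℝ), 0 ≤ t → φ (t • x) = t * φ x
  ray : ∀ (S' : Model S) (v : S'.1.rays), φ (toReal (v : Fin n → ℤ)) = -(D.inc S' v : ℝ)

/-! ### Convex sets in `M_ℝ` -/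

/-- The stability set of a concave function. -/
def stabilitySet {n : ℕ} (φ : (Fin n → ℝ) → ℝ) : Set (Fin n → ℝ) :=
  {m | BddBelow (Set.range fun v => m ⬝ᵥ v - φ v)}

/-- Rational polytopes: convex hulls of finitely many points of `M_ℚ`. -/
def IsRationalPolytope {n : ℕ} (P : Set (Fin n → ℝ)) : Prop :=
  ∃ s : Finset (Fin n → ℚ), P = convexHull ℝ (ratToReal '' (s : Set (Fin n → ℚ)))

/-- The affine hull of `P` is a rational affine subspace, i.e. it is spanned by points of `M_ℚ`. -/
def HasRationalAffineHull {n : ℕ} (P : Set (Fin n → ℝ)) : Prop :=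
  ∃ s : Set (Fin n → ℚ), affineSpan ℝ (ratToReal '' s) = affineSpan ℝ P

/-! ### Rational functions and global sections

The toric variety `X` of a fan is covered by the affine charts `Spec k[σ^∨ ∩ M]`, all of them
with function field `k(X) = Frac k[M]`. A prime divisor of `X` is a prime ideal of height one of
the ring of a chart; `X` being normal, its local ring is a discrete valuation ring of `k(X)`. -/

/-- The ring `k[M]` of the torus. -/
abbrev TorusRing (k : Type*) [Field k] (n : ℕ) := AddMonoidAlgebra k (Fin n → ℤ)

/-- The field `k(X)`. -/
abbrev FunctionField (k : Type*) [Field k] (n : ℕ) := FractionRing (TorusRing k n)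

/-- The character `χ^m`. -/
def character (k : Type*) [Field k] {n : ℕ} (m : Fin n → ℤ) : TorusRing k n :=
  AddMonoidAlgebra.single m 1

/-- The ring `k[σ^∨ ∩ M]`. -/
def chart (k : Type*) [Field k] {n : ℕ} (σ : Cone n) : Subalgebra k (TorusRing k n) :=
  Algebra.adjoin k {f | ∃ m : Fin n → ℤ, (∀ u ∈ σ, 0 ≤ toReal m ⬝ᵥ u) ∧ f = character k m}

/-- `V` is the localization of the chart ring `A` at `p`, as a subring of `k(X)`. -/
def IsLocalRingAt {k : Type*} [Field k] {n : ℕ} (A : Subalgebra k (TorusRing k n)) (p : Ideal A)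
    (V : ValuationSubring (FunctionField k n)) : Prop :=
  ∀ f : FunctionField k n, f ∈ V ↔ ∃ a b : A, b ∉ p ∧
    f * algebraMap (TorusRing k n) (FunctionField k n) (b : TorusRing k n) =
      algebraMap (TorusRing k n) (FunctionField k n) (a : TorusRing k n)

/-- `V` is the local ring of a prime divisor of the toric variety of `S`. -/
def IsPrimeDivisor {k : Type*} [Field k] {n : ℕ} (S : Fan n)
    (V : ValuationSubring (FunctionField k n)) : Prop :=
  ∃ σ ∈ S.cones, ∃ p : Ideal (chart k σ), p.IsPrime ∧ p.height = 1 ∧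
    IsLocalRingAt (chart k σ) p V

/-- The ideal of the toric prime divisor `D_τ` in the ring of the chart of the ray `τ = ℝ≥0 v`. -/
def toricIdeal (k : Type*) [Field k] {n : ℕ} (v : Fin n → ℤ) : Ideal (chart k (rayCone v)) :=
  Ideal.span {a | ∃ m : Fin n → ℤ, 0 < m ⬝ᵥ v ∧ (a : TorusRing k n) = character k m}

/-- `V` is the local ring of the toric prime divisor `D_τ`, where `v = v_τ`. -/
def IsToricPrime {k : Type*} [Field k] {n : ℕ} (v : Fin n → ℤ)
    (V : ValuationSubring (FunctionField k n)) : Prop :=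
  IsLocalRingAt (chart k (rayCone v)) (toricIdeal k v) V

/-- The normalized discrete valuation of `V` is at least `j` at `f`; here `ϖ` is a uniformizer. -/
def OrdGE {K : Type*} [Field K] (V : ValuationSubring K) (j : ℤ) (f : K) : Prop :=
  ∀ ϖ : V, Irreducible ϖ → V.valuation f ≤ V.valuation (ϖ : K) ^ j

/-- `div f + ⌊D⌋ ≥ 0` on the toric variety of `S` (or `f = 0`): the coefficient of `⌊D⌋` is
`⌊a_τ⌋` along `D_τ` and zero along all other prime divisors. -/
def IsSection {k : Type*} [Field k] {n : ℕ} {S : Fan n} (D : ToricDivisor S)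
    (f : FunctionField k n) : Prop :=
  ∀ V : ValuationSubring (FunctionField k n), IsPrimeDivisor S V →
    (∀ v : S.rays, IsToricPrime (v : Fin n → ℤ) V → OrdGE V (-⌊D v⌋) f) ∧
    ((∀ v : S.rays, ¬ IsToricPrime (v : Fin n → ℤ) V) → OrdGE V 0 f)

section helpers

variable {K : Type*} [Field K] {V : ValuationSubring K}

theorem ordGE_zero (j : ℤ) : OrdGE V j 0 := fun ϖ _ => by simp

theorem OrdGE.add {j : ℤ} {f g : K} (hf : OrdGE V j f) (hg : OrdGE V j g) : OrdGE V j (f + g) :=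
  fun ϖ h => (V.valuation.map_add f g).trans (max_le (hf ϖ h) (hg ϖ h))

theorem OrdGE.mul {i j : ℤ} {f g : K} (hf : OrdGE V i f) (hg : OrdGE V j g) :
    OrdGE V (i + j) (f * g) := fun ϖ h => by
  have h0 : V.valuation (ϖ : K) ≠ 0 := by
    rw [Valuation.ne_zero_iff]
    exact fun h' => h.ne_zero (Subtype.ext h')
  rw [map_mul, zpow_add₀ h0]
  exact mul_le_mul' (hf ϖ h) (hg ϖ h)

theorem OrdGE.mono {i j : ℤ} (hij : j ≤ i) {f : K} (hf : OrdGE V i f) : OrdGE V j f :=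
  fun ϖ h => by
  have h0 : V.valuation (ϖ : K) ≠ 0 := by
    rw [Valuation.ne_zero_iff]
    exact fun h' => h.ne_zero (Subtype.ext h')
  refine (hf ϖ h).trans ?_
  exact zpow_le_zpow_right_of_le_one₀ (zero_lt_iff.mpr h0) (V.valuation_le_one ϖ) hij

theorem ordGE_of_mem {f : K} (hf : f ∈ V) : OrdGE V 0 f := fun ϖ _ => by
  simpa using (V.valuation_le_one_iff f).2 hf

variable {k : Type*} [Field k] {n : ℕ} {S : Fan n}

theorem IsPrimeDivisor.algebraMap_mem {V : ValuationSubring (FunctionField k n)}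
    (hV : IsPrimeDivisor S V) (c : k) : algebraMap k (FunctionField k n) c ∈ V := by
  obtain ⟨σ, -, p, hp, -, h⟩ := hV
  refine (h _).2 ⟨algebraMap k _ c, 1, fun h1 => hp.ne_top ((Ideal.eq_top_iff_one p).2 h1), ?_⟩
  simp only [OneMemClass.coe_one, map_one, mul_one, Subalgebra.coe_algebraMap]
  exact IsScalarTower.algebraMap_apply k (TorusRing k n) (FunctionField k n) c

theorem IsSection.mul {D D' : ToricDivisor S} {f g : FunctionField k n} (hf : IsSection D f)
    (hg : IsSection D' g) : IsSection (D + D') (f * g) := fun V hV => by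
  refine ⟨fun v hv => ?_, fun h => ?_⟩
  · refine (((hf V hV).1 v hv).mul ((hg V hV).1 v hv)).mono ?_
    have := Int.le_floor_add (D v) (D' v)
    simp only [Pi.add_apply]
    omega
  · simpa using ((hf V hV).2 h).mul ((hg V hV).2 h)

theorem isSection_zero_algebraMap (c : k) :
    IsSection (0 : ToricDivisor S) (algebraMap k (FunctionField k n) c) := fun V hV => by
  have := ordGE_of_mem (hV.algebraMap_mem c)
  exact ⟨fun v _ => by simpa using this, fun _ => this⟩

end helpers

/-- `H⁰(X, O(D))` for a toric b-divisor `D`: the rational functions `f` with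
`b-div f + ⌊D⌋ ≥ 0`, together with `0`. -/
def BDivisor.H0 (k : Type*) [Field k] {n : ℕ} {S : Fan n} (D : BDivisor S) :
    Submodule k (FunctionField k n) where
  carrier := {f | ∀ S' : Model S, IsSection (D.inc S') f}
  zero_mem' _ _ _ := ⟨fun _ _ => ordGE_zero _, fun _ => ordGE_zero _⟩
  add_mem' hf hg S' V hV :=
    ⟨fun v hv => ((hf S' V hV).1 v hv).add ((hg S' V hV).1 v hv),
      fun h => ((hf S' V hV).2 h).add ((hg S' V hV).2 h)⟩
  smul_mem' c f hf S' := by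
    have := (isSection_zero_algebraMap (S := S'.1) c).mul (hf S')
    rwa [zero_add, ← Algebra.smul_def] at this

/-- The ring `b-R(D) = ⊕_ℓ H⁰(X, O(ℓ D))`, with `t` keeping track of the degree: the
polynomials `∑ f_ℓ t^ℓ` with `f_ℓ ∈ H⁰(X, O(ℓ D))`. -/
def BDivisor.sectionRing (k : Type*) [Field k] {n : ℕ} {S : Fan n} (D : BDivisor S) :
    Subalgebra k (FunctionField k n)[X] where
  carrier := {F | ∀ l : ℕ, F.coeff l ∈ (BDivisor.mul l D).H0 k}
  add_mem' hF hG l := by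
    rw [Polynomial.coeff_add]
    exact Submodule.add_mem _ (hF l) (hG l)
  mul_mem' := by
    intro F G hF hG l
    rw [Polynomial.coeff_mul]
    refine Submodule.sum_mem _ fun x hx S' => ?_
    have := (hF x.1 S').mul (hG x.2 S')
    have hx : x.1 + x.2 = l := Finset.HasAntidiagonal.mem_antidiagonal.1 hx
    convert this using 1
    funext v
    simp [BDivisor.mul, ← hx, add_mul]
  algebraMap_mem' c l := by
    rw [Polynomial.algebraMap_apply, Polynomial.coeff_C]
    split_ifs with h
    · subst h
      intro S'
      convert isSection_zero_algebraMap (S := S'.1) c using 1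
      funext v
      simp [BDivisor.mul]
    · exact Submodule.zero_mem _

end ToricB

end

open scoped Polynomial

noncomputable section

namespace ToricB

variable {n : ℕ}

/-! ### Lattice vectors and their real counterparts -/

/-! The b-divisor is encoded by one conical concave function `φ` on `N_ℝ`. The concave support
functions of the nef incarnations can only grow under subdivision, because a support function
interpolates linearly between rays and a concave function lies above such an interpolation. They
stay below `-ψ(-x)` for any fixed member `ψ` of the family, so their supremum `φ` is finite, conical
and concave. Every primitive vector spans a ray of some model, and rational directions are dense;
hence conditions imposed on all models at once become conditions on `φ` over `N_ℝ`
(`IsConical.le_of_primitive`).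

Being Cartier means that `φ` is linear with rational slopes on the cones of one model. By
Hahn–Banach `φ` is the minimum of the linear forms in its stability set `Δ`. If `Δ` is the hull of
finitely many rational points, then `φ` is the minimum of finitely many rational forms, and a smooth
subdivision along the hyperplanes where two of them agree makes `φ` linear on every cone.
Conversely, the slopes on the full-dimensional cones dominate `φ` by concavity, and `Δ` is their
convex hull.

For the sections, `k[M]` is a unique factorization domain, so a function regular on the torus is a
Laurent polynomial, and its order along `D_τ` is the least `⟨m, v_τ⟩` over its support. Thus
`H⁰(ℓD)` is spanned by the characters in `ℓΔ`, and the section ring is the semigroup ring of `Γ =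
{(ℓ, m) : m ∈ ℓΔ}`. It is finitely generated exactly when `Γ` is. Gordan's lemma gives generators of
`Γ` when `Δ` is a rational polytope. Conversely, generators of `Γ` divided by their degrees span a
polytope that contains all rational points of `Δ`, and these are dense in `Δ` when its affine hull
is rational. If `n ≤ 2` and `Δ` is not full-dimensional, then `Δ` is a point or a segment, and its
endpoints are rational because `φ` takes rational values on `N`.

The existence of enough models is combinatorial. A smooth complete fan is treated as a simplicial
complex of generator sets, and star subdivisions at sums `a + b` remove the edges crossing a given
hyperplane (`Fan.exists_subdivides_oneSided`). Common subdivisions, and models with a prescribed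
ray, follow from this. -/

theorem toReal_injective : Function.Injective (toReal : (Fin n → ℤ) → Fin n → ℝ) := by
  intro v w h
  funext i
  exact Int.cast_injective (α := ℝ) (congrFun h i)

theorem toReal_add (v w : Fin n → ℤ) : toReal (v + w) = toReal v + toReal w := by
  funext i; simp [toReal]

theorem toReal_smul (d : ℤ) (v : Fin n → ℤ) : toReal (d • v) = (d : ℝ) • toReal v := by
  funext i; simp [toReal]

theorem toReal_zero : toReal (0 : Fin n → ℤ) = 0 := by
  funext i; simp [toReal]

theorem toReal_sub (v w : Fin n → ℤ) : toReal (v - w) = toReal v - toReal w := by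
  funext i; simp [toReal]

theorem toReal_dotProduct (m v : Fin n → ℤ) : toReal m ⬝ᵥ toReal v = ((m ⬝ᵥ v : ℤ) : ℝ) := by
  simp [dotProduct, toReal]

/-- The element of the dual lattice given by the `i`-th coordinate function of a basis. -/
def dualVec (b : Module.Basis (Fin n) ℤ (Fin n → ℤ)) (i : Fin n) : Fin n → ℤ :=
  fun j => b.coord i (Pi.single j 1)

theorem dualVec_dotProduct (b : Module.Basis (Fin n) ℤ (Fin n → ℤ)) (i : Fin n) (w : Fin n → ℤ) :
    dualVec b i ⬝ᵥ w = b.repr w i := by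
  conv_rhs => rw [← b.coord_apply, LinearMap.pi_apply_eq_sum_univ (b.coord i) w]
  simp only [dotProduct, dualVec, smul_eq_mul]
  refine Finset.sum_congr rfl fun j _ => ?_
  rw [mul_comm]
  congr 2
  funext l
  simp [Pi.single_apply, eq_comm]

theorem dualVec_dotProduct_self (b : Module.Basis (Fin n) ℤ (Fin n → ℤ)) (i j : Fin n) :
    dualVec b i ⬝ᵥ b j = if j = i then 1 else 0 := by
  rw [dualVec_dotProduct, b.repr_self, Finsupp.single_apply]

/-- The integral expansion in the basis `b` is applied to the standard basis vectors and extended by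
`ℝ`-linearity. -/
theorem sum_dualVec_smul (b : Module.Basis (Fin n) ℤ (Fin n → ℤ)) (x : Fin n → ℝ) :
    ∑ i, (toReal (dualVec b i) ⬝ᵥ x) • toReal (b i) = x := by
  have key : ∀ j : Fin n, ∑ i, ((dualVec b i j : ℤ) : ℝ) • toReal (b i) = Pi.single j 1 := by
    intro j
    have h := b.sum_repr (Pi.single j 1)
    have h2 := congrArg toReal h
    have h3 : toReal (Pi.single j 1 : Fin n → ℤ) = Pi.single j 1 := by
      funext l
      by_cases hl : l = j
      · subst hl; simp [toReal]
      · simp [toReal, hl]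
    rw [h3] at h2
    rw [← h2]
    funext l
    simp [toReal, dualVec]
  have h4 : x = ∑ j, x j • (Pi.single j (1 : ℝ) : Fin n → ℝ) := by
    funext l
    simp [Finset.sum_apply, Pi.single_apply]
  conv_rhs => rw [h4]
  simp_rw [← key, Finset.smul_sum]
  rw [Finset.sum_comm]
  refine Finset.sum_congr rfl fun i _ => ?_
  rw [dotProduct, Finset.sum_smul]
  refine Finset.sum_congr rfl fun j _ => ?_
  rw [smul_smul, mul_comm]
  rfl

/-! ### Cones spanned by finitely many lattice vectors -/

/-- The point with given coefficients at the lattice vectors. -/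
def realize : ((Fin n → ℤ) →₀ ℝ) →ₗ[ℝ] (Fin n → ℝ) := Finsupp.linearCombination ℝ toReal

theorem realize_single (v : Fin n → ℤ) (t : ℝ) :
    realize (Finsupp.single v t) = t • toReal v := by
  simp [realize]

theorem realize_eq_sum {F : Finset (Fin n → ℤ)} {c : (Fin n → ℤ) →₀ ℝ} (hc : c.support ⊆ F) :
    realize c = ∑ v ∈ F, c v • toReal v := by
  rw [realize, Finsupp.linearCombination_apply, Finsupp.sum_of_support_subset c hc]
  simp

/-- The cone spanned by a finite set of lattice vectors. -/
def coneOf (F : Finset (Fin n → ℤ)) : Cone n := PointedCone.hull ℝ (toReal '' (F : Set (Fin n → ℤ)))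

theorem smul_mem_cone {σ : Cone n} {x : Fin n → ℝ} (hx : x ∈ σ) {t : ℝ} (ht : 0 ≤ t) :
    t • x ∈ σ := σ.smul_mem ht hx

theorem mem_coneOf {F : Finset (Fin n → ℤ)} {x : Fin n → ℝ} :
    x ∈ coneOf F ↔ ∃ c : (Fin n → ℤ) →₀ ℝ, (∀ v, 0 ≤ c v) ∧ c.support ⊆ F ∧ realize c = x := by
  classical
  constructor
  · intro h
    induction h using Submodule.span_induction with
    | mem x hx =>
      obtain ⟨v, hv, rfl⟩ := hx
      refine ⟨Finsupp.single v 1, fun w => ?_, ?_, by simp [realize_single]⟩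
      · rw [Finsupp.single_apply]; split_ifs <;> norm_num
      · exact Finsupp.support_single_subset.trans (by simpa using hv)
    | zero => exact ⟨0, fun _ => le_rfl, by simp, by simp⟩
    | add x y _ _ hx hy =>
      obtain ⟨c, hc, hcs, rfl⟩ := hx
      obtain ⟨d, hd, hds, rfl⟩ := hy
      exact ⟨c + d, fun v => add_nonneg (hc v) (hd v),
        Finsupp.support_add.trans (Finset.union_subset hcs hds), by simp⟩
    | smul a x _ hx =>
      obtain ⟨c, hc, hcs, rfl⟩ := hx
      refine ⟨(a : ℝ) • c, fun v => mul_nonneg a.2 (hc v), Finsupp.support_smul.trans hcs, ?_⟩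
      rw [map_smul]; rfl
  · rintro ⟨c, hc, hcs, rfl⟩
    rw [realize_eq_sum hcs]
    refine Submodule.sum_mem _ fun v hv => smul_mem_cone (Submodule.subset_span ?_) (hc v)
    exact ⟨v, hv, rfl⟩

theorem toReal_mem_coneOf {F : Finset (Fin n → ℤ)} {v : Fin n → ℤ} (hv : v ∈ F) :
    toReal v ∈ coneOf F := Submodule.subset_span ⟨v, hv, rfl⟩

theorem coneOf_le {F : Finset (Fin n → ℤ)} {σ : Cone n} :
    coneOf F ≤ σ ↔ ∀ v ∈ F, toReal v ∈ σ := by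
  constructor
  · intro h v hv
    exact h (toReal_mem_coneOf hv)
  · intro h
    refine Submodule.span_le.2 ?_
    rintro _ ⟨v, hv, rfl⟩
    exact h v hv

theorem coneOf_mono {F G : Finset (Fin n → ℤ)} (h : F ⊆ G) : coneOf F ≤ coneOf G :=
  coneOf_le.2 fun _ hv => toReal_mem_coneOf (h hv)

theorem coneOf_singleton (v : Fin n → ℤ) : coneOf {v} = rayCone v := by
  simp [coneOf, rayCone]

theorem mem_rayCone {v : Fin n → ℤ} {x : Fin n → ℝ} :
    x ∈ rayCone v ↔ ∃ t : ℝ, 0 ≤ t ∧ x = t • toReal v := by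
  rw [← coneOf_singleton]
  constructor
  · intro h
    obtain ⟨c, hc, hcs, rfl⟩ := mem_coneOf.1 h
    exact ⟨c v, hc v, by rw [realize_eq_sum hcs]; simp⟩
  · rintro ⟨t, ht, rfl⟩
    exact smul_mem_cone (toReal_mem_coneOf (by simp)) ht

/-- Finite sets of lattice vectors that are part of a basis of the lattice. -/
def IsUnimodular (F : Finset (Fin n → ℤ)) : Prop :=
  ∃ b : Module.Basis (Fin n) ℤ (Fin n → ℤ), ∀ v ∈ F, v ∈ Set.range b

theorem IsUnimodular.mono {F G : Finset (Fin n → ℤ)} (hG : IsUnimodular G) (h : F ⊆ G) :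
    IsUnimodular F := by
  obtain ⟨b, hb⟩ := hG
  exact ⟨b, fun v hv => hb v (h hv)⟩

/-- The dual basis vector of `v` reads off the coefficient of `v`. It is the source of the
uniqueness of coefficients, of primitivity, and later of uniformizers. -/
theorem IsUnimodular.exists_dual {F : Finset (Fin n → ℤ)} (hF : IsUnimodular F)
    {v : Fin n → ℤ} (hv : v ∈ F) : ∃ m : Fin n → ℤ, m ⬝ᵥ v = 1 ∧ (∀ w ∈ F, w ≠ v → m ⬝ᵥ w = 0) ∧
      ∀ c : (Fin n → ℤ) →₀ ℝ, c.support ⊆ F → toReal m ⬝ᵥ realize c = c v := by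
  classical
  obtain ⟨b, hb⟩ := hF
  obtain ⟨i, rfl⟩ := hb v hv
  have h1 : dualVec b i ⬝ᵥ b i = 1 := by simp [dualVec_dotProduct_self]
  have h2 : ∀ w ∈ F, w ≠ b i → dualVec b i ⬝ᵥ w = 0 := by
    intro w hw hne
    obtain ⟨j, rfl⟩ := hb w hw
    rw [dualVec_dotProduct_self, if_neg]
    rintro rfl; exact hne rfl
  refine ⟨dualVec b i, h1, h2, fun c hc => ?_⟩
  rw [realize_eq_sum hc, dotProduct_sum, Finset.sum_eq_single (b i)]
  · rw [dotProduct_smul, toReal_dotProduct, h1]; simp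
  · intro w hw hne
    rw [dotProduct_smul, toReal_dotProduct, h2 w hw hne]; simp
  · intro h; exact absurd hv h

theorem IsUnimodular.realize_inj {F : Finset (Fin n → ℤ)} (hF : IsUnimodular F)
    {c d : (Fin n → ℤ) →₀ ℝ} (hc : c.support ⊆ F) (hd : d.support ⊆ F)
    (h : realize c = realize d) : c = d := by
  ext v
  by_cases hv : v ∈ F
  · obtain ⟨m, -, -, hm⟩ := hF.exists_dual hv
    rw [← hm c hc, ← hm d hd, h]
  · rw [Finsupp.notMem_support_iff.1 fun h' => hv (hc h'),
      Finsupp.notMem_support_iff.1 fun h' => hv (hd h')]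

theorem isPrimitive_of_dual {v m : Fin n → ℤ} (h : m ⬝ᵥ v = 1) : IsPrimitive v := by
  rintro d w rfl
  rw [dotProduct_smul, smul_eq_mul] at h
  exact IsUnit.of_mul_eq_one _ h

theorem IsUnimodular.isPrimitive {F : Finset (Fin n → ℤ)} (hF : IsUnimodular F)
    {v : Fin n → ℤ} (hv : v ∈ F) : IsPrimitive v := by
  obtain ⟨m, hm, -⟩ := hF.exists_dual hv
  exact isPrimitive_of_dual hm

theorem IsPrimitive.ne_zero {v : Fin n → ℤ} (hv : IsPrimitive v) : v ≠ 0 := by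
  intro h
  simpa using hv 0 0 (by simpa using h)

/-- A primitive vector on the ray of a primitive vector `v` equals `v`. -/
theorem IsPrimitive.eq_of_smul {g v m : Fin n → ℤ} (hg : IsPrimitive g) (hm : m ⬝ᵥ v = 1) {t : ℝ}
    (ht : 0 ≤ t) (h : toReal g = t • toReal v) : g = v := by
  have h1 : t = ((m ⬝ᵥ g : ℤ) : ℝ) := by
    rw [← toReal_dotProduct, h, dotProduct_smul, toReal_dotProduct, hm]; simp
  have h2 : g = (m ⬝ᵥ g) • v := by
    apply toReal_injective
    rw [toReal_smul, ← h1, h]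
  have h3 : 0 ≤ m ⬝ᵥ g := by
    rw [h1] at ht; exact_mod_cast ht
  have h4 : m ⬝ᵥ g = 1 := by
    rcases Int.isUnit_iff.1 (hg _ _ h2) with h | h
    · exact h
    · omega
  rw [h4, one_smul] at h2
  exact h2

/-- By uniqueness the coefficients of `x` and `y` add up to those of `x + y`; being nonnegative,
they vanish wherever the sum does. -/
theorem isFaceOf_coneOf {F G : Finset (Fin n → ℤ)} (hF : IsUnimodular F) (h : G ⊆ F) :
    (coneOf G).IsFaceOf (coneOf F) := by
  classical
  refine PointedCone.IsFaceOf.of_mem_of_add_mem_left (coneOf_mono h) ?_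
  intro x y hx hy hxy
  obtain ⟨c, hc, hcs, rfl⟩ := mem_coneOf.1 hx
  obtain ⟨d, hd, hds, rfl⟩ := mem_coneOf.1 hy
  obtain ⟨e, he, hes, hh⟩ := mem_coneOf.1 hxy
  have : c + d = e := hF.realize_inj
    (Finsupp.support_add.trans (Finset.union_subset hcs hds)) (hes.trans h) (by rw [map_add, hh])
  refine mem_coneOf.2 ⟨c, hc, fun v hv => ?_, rfl⟩
  by_contra hvG
  have h0 : e v = 0 := Finsupp.notMem_support_iff.1 fun h' => hvG (hes h')
  have h1 : c v + d v = 0 := by rw [← h0, ← this]; rfl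
  have h2 : c v = 0 := le_antisymm (by linarith [hd v]) (hc v)
  exact Finsupp.mem_support_iff.1 hv h2

/-- A face that contains a sum of elements of the cone contains the summands; here `c v • v` is
split off from `c.erase v`. -/
theorem toReal_mem_of_realize_mem {F : Finset (Fin n → ℤ)} {τ : Cone n}
    (hτ : τ.IsFaceOf (coneOf F)) {c : (Fin n → ℤ) →₀ ℝ} (hc : ∀ v, 0 ≤ c v)
    (hcs : c.support ⊆ F) (h : realize c ∈ τ) {v : Fin n → ℤ} (hv : v ∈ c.support) :
    toReal v ∈ τ := by
  classical
  have h0 : 0 < c v := lt_of_le_of_ne (hc v) (Finsupp.mem_support_iff.1 hv).symm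
  refine hτ.mem_of_smul_add_mem (y := realize (c.erase v)) (toReal_mem_coneOf (hcs hv))
    (mem_coneOf.2 ⟨c.erase v, fun w => ?_, ?_, rfl⟩) h0 ?_
  · rw [Finsupp.erase_apply]; split_ifs
    · exact le_rfl
    · exact hc w
  · rw [Finsupp.support_erase]; exact (Finset.erase_subset _ _).trans hcs
  · rwa [← realize_single, ← map_add, Finsupp.single_add_erase]

open Classical in
theorem eq_coneOf_of_isFaceOf {F : Finset (Fin n → ℤ)} {τ : Cone n}
    (hτ : τ.IsFaceOf (coneOf F)) : τ = coneOf (F.filter fun v => toReal v ∈ τ) := by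
  apply le_antisymm
  · intro x hx
    obtain ⟨c, hc, hcs, rfl⟩ := mem_coneOf.1 (hτ.le hx)
    refine mem_coneOf.2 ⟨c, hc, fun v hv => ?_, rfl⟩
    exact Finset.mem_filter.2 ⟨hcs hv, toReal_mem_of_realize_mem hτ hc hcs hx hv⟩
  · exact coneOf_le.2 fun v hv => (Finset.mem_filter.1 hv).2

/-- A generator `v` of one set spans a ray that is a face of the common cone. A generator `g` of the
other set occurring in `v` lies on that ray, and primitivity gives `g = v`. -/
theorem subset_of_coneOf_eq {F G : Finset (Fin n → ℤ)} (hF : IsUnimodular F)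
    (hG : IsUnimodular G) (h : coneOf F = coneOf G) : F ⊆ G := by
  classical
  intro v hv
  have hface : (coneOf {v}).IsFaceOf (coneOf G) :=
    h ▸ isFaceOf_coneOf hF (Finset.singleton_subset_iff.2 hv)
  obtain ⟨m, hm, -⟩ := hF.exists_dual hv
  obtain ⟨c, hc, hcs, hcv⟩ := mem_coneOf.1 (hface.le (toReal_mem_coneOf (Finset.mem_singleton_self v)))
  have hne : c.support.Nonempty := by
    rw [Finset.nonempty_iff_ne_empty]
    intro h0
    rw [Finsupp.support_eq_empty.1 h0, map_zero, ← toReal_zero] at hcv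
    exact (isPrimitive_of_dual hm).ne_zero (toReal_injective hcv).symm
  obtain ⟨g, hg⟩ := hne
  have hgv : toReal g ∈ coneOf {v} := toReal_mem_of_realize_mem hface hc hcs
    (hcv ▸ toReal_mem_coneOf (Finset.mem_singleton_self v)) hg
  rw [coneOf_singleton] at hgv
  obtain ⟨t, ht, hgt⟩ := mem_rayCone.1 hgv
  rw [← (hG.isPrimitive (hcs hg)).eq_of_smul hm ht hgt]
  exact hcs hg

theorem coneOf_injOn : Set.InjOn (coneOf (n := n)) {F | IsUnimodular F} :=
  fun _ hF _ hG h => (subset_of_coneOf_eq hF hG h).antisymm (subset_of_coneOf_eq hG hF h.symm)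

theorem isSmoothCone_iff {σ : Cone n} : IsSmoothCone σ ↔ ∃ F, IsUnimodular F ∧ coneOf F = σ := by
  classical
  constructor
  · rintro ⟨b, s, rfl⟩
    refine ⟨s.toFinset.image b, ⟨b, fun v hv => ?_⟩, ?_⟩
    · obtain ⟨i, -, rfl⟩ := Finset.mem_image.1 hv
      exact ⟨i, rfl⟩
    · simp [coneOf, Set.image_image]
  · rintro ⟨F, ⟨b, hb⟩, rfl⟩
    refine ⟨b, b ⁻¹' F, ?_⟩
    rw [coneOf, ← Set.image_image toReal b, Set.image_preimage_eq_of_subset]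
    exact hb

end ToricB

namespace ToricB

variable {n : ℕ}

/-! ### Smooth complete fans as simplicial complexes -/

/-- A smooth complete fan, given by the sets of primitive generators of its cones: every point of
the space is a combination, with positive coefficients, of the elements of exactly one of them. -/
structure UnimodularComplex (n : ℕ) where
  /-- the sets of generators of the cones -/
  faces : Set (Finset (Fin n → ℤ))
  finite : faces.Finite
  unimodular : ∀ F ∈ faces, IsUnimodular F
  down_closed : ∀ F ∈ faces, ∀ G ⊆ F, G ∈ faces
  exists_rep : ∀ x : Fin n → ℝ, ∃ c : (Fin n → ℤ) →₀ ℝ,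
    (∀ v, 0 ≤ c v) ∧ c.support ∈ faces ∧ realize c = x
  rep_unique : ∀ c d : (Fin n → ℤ) →₀ ℝ, (∀ v, 0 ≤ c v) → c.support ∈ faces → (∀ v, 0 ≤ d v) →
    d.support ∈ faces → realize c = realize d → c = d

theorem UnimodularComplex.coneOf_inf (K : UnimodularComplex n) [DecidableEq (Fin n → ℤ)]
    {F G : Finset (Fin n → ℤ)} (hF : F ∈ K.faces) (hG : G ∈ K.faces) :
    coneOf F ⊓ coneOf G = coneOf (F ∩ G) := by
  apply le_antisymm
  · rintro x ⟨hxF, hxG⟩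
    obtain ⟨c, hc, hcs, rfl⟩ := mem_coneOf.1 hxF
    obtain ⟨d, hd, hds, hcd⟩ := mem_coneOf.1 hxG
    have : d = c := K.rep_unique d c hd (K.down_closed G hG _ hds) hc (K.down_closed F hF _ hcs) hcd
    subst this
    exact mem_coneOf.2 ⟨d, hd, Finset.subset_inter hcs hds, rfl⟩
  · exact le_inf (coneOf_mono Finset.inter_subset_left) (coneOf_mono Finset.inter_subset_right)

/-- The fan of a complex. -/
def UnimodularComplex.toFan (K : UnimodularComplex n) : Fan n where
  cones := coneOf '' K.faces
  finite := K.finite.image _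
  smooth := by
    rintro _ ⟨F, hF, rfl⟩
    exact isSmoothCone_iff.2 ⟨F, K.unimodular F hF, rfl⟩
  face_mem := by
    classical
    rintro _ ⟨F, hF, rfl⟩ τ hτ
    rw [eq_coneOf_of_isFaceOf hτ]
    exact ⟨_, K.down_closed F hF _ (Finset.filter_subset _ _), rfl⟩
  inter_face := by
    classical
    rintro _ ⟨F, hF, rfl⟩ _ ⟨G, hG, rfl⟩
    rw [K.coneOf_inf hF hG]
    exact ⟨isFaceOf_coneOf (K.unimodular F hF) Finset.inter_subset_left,
      isFaceOf_coneOf (K.unimodular G hG) Finset.inter_subset_right⟩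
  complete := by
    intro x
    obtain ⟨c, hc, hcs, rfl⟩ := K.exists_rep x
    exact ⟨_, ⟨_, hcs, rfl⟩, mem_coneOf.2 ⟨c, hc, subset_rfl, rfl⟩⟩

theorem Fan.exists_rep (S : Fan n) (x : Fin n → ℝ) : ∃ c : (Fin n → ℤ) →₀ ℝ,
    (∀ v, 0 ≤ c v) ∧ (IsUnimodular c.support ∧ coneOf c.support ∈ S.cones) ∧ realize c = x := by
  obtain ⟨σ, hσ, hx⟩ := S.complete x
  obtain ⟨F, hF, rfl⟩ := isSmoothCone_iff.1 (S.smooth σ hσ)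
  obtain ⟨c, hc, hcs, rfl⟩ := mem_coneOf.1 hx
  exact ⟨c, hc, ⟨hF.mono hcs, S.face_mem _ hσ _ (isFaceOf_coneOf hF hcs)⟩, rfl⟩

/-- If the sum of the generators of a cone (or any combination of them with positive coefficients)
lies in another cone of the fan, then so does the cone. -/
theorem Fan.coneOf_le_of_realize_mem (S : Fan n) {c : (Fin n → ℤ) →₀ ℝ} (hc : ∀ v, 0 ≤ c v)
    (hcs : coneOf c.support ∈ S.cones) {τ : Cone n} (hτ : τ ∈ S.cones) (h : realize c ∈ τ) :
    coneOf c.support ≤ τ := by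
  have hmem : realize c ∈ coneOf c.support := mem_coneOf.2 ⟨c, hc, subset_rfl, rfl⟩
  refine coneOf_le.2 fun v hv => ?_
  exact (toReal_mem_of_realize_mem (S.inter_face _ hcs _ hτ).1 hc subset_rfl ⟨hmem, h⟩ hv).2

/-- The complex of a fan. -/
def Fan.toComplex (S : Fan n) : UnimodularComplex n where
  faces := {F | IsUnimodular F ∧ coneOf F ∈ S.cones}
  finite := by
    refine Set.Finite.of_finite_image (f := coneOf) (S.finite.subset ?_) ?_
    · rintro _ ⟨F, hF, rfl⟩
      exact hF.2
    · exact coneOf_injOn.mono fun F hF => hF.1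
  unimodular F hF := hF.1
  down_closed F hF G hG := ⟨hF.1.mono hG, S.face_mem _ hF.2 _ (isFaceOf_coneOf hF.1 hG)⟩
  exists_rep := S.exists_rep
  rep_unique c d hc hcs hd hds h := by
    -- The common point is relatively interior to both cones, so each is contained in the other.
    have h1 : coneOf c.support ≤ coneOf d.support := S.coneOf_le_of_realize_mem hc hcs.2 hds.2
      (h ▸ mem_coneOf.2 ⟨d, hd, subset_rfl, rfl⟩)
    have h2 : coneOf d.support ≤ coneOf c.support := S.coneOf_le_of_realize_mem hd hds.2 hcs.2
      (h ▸ mem_coneOf.2 ⟨c, hc, subset_rfl, rfl⟩)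
    have h3 := coneOf_injOn hcs.1 hds.1 (le_antisymm h1 h2)
    exact hcs.1.realize_inj subset_rfl h3.ge h

theorem Fan.Subdivides.refl (S : Fan n) : S.Subdivides S := fun σ hσ => ⟨σ, hσ, le_rfl⟩

theorem Fan.Subdivides.trans {S S' S'' : Fan n} (h : S''.Subdivides S') (h' : S'.Subdivides S) :
    S''.Subdivides S := by
  intro σ hσ
  obtain ⟨τ, hτ, h1⟩ := h σ hσ
  obtain ⟨ρ, hρ, h2⟩ := h' τ hτ
  exact ⟨ρ, hρ, h1.trans h2⟩

/-! ### Star subdivisions -/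

/-- Replacing `b` by `a + b` in a part of a basis. -/
theorem IsUnimodular.transvection {F G : Finset (Fin n → ℤ)} (hG : IsUnimodular G)
    {a b : Fin n → ℤ} (ha : a ∈ G) (hb : b ∈ G) (hab : a ≠ b)
    (h : ∀ v ∈ F, v = a + b ∨ (v ∈ G ∧ v ≠ b)) : IsUnimodular F := by
  obtain ⟨B, hB⟩ := hG
  obtain ⟨i, rfl⟩ := hB a ha
  obtain ⟨j, rfl⟩ := hB b hb
  have hij : i ≠ j := by rintro rfl; exact hab rfl
  have h0 : B.coord j (B i) = 0 := by simp [hij]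
  -- The elementary transformation that adds the `j`-th coordinate times `B i`; since `B i` has zero
  -- `j`-th coordinate, subtracting inverts it.
  let e : (Fin n → ℤ) ≃ₗ[ℤ] (Fin n → ℤ) := LinearEquiv.ofLinearMap
    (LinearMap.id + (B.coord j).smulRight (B i)) (LinearMap.id - (B.coord j).smulRight (B i))
    (LinearMap.ext fun x => by
      simp only [LinearMap.comp_apply, LinearMap.add_apply, LinearMap.sub_apply,
        LinearMap.smulRight_apply, LinearMap.id_apply, map_sub, map_smul, h0]
      simp)
    (LinearMap.ext fun x => by
      simp only [LinearMap.comp_apply, LinearMap.add_apply, LinearMap.sub_apply,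
        LinearMap.smulRight_apply, LinearMap.id_apply, map_add, map_smul, h0]
      simp)
  refine ⟨B.map e, fun v hv => ?_⟩
  rcases h v hv with rfl | ⟨hvG, hvb⟩
  · exact ⟨j, by simp [e, add_comm]⟩
  · obtain ⟨l, rfl⟩ := hB v hvG
    have hlj : l ≠ j := by rintro rfl; exact hvb rfl
    exact ⟨l, by simp [e, hlj]⟩

namespace UnimodularComplex

variable (K : UnimodularComplex n) {a b : Fin n → ℤ}

/-- Otherwise the point `a + b` would have two representations: by itself, and as the sum of `a` and
`b` on the cone of `{a, b}`. -/
theorem add_notMem [DecidableEq (Fin n → ℤ)] (hne : a ≠ b) (hab : {a, b} ∈ K.faces)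
    {F : Finset (Fin n → ℤ)} (hF : F ∈ K.faces) : a + b ∉ F := by
  intro hw
  have hb0 : b ≠ 0 := ((K.unimodular _ hab).isPrimitive (by simp)).ne_zero
  have h1 : Finsupp.single (a + b) (1 : ℝ) = Finsupp.single a 1 + Finsupp.single b 1 := by
    refine K.rep_unique _ _ (fun v => ?_) (K.down_closed F hF _ ?_) (fun v => ?_)
      (K.down_closed _ hab _ ?_) ?_
    · rw [Finsupp.single_apply]; split_ifs <;> norm_num
    · exact Finsupp.support_single_subset.trans (Finset.singleton_subset_iff.2 hw)
    · rw [Finsupp.add_apply, Finsupp.single_apply, Finsupp.single_apply]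
      split_ifs <;> norm_num
    · refine Finsupp.support_add.trans (Finset.union_subset ?_ ?_) <;>
      refine Finsupp.support_single_subset.trans (by simp)
    · rw [map_add, realize_single, realize_single, realize_single, toReal_add]; simp
  have h2 := DFunLike.congr_fun h1 a
  simp [hb0, hne.symm] at h2

/-- Moving the coefficient of `a + b` to `a` and `b`. -/
def collapse (a b : Fin n → ℤ) (c : (Fin n → ℤ) →₀ ℝ) : (Fin n → ℤ) →₀ ℝ :=
  c - Finsupp.single (a + b) (c (a + b)) + Finsupp.single a (c (a + b)) +
    Finsupp.single b (c (a + b))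

theorem realize_collapse (a b : Fin n → ℤ) (c : (Fin n → ℤ) →₀ ℝ) :
    realize (collapse a b c) = realize c := by
  simp only [collapse, map_add, map_sub, realize_single, toReal_add, smul_add]
  abel

open Classical in
/-- The sets of generators of the cones of the star subdivision at `a + b`. -/
def starFaces (a b : Fin n → ℤ) : Set (Finset (Fin n → ℤ)) :=
  {F | ¬ (a ∈ F ∧ b ∈ F) ∧
    (F ∈ K.faces ∨ (a + b ∈ F ∧ insert a (insert b (F.erase (a + b))) ∈ K.faces))}

open Classical in
/-- The star subdivision along a two-dimensional cone. -/
def star (hne : a ≠ b) (hab : {a, b} ∈ K.faces) : UnimodularComplex n :=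
  have hwa : a + b ≠ a := by
    simpa using ((K.unimodular _ hab).isPrimitive (v := b) (by simp)).ne_zero
  have hwb : a + b ≠ b := by
    simpa using ((K.unimodular _ hab).isPrimitive (v := a) (by simp)).ne_zero
  { faces := K.starFaces a b
    finite := by
      refine (K.finite.biUnion fun G _ =>
        Finset.finite_toSet (insert (a + b) G).powerset).subset ?_
      rintro F ⟨-, hF | ⟨hw, hF⟩⟩
      · refine Set.mem_biUnion hF ?_
        rw [Finset.mem_coe, Finset.mem_powerset]
        exact Finset.subset_insert _ _
      · refine Set.mem_biUnion hF ?_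
        rw [Finset.mem_coe, Finset.mem_powerset]
        intro v hv
        by_cases h : v = a + b <;> simp [h, hv]
    unimodular := by
      rintro F ⟨hn, hF | ⟨hw, hF⟩⟩
      · exact K.unimodular F hF
      · have hU := K.unimodular _ hF
        -- At most one of `a`, `b` lies in `F`; one that is missing is the basis vector replaced by
        -- `a + b`.
        by_cases hbF : b ∈ F
        · have haF : a ∉ F := fun h => hn ⟨h, hbF⟩
          refine hU.transvection (a := b) (b := a) (by simp) (by simp) hne.symm fun v hv => ?_
          by_cases h : v = a + b
          · left; rw [h, add_comm]
          · right
            refine ⟨by simp [h, hv], ?_⟩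
            rintro rfl; exact haF hv
        · refine hU.transvection (a := a) (b := b) (by simp) (by simp) hne fun v hv => ?_
          by_cases h : v = a + b
          · left; exact h
          · right
            refine ⟨by simp [h, hv], ?_⟩
            rintro rfl; exact hbF hv
    down_closed := by
      rintro F ⟨hn, hF⟩ G hG
      refine ⟨fun h => hn ⟨hG h.1, hG h.2⟩, ?_⟩
      rcases hF with hF | ⟨hw, hF⟩
      · exact Or.inl (K.down_closed F hF G hG)
      · by_cases hwG : a + b ∈ G
        · refine Or.inr ⟨hwG, K.down_closed _ hF _ ?_⟩
          exact Finset.insert_subset_insert _ (Finset.insert_subset_insert _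
            (Finset.erase_subset_erase _ hG))
        · refine Or.inl (K.down_closed _ hF _ fun v hv => ?_)
          have : v ≠ a + b := by rintro rfl; exact hwG hv
          simp [this, hG hv]
    exists_rep := by
      intro x
      obtain ⟨c, hc, hcs, rfl⟩ := K.exists_rep x
      have hcw : c (a + b) = 0 := Finsupp.notMem_support_iff.1 (K.add_notMem hne hab hcs)
      -- The largest amount that can be moved from `a` and `b` to `a + b`; one of the two
      -- coefficients becomes zero.
      set t := min (c a) (c b) with ht
      have ht0 : 0 ≤ t := le_min (hc a) (hc b)
      set d := c - Finsupp.single a t - Finsupp.single b t + Finsupp.single (a + b) t with hd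
      have hda : d a = c a - t := by simp [hd, hne, hwa]
      have hdb : d b = c b - t := by simp [hd, hne.symm, hwb]
      have hdw : d (a + b) = t := by
        simp [hd, hcw, Finsupp.single_eq_of_ne hwa, Finsupp.single_eq_of_ne hwb]
      have hdo : ∀ v, v ≠ a → v ≠ b → v ≠ a + b → d v = c v := by
        intro v h1 h2 h3
        simp [hd, h1, h2, h3]
      refine ⟨d, fun v => ?_, ⟨?_, ?_⟩, ?_⟩
      · by_cases h1 : v = a
        · rw [h1, hda]; linarith [min_le_left (c a) (c b)]
        by_cases h2 : v = b
        · rw [h2, hdb]; linarith [min_le_right (c a) (c b)]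
        by_cases h3 : v = a + b
        · rw [h3, hdw]; exact ht0
        · rw [hdo v h1 h2 h3]; exact hc v
      · rintro ⟨h1, h2⟩
        rw [Finsupp.mem_support_iff, hda] at h1
        rw [Finsupp.mem_support_iff, hdb] at h2
        rcases min_choice (c a) (c b) with h | h
        · exact h1 (by rw [ht, h]; ring)
        · exact h2 (by rw [ht, h]; ring)
      · rcases ht0.eq_or_lt with h0 | h0
        · left
          have : d = c := by rw [hd, ← h0]; simp
          rw [this]; exact hcs
        · right
          have ha : a ∈ c.support := Finsupp.mem_support_iff.2
            (lt_of_lt_of_le h0 (min_le_left _ _)).ne'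
          have hb : b ∈ c.support := Finsupp.mem_support_iff.2
            (lt_of_lt_of_le h0 (min_le_right _ _)).ne'
          refine ⟨Finsupp.mem_support_iff.2 (by rw [hdw]; exact h0.ne'),
            K.down_closed _ hcs _ fun v hv => ?_⟩
          by_cases h1 : v = a
          · rw [h1]; exact ha
          by_cases h2 : v = b
          · rw [h2]; exact hb
          simp only [Finset.mem_insert, h1, h2, Finset.mem_erase, false_or] at hv
          rw [Finsupp.mem_support_iff, ← hdo v h1 h2 hv.1]
          exact Finsupp.mem_support_iff.1 hv.2
      · simp only [hd, map_add, map_sub, realize_single, toReal_add, smul_add]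
        abel
    rep_unique := by
      -- `collapse` produces the representation in `K`, from which the coefficient of `a + b` is
      -- recovered as a minimum. Uniqueness thus descends from `K`.
      have key : ∀ c : (Fin n → ℤ) →₀ ℝ, (∀ v, 0 ≤ c v) → c.support ∈ K.starFaces a b →
          (∀ v, 0 ≤ collapse a b c v) ∧ (collapse a b c).support ∈ K.faces ∧
          c (a + b) = min (collapse a b c a) (collapse a b c b) := by
        intro c hc hcs
        have hda : collapse a b c a = c a + c (a + b) := by
          simp [collapse, hne, hwa]
        have hdb : collapse a b c b = c b + c (a + b) := by
          simp [collapse, hne.symm, hwb]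
        have hdw : collapse a b c (a + b) = 0 := by
          simp [collapse, Finsupp.single_eq_of_ne hwa, Finsupp.single_eq_of_ne hwb]
        have hdo : ∀ v, v ≠ a → v ≠ b → v ≠ a + b → collapse a b c v = c v := by
          intro v h1 h2 h3
          simp [collapse, h1, h2, h3]
        refine ⟨fun v => ?_, ?_, ?_⟩
        · by_cases h1 : v = a
          · rw [h1, hda]; exact add_nonneg (hc _) (hc _)
          by_cases h2 : v = b
          · rw [h2, hdb]; exact add_nonneg (hc _) (hc _)
          by_cases h3 : v = a + b
          · rw [h3, hdw]
          · rw [hdo v h1 h2 h3]; exact hc v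
        · by_cases h0 : c (a + b) = 0
          · have : collapse a b c = c := by simp [collapse, h0]
            rw [this]
            rcases hcs.2 with h | h
            · exact h
            · exact absurd h0 (Finsupp.mem_support_iff.1 h.1)
          · have hw := Finsupp.mem_support_iff.2 h0
            rcases hcs.2 with h | h
            · exact absurd hw (K.add_notMem hne hab h)
            · refine K.down_closed _ h.2 _ fun v hv => ?_
              by_cases h1 : v = a
              · simp [h1]
              by_cases h2 : v = b
              · simp [h2]
              by_cases h3 : v = a + b
              · rw [h3] at hv; exact absurd hdw (Finsupp.mem_support_iff.1 hv)
              rw [Finsupp.mem_support_iff, hdo v h1 h2 h3] at hv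
              simp [h3, hv]
        · rw [hda, hdb]
          by_cases h : c a = 0
          · rw [h, zero_add, min_eq_left]; linarith [hc b]
          · have : c b = 0 := by
              by_contra h'
              exact hcs.1 ⟨Finsupp.mem_support_iff.2 h, Finsupp.mem_support_iff.2 h'⟩
            rw [this, zero_add, min_eq_right]; linarith [hc a]
      intro c d hc hcs hd hds h
      obtain ⟨c1, c2, c3⟩ := key c hc hcs
      obtain ⟨d1, d2, d3⟩ := key d hd hds
      have h1 := K.rep_unique _ _ c1 c2 d1 d2 (by rw [realize_collapse, realize_collapse, h])
      have h2 : c (a + b) = d (a + b) := by rw [c3, d3, h1]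
      rw [collapse, collapse, h2] at h1
      simpa using h1 }

theorem star_subdivides [DecidableEq (Fin n → ℤ)] (hne : a ≠ b) (hab : {a, b} ∈ K.faces) :
    (K.star hne (by convert hab)).toFan.Subdivides K.toFan := by
  classical
  rintro _ ⟨F, ⟨-, hF | ⟨-, hF⟩⟩, rfl⟩
  · exact ⟨_, ⟨F, hF, rfl⟩, le_rfl⟩
  · refine ⟨_, ⟨_, hF, rfl⟩, coneOf_le.2 fun v hv => ?_⟩
    by_cases h : v = a + b
    · rw [h, toReal_add]
      exact add_mem (toReal_mem_coneOf (by simp)) (toReal_mem_coneOf (by simp))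
    · exact toReal_mem_coneOf (by simp [h, hv])

end UnimodularComplex

end ToricB

namespace ToricB

variable {n : ℕ}

/-! ### Subdividing along hyperplanes -/

/-- The cone lies on one side of the hyperplane orthogonal to `m`. -/
def OneSided (m : Fin n → ℤ) (σ : Cone n) : Prop :=
  (∀ u ∈ σ, 0 ≤ toReal m ⬝ᵥ u) ∨ (∀ u ∈ σ, toReal m ⬝ᵥ u ≤ 0)

theorem OneSided.mono {m : Fin n → ℤ} {σ τ : Cone n} (h : OneSided m τ) (hle : σ ≤ τ) :
    OneSided m σ :=
  h.imp (fun h u hu => h u (hle hu)) (fun h u hu => h u (hle hu))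

theorem dotProduct_nonneg_of_coneOf {m : Fin n → ℤ} {F : Finset (Fin n → ℤ)}
    (h : ∀ v ∈ F, 0 ≤ m ⬝ᵥ v) {u : Fin n → ℝ} (hu : u ∈ coneOf F) : 0 ≤ toReal m ⬝ᵥ u := by
  obtain ⟨c, hc, hcs, rfl⟩ := mem_coneOf.1 hu
  rw [realize_eq_sum hcs, dotProduct_sum]
  refine Finset.sum_nonneg fun v hv => ?_
  rw [dotProduct_smul, toReal_dotProduct, smul_eq_mul]
  exact mul_nonneg (hc v) (by exact_mod_cast h v hv)

theorem dotProduct_nonpos_of_coneOf {m : Fin n → ℤ} {F : Finset (Fin n → ℤ)}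
    (h : ∀ v ∈ F, m ⬝ᵥ v ≤ 0) {u : Fin n → ℝ} (hu : u ∈ coneOf F) : toReal m ⬝ᵥ u ≤ 0 := by
  have h1 := dotProduct_nonneg_of_coneOf (m := -m) (F := F)
    (fun v hv => by rw [neg_dotProduct]; linarith [h v hv]) hu
  have h2 : toReal (-m) = -toReal m := by funext i; simp [toReal]
  rw [h2, neg_dotProduct] at h1
  linarith

namespace UnimodularComplex

open Classical in
/-- The edges that cross the hyperplane orthogonal to `m`. -/
def crossing (K : UnimodularComplex n) (m : Fin n → ℤ) : Set ((Fin n → ℤ) × (Fin n → ℤ)) :=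
  {p | {p.1, p.2} ∈ K.faces ∧ 0 < m ⬝ᵥ p.1 ∧ m ⬝ᵥ p.2 < 0}

theorem crossing_finite (K : UnimodularComplex n) (m : Fin n → ℤ) : (K.crossing m).Finite := by
  classical
  refine (K.finite.biUnion fun F _ => Finset.finite_toSet (F ×ˢ F)).subset ?_
  rintro ⟨a, b⟩ ⟨h, -⟩
  exact Set.mem_biUnion h (by simp)

theorem oneSided_of_crossing_eq_empty {K : UnimodularComplex n} {m : Fin n → ℤ}
    (h : K.crossing m = ∅) : ∀ σ ∈ K.toFan.cones, OneSided m σ := by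
  classical
  rintro _ ⟨F, hF, rfl⟩
  by_cases h1 : ∀ v ∈ F, 0 ≤ m ⬝ᵥ v
  · exact Or.inl fun u hu => dotProduct_nonneg_of_coneOf h1 hu
  · push Not at h1
    obtain ⟨b, hb, hmb⟩ := h1
    refine Or.inr fun u hu => dotProduct_nonpos_of_coneOf (fun a ha => ?_) hu
    by_contra! hma
    have : (a, b) ∈ K.crossing m :=
      ⟨K.down_closed F hF _ (by intro v; simp; rintro (rfl | rfl) <;> assumption), hma, hmb⟩
    rw [h] at this
    exact this

/-- A new crossing edge has `a + b` as an endpoint. Since `⟨m, a + b⟩` lies strictly between `⟨m,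
b⟩` and `⟨m, a⟩`, it is strictly narrower than the old crossing edge with `a` or `b` in place of `a
+ b`. -/
theorem crossing_star {K : UnimodularComplex n} {m a b : Fin n → ℤ} {N : ℤ}
    (hN : ∀ p ∈ K.crossing m, m ⬝ᵥ p.1 - m ⬝ᵥ p.2 ≤ N) (hab : (a, b) ∈ K.crossing m)
    (hne : a ≠ b) {p : (Fin n → ℤ) × (Fin n → ℤ)} (hp : p ∈ (K.star hne hab.1).crossing m) :
    (p ∈ K.crossing m ∧ p ≠ (a, b)) ∨ m ⬝ᵥ p.1 - m ⬝ᵥ p.2 < N := by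
  classical
  obtain ⟨x, y⟩ := p
  obtain ⟨⟨hn, hF⟩, hx, hy⟩ := hp
  obtain ⟨hab, ha, hb⟩ := hab
  simp only at hx hy hF hn ha hb hab ⊢
  rcases hF with hF | ⟨hw, hF⟩
  · refine Or.inl ⟨⟨hF, hx, hy⟩, fun h => hn ?_⟩
    obtain ⟨rfl, rfl⟩ := Prod.mk.inj h
    simp
  · right
    simp only [Finset.mem_insert, Finset.mem_singleton] at hw
    have hmw : m ⬝ᵥ (a + b) = m ⬝ᵥ a + m ⬝ᵥ b := dotProduct_add _ _ _
    rcases hw with rfl | rfl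
    · have hyw : y ≠ a + b := by rintro rfl; omega
      have := hN (a, y) ⟨K.down_closed _ hF _ (by intro v; simp; rintro (rfl | rfl) <;> simp [hyw]),
        ha, hy⟩
      simp only at this
      omega
    · have hxw : x ≠ a + b := by rintro rfl; omega
      have := hN (x, b) ⟨K.down_closed _ hF _ (by intro v; simp; rintro (rfl | rfl) <;> simp [hxw]),
        hx, hb⟩
      simp only at this
      omega

/-- Lexicographic induction on a bound for the widths of the crossing edges and on the number of
edges attaining it. A star subdivision at an edge of maximal width removes this edge and creates
only narrower crossing edges. -/
theorem exists_crossing_eq_empty (m : Fin n → ℤ) (N : ℕ) : ∀ K : UnimodularComplex n,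
    (∀ p ∈ K.crossing m, m ⬝ᵥ p.1 - m ⬝ᵥ p.2 ≤ N) →
    ∃ K' : UnimodularComplex n, K'.toFan.Subdivides K.toFan ∧ K'.crossing m = ∅ := by
  classical
  induction N with
  | zero =>
    intro K hK
    refine ⟨K, Fan.Subdivides.refl _, Set.eq_empty_of_forall_notMem fun p hp => ?_⟩
    -- A crossing edge has width at least 2, so none is left.
    have h1 := hK p hp
    have h2 := hp.2.1
    have h3 := hp.2.2
    push_cast at h1
    omega
  | succ N ih =>
    suffices H : ∀ c : ℕ, ∀ K : UnimodularComplex n,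
        (∀ p ∈ K.crossing m, m ⬝ᵥ p.1 - m ⬝ᵥ p.2 ≤ (N + 1 : ℕ)) →
        {p ∈ K.crossing m | m ⬝ᵥ p.1 - m ⬝ᵥ p.2 = (N + 1 : ℕ)}.ncard ≤ c →
        ∃ K' : UnimodularComplex n, K'.toFan.Subdivides K.toFan ∧ K'.crossing m = ∅ from
      fun K hK => H _ K hK le_rfl
    intro c
    induction c with
    | zero =>
      intro K hK hc
      refine ih K fun p hp => ?_
      have hfin := (K.crossing_finite m).subset
        (Set.sep_subset _ fun p => m ⬝ᵥ p.1 - m ⬝ᵥ p.2 = (N + 1 : ℕ))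
      have h0 := (Set.ncard_eq_zero hfin).1 (Nat.le_zero.1 hc)
      have h1 := hK p hp
      have h2 : m ⬝ᵥ p.1 - m ⬝ᵥ p.2 ≠ (N + 1 : ℕ) := fun h => by
        have : p ∈ {p ∈ K.crossing m | m ⬝ᵥ p.1 - m ⬝ᵥ p.2 = (N + 1 : ℕ)} := ⟨hp, h⟩
        rw [h0] at this
        exact this
      push_cast at h1 h2
      omega
    | succ c ihc =>
      intro K hK hc
      by_cases hex : ∃ p ∈ K.crossing m, m ⬝ᵥ p.1 - m ⬝ᵥ p.2 = (N + 1 : ℕ)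
      · obtain ⟨⟨a, b⟩, hab, hd⟩ := hex
        have hne : a ≠ b := by
          rintro rfl
          have h1 := hab.2.1
          have h2 := hab.2.2
          simp only at h1 h2
          omega
        have hstar := fun p hp => crossing_star hK hab hne (p := p) hp
        obtain ⟨K', h1, h2⟩ := ihc (K.star hne hab.1) (fun p hp => by
            rcases hstar p hp with h | h
            · exact hK p h.1
            · exact h.le) (by
          have hfin := (K.crossing_finite m).subset
            (Set.sep_subset _ fun p => m ⬝ᵥ p.1 - m ⬝ᵥ p.2 = (N + 1 : ℕ))
          have hsub : {p ∈ (K.star hne hab.1).crossing m | m ⬝ᵥ p.1 - m ⬝ᵥ p.2 = (N + 1 : ℕ)} ⊆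
              {p ∈ K.crossing m | m ⬝ᵥ p.1 - m ⬝ᵥ p.2 = (N + 1 : ℕ)} \ {(a, b)} := by
            rintro p ⟨hp, hpd⟩
            rcases hstar p hp with h | h
            · exact ⟨⟨h.1, hpd⟩, h.2⟩
            · exact absurd hpd h.ne
          have h1 := Set.ncard_le_ncard hsub hfin.sdiff
          have hmem : (a, b) ∈ {p ∈ K.crossing m | m ⬝ᵥ p.1 - m ⬝ᵥ p.2 = (N + 1 : ℕ)} := ⟨hab, hd⟩
          have h2 := Set.ncard_sdiff_singleton_add_one hmem hfin
          omega)
        exact ⟨K', h1.trans (K.star_subdivides hne hab.1), h2⟩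
      · push Not at hex
        refine ihc K hK ?_
        have : {p ∈ K.crossing m | m ⬝ᵥ p.1 - m ⬝ᵥ p.2 = (N + 1 : ℕ)} = ∅ :=
          Set.eq_empty_of_forall_notMem fun p hp => hex p hp.1 hp.2
        rw [this]; simp

end UnimodularComplex

theorem Fan.toComplex_toFan_cones (S : Fan n) : S.toComplex.toFan.cones = S.cones := by
  ext σ
  constructor
  · rintro ⟨F, hF, rfl⟩
    exact hF.2
  · intro hσ
    obtain ⟨F, hF, rfl⟩ := isSmoothCone_iff.1 (S.smooth σ hσ)
    exact ⟨F, ⟨hF, hσ⟩, rfl⟩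

/-- Every smooth fan has a smooth subdivision along finitely many rational hyperplanes. -/
theorem Fan.exists_subdivides_oneSided (S : Fan n) (T : Finset (Fin n → ℤ)) :
    ∃ S' : Fan n, S'.Subdivides S ∧ ∀ σ ∈ S'.cones, ∀ m ∈ T, OneSided m σ := by
  classical
  induction T using Finset.induction_on with
  | empty => exact ⟨S, Fan.Subdivides.refl _, by simp⟩
  | insert m T _ ih =>
    obtain ⟨S', h1, h2⟩ := ih
    set K := S'.toComplex with hK
    obtain ⟨N, hN⟩ := ((K.crossing_finite m).image fun p => m ⬝ᵥ p.1 - m ⬝ᵥ p.2).bddAbove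
    obtain ⟨K', h3, h4⟩ := UnimodularComplex.exists_crossing_eq_empty m N.toNat K
      fun p hp => (hN ⟨p, hp, rfl⟩).trans (Int.self_le_toNat N)
    have h5 : K'.toFan.Subdivides S' := by
      intro σ hσ
      obtain ⟨τ, hτ, hle⟩ := h3 σ hσ
      exact ⟨τ, by rwa [hK, Fan.toComplex_toFan_cones] at hτ, hle⟩
    refine ⟨K'.toFan, h5.trans h1, fun σ hσ m' hm' => ?_⟩
    rcases Finset.mem_insert.1 hm' with rfl | hm'
    · exact UnimodularComplex.oneSided_of_crossing_eq_empty h4 σ hσ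
    · obtain ⟨τ, hτ, hle⟩ := h5 σ hσ
      exact (h2 τ hτ m' hm').mono hle

/-! ### Consequences for the set of models -/

/-- A linear form with constant sign on a cone that vanishes at a point with positive coefficients
vanishes on the generators. -/
theorem OneSided.dotProduct_nonneg {m : Fin n → ℤ} {c : (Fin n → ℤ) →₀ ℝ} (hc : ∀ v, 0 ≤ c v)
    (h : OneSided m (coneOf c.support)) (h0 : 0 ≤ toReal m ⬝ᵥ realize c) :
    ∀ u ∈ coneOf c.support, 0 ≤ toReal m ⬝ᵥ u := by
  rcases h with h | h
  · exact h
  · have hv : ∀ v ∈ c.support, m ⬝ᵥ v ≤ 0 := fun v hv => by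
      have := h _ (toReal_mem_coneOf hv)
      rw [toReal_dotProduct] at this
      exact_mod_cast this
    have hz : ∀ v ∈ c.support, c v * ((m ⬝ᵥ v : ℤ) : ℝ) = 0 := by
      rw [realize_eq_sum subset_rfl, dotProduct_sum] at h0
      simp only [dotProduct_smul, toReal_dotProduct, smul_eq_mul] at h0
      have hle : ∀ v ∈ c.support, c v * ((m ⬝ᵥ v : ℤ) : ℝ) ≤ 0 := fun v hv' =>
        mul_nonpos_of_nonneg_of_nonpos (hc v) (by exact_mod_cast hv v hv')
      exact (Finset.sum_eq_zero_iff_of_nonpos hle).1 (le_antisymm (Finset.sum_nonpos hle) h0)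
    refine fun u hu => dotProduct_nonneg_of_coneOf (fun v hv' => ?_) hu
    have := (mul_eq_zero.1 (hz v hv')).resolve_left (Finsupp.mem_support_iff.1 hv')
    exact_mod_cast this.ge

/-- With full support, `realize c` is a relatively interior point of `coneOf F`. For one-sided
forms, nonnegativity at this point decides nonnegativity on the whole cone. -/
theorem exists_realize_eq (F : Finset (Fin n → ℤ)) : ∃ c : (Fin n → ℤ) →₀ ℝ,
    (∀ v, 0 ≤ c v) ∧ c.support = F := by
  classical
  refine ⟨Finsupp.onFinset F (fun v => if v ∈ F then 1 else 0) (by simp), fun v => ?_, ?_⟩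
  · simp only [Finsupp.onFinset_apply]; split_ifs <;> norm_num
  · ext v; simp

theorem dualVec_dotProduct_of_mem_hull {b : Module.Basis (Fin n) ℤ (Fin n → ℤ)} {s : Set (Fin n)}
    {x : Fin n → ℝ} (hx : x ∈ PointedCone.hull ℝ ((fun i => toReal (b i)) '' s)) (i : Fin n) :
    0 ≤ toReal (dualVec b i) ⬝ᵥ x ∧ (i ∉ s → toReal (dualVec b i) ⬝ᵥ x = 0) := by
  induction hx using Submodule.span_induction with
  | mem x hx =>
    obtain ⟨j, hj, rfl⟩ := hx
    simp only [toReal_dotProduct, dualVec_dotProduct_self]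
    constructor
    · split_ifs <;> simp
    · intro hi
      rw [if_neg]
      · simp
      · rintro rfl; exact hi hj
  | zero => simp
  | add x y _ _ hx hy =>
    rw [dotProduct_add]
    exact ⟨add_nonneg hx.1 hy.1, fun hi => by rw [hx.2 hi, hy.2 hi, add_zero]⟩
  | smul a x _ hx =>
    have : a • x = (a : ℝ) • x := rfl
    rw [this, dotProduct_smul, smul_eq_mul]
    exact ⟨mul_nonneg a.2 hx.1, fun hi => by rw [hx.2 hi, mul_zero]⟩

/-- Any two smooth fans have a common smooth subdivision. -/
theorem Fan.exists_common_subdivision (S S' : Fan n) :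
    ∃ S'' : Fan n, S''.Subdivides S ∧ S''.Subdivides S' := by
  classical
  have : Nonempty (Module.Basis (Fin n) ℤ (Fin n → ℤ)) := ⟨Pi.basisFun ℤ (Fin n)⟩
  choose! b s hbs using S'.smooth
  -- The coordinate forms of the cones of `S'`. Both signs are included, so that a form vanishing at
  -- the relatively interior point below is seen to vanish on the whole cone.
  let T : Finset (Fin n → ℤ) := S'.finite.toFinset.biUnion fun σ =>
    Finset.univ.image (dualVec (b σ)) ∪ Finset.univ.image (fun i => -dualVec (b σ) i)
  obtain ⟨S'', h1, h2⟩ := S.exists_subdivides_oneSided T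
  refine ⟨S'', h1, fun σ hσ => ?_⟩
  obtain ⟨F, hF, rfl⟩ := isSmoothCone_iff.1 (S''.smooth σ hσ)
  obtain ⟨c, hc, rfl⟩ := exists_realize_eq F
  obtain ⟨τ, hτ, hx⟩ := S'.complete (realize c)
  refine ⟨τ, hτ, fun u hu => ?_⟩
  have hpos : ∀ i, 0 ≤ toReal (dualVec (b τ) i) ⬝ᵥ realize c →
      0 ≤ toReal (dualVec (b τ) i) ⬝ᵥ u := fun i hi => by
    refine (h2 _ hσ _ ?_).dotProduct_nonneg hc hi u hu
    exact Finset.mem_biUnion.2 ⟨τ, by simpa using hτ,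
      Finset.mem_union_left _ (Finset.mem_image_of_mem _ (Finset.mem_univ i))⟩
  have hneg : ∀ i, 0 ≤ toReal (-dualVec (b τ) i) ⬝ᵥ realize c →
      0 ≤ toReal (-dualVec (b τ) i) ⬝ᵥ u := fun i hi => by
    refine (h2 _ hσ _ ?_).dotProduct_nonneg hc hi u hu
    exact Finset.mem_biUnion.2 ⟨τ, by simpa using hτ,
      Finset.mem_union_right _ (Finset.mem_image_of_mem _ (Finset.mem_univ i))⟩
  have hnn : ∀ i, toReal (-dualVec (b τ) i) = -toReal (dualVec (b τ) i) := fun i => by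
    funext j; simp [toReal]
  have hτc : ∀ x ∈ τ, ∀ i, 0 ≤ toReal (dualVec (b τ) i) ⬝ᵥ x ∧
      (i ∉ s τ → toReal (dualVec (b τ) i) ⬝ᵥ x = 0) := by
    intro x hx i
    rw [hbs τ hτ] at hx
    exact dualVec_dotProduct_of_mem_hull hx i
  rw [hbs τ hτ, ← sum_dualVec_smul (b τ) u]
  refine Submodule.sum_mem _ fun i _ => ?_
  obtain ⟨h3, h4⟩ := hτc _ hx i
  by_cases hi : i ∈ s τ
  · exact smul_mem_cone (PointedCone.subset_hull (Set.mem_image_of_mem _ hi)) (hpos i h3)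
  · have h5 := hneg i (by rw [hnn, neg_dotProduct, h4 hi, neg_zero])
    rw [hnn, neg_dotProduct] at h5
    have h6 := hpos i h3
    rw [show toReal (dualVec (b τ) i) ⬝ᵥ u = 0 by linarith, zero_smul]
    exact Submodule.zero_mem _

/-- The ray is a smooth cone, so it is spanned by part of a lattice basis. Those generators are
primitive vectors on the ray of `v`, hence equal to `v`. -/
theorem Fan.mem_rays_iff (S : Fan n) {v : Fin n → ℤ} :
    v ∈ S.rays ↔ IsUnimodular {v} ∧ coneOf {v} ∈ S.cones := by
  constructor
  · rintro ⟨hv, hS⟩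
    rw [coneOf_singleton]
    refine ⟨?_, hS⟩
    obtain ⟨F, hF, hFv⟩ := isSmoothCone_iff.1 (S.smooth _ hS)
    have hsub : ∀ g ∈ F, g = v := by
      intro g hg
      obtain ⟨m, hm, -⟩ := hF.exists_dual hg
      obtain ⟨t, ht, hgt⟩ := mem_rayCone.1 (hFv ▸ toReal_mem_coneOf hg)
      have ht0 : t ≠ 0 := by
        rintro rfl
        rw [zero_smul, ← toReal_zero] at hgt
        exact (hF.isPrimitive hg).ne_zero (toReal_injective hgt)
      refine (hv.eq_of_smul hm (inv_nonneg.2 ht) ?_).symm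
      rw [hgt, smul_smul, inv_mul_cancel₀ ht0, one_smul]
    have hmem : toReal v ∈ coneOf F := by
      rw [hFv]; exact mem_rayCone.2 ⟨1, zero_le_one, by simp⟩
    obtain ⟨c, hc, hcs, hcv⟩ := mem_coneOf.1 hmem
    have hne : F.Nonempty := by
      rw [Finset.nonempty_iff_ne_empty]
      rintro rfl
      rw [Finset.subset_empty, Finsupp.support_eq_empty] at hcs
      rw [hcs, map_zero, ← toReal_zero] at hcv
      exact hv.ne_zero (toReal_injective hcv).symm
    obtain ⟨g, hg⟩ := hne
    exact hF.mono (Finset.singleton_subset_iff.2 (hsub g hg ▸ hg))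
  · rintro ⟨hv, hS⟩
    exact ⟨hv.isPrimitive (by simp), coneOf_singleton v ▸ hS⟩

theorem Fan.rays_of_mem_face (S : Fan n) {F : Finset (Fin n → ℤ)} (hF : IsUnimodular F)
    (hS : coneOf F ∈ S.cones) {v : Fin n → ℤ} (hv : v ∈ F) : v ∈ S.rays :=
  S.mem_rays_iff.2 (S.toComplex.down_closed F ⟨hF, hS⟩ _ (Finset.singleton_subset_iff.2 hv))

/-- A fan has a vector among its rays if the vector lies on a ray of the fan. -/
theorem Fan.mem_rays_of_realize (S : Fan n) {c : (Fin n → ℤ) →₀ ℝ} {v : Fin n → ℤ}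
    (hv : IsPrimitive v)
    (hcs : IsUnimodular c.support ∧ coneOf c.support ∈ S.cones) (hcv : realize c = toReal v)
    (h : ∀ g ∈ c.support, ∃ t : ℝ, 0 ≤ t ∧ toReal g = t • toReal v) : v ∈ S.rays := by
  have hne : c.support.Nonempty := by
    rw [Finset.nonempty_iff_ne_empty]
    intro h0
    rw [Finsupp.support_eq_empty.1 h0, map_zero, ← toReal_zero] at hcv
    exact hv.ne_zero (toReal_injective hcv).symm
  obtain ⟨g, hg⟩ := hne
  obtain ⟨m, hm, -⟩ := hcs.1.exists_dual hg
  obtain ⟨t, ht, hgt⟩ := h g hg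
  have ht0 : t ≠ 0 := by
    rintro rfl
    rw [zero_smul, ← toReal_zero] at hgt
    exact (hcs.1.isPrimitive hg).ne_zero (toReal_injective hgt)
  have : v = g := by
    refine hv.eq_of_smul hm (inv_nonneg.2 ht) ?_
    rw [hgt, smul_smul, inv_mul_cancel₀ ht0, one_smul]
  rw [this]
  exact S.rays_of_mem_face hcs.1 hcs.2 hg

/-- Take the cone of `S'` with `v` in its relative interior and a cone `σ` of `S` around it. The
face `rayCone v ⊓ σ` of `σ` cuts out a face of the small cone; it contains `v`, hence all
generators, which therefore lie on the ray of `v`. -/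
theorem Fan.Subdivides.rays_subset {S S' : Fan n} (h : S'.Subdivides S) : S.rays ⊆ S'.rays := by
  intro v hv
  obtain ⟨c, hc, hcs, hcv⟩ := S'.exists_rep (toReal v)
  refine S'.mem_rays_of_realize hv.1 hcs hcv fun g hg => ?_
  obtain ⟨σ, hσ, hle⟩ := h _ hcs.2
  have hvσ : toReal v ∈ σ := hcv ▸ hle (mem_coneOf.2 ⟨c, hc, subset_rfl, rfl⟩)
  have hface := (S.inter_face _ hv.2 _ hσ).2
  have hvr : toReal v ∈ rayCone v := mem_rayCone.2 ⟨1, zero_le_one, by simp⟩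
  have h1 : (rayCone v ⊓ σ ⊓ coneOf c.support).IsFaceOf (coneOf c.support) := by
    have := hface.inf (PointedCone.IsFaceOf.refl (coneOf c.support))
    rwa [inf_eq_right.2 hle] at this
  have h2 := toReal_mem_of_realize_mem h1 hc subset_rfl
    ⟨⟨hcv ▸ hvr, hcv ▸ hvσ⟩, mem_coneOf.2 ⟨c, hc, subset_rfl, rfl⟩⟩ hg
  exact mem_rayCone.1 h2.1.1

/-- Every primitive vector spans a ray of some subdivision. -/
theorem Fan.exists_subdivides_mem_rays (S : Fan n) {v : Fin n → ℤ} (hv : IsPrimitive v) :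
    ∃ S' : Fan n, S'.Subdivides S ∧ v ∈ S'.rays := by
  classical
  -- The forms `v i * x j - v j * x i` cut out the line through `v`. Exchanging `i` and `j` changes
  -- the sign, so one-sidedness forces them to vanish on the cone around `v`.
  let T : Finset (Fin n → ℤ) := Finset.univ.image fun p : Fin n × Fin n =>
    v p.1 • (Pi.single p.2 1 : Fin n → ℤ) - v p.2 • (Pi.single p.1 1 : Fin n → ℤ)
  obtain ⟨S', h1, h2⟩ := S.exists_subdivides_oneSided T
  refine ⟨S', h1, ?_⟩
  obtain ⟨c, hc, hcs, hcv⟩ := S'.exists_rep (toReal v)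
  refine S'.mem_rays_of_realize hv hcs hcv fun g hg => ?_
  have hdot : ∀ (i j : Fin n) (x : Fin n → ℝ),
      toReal (v i • (Pi.single j 1 : Fin n → ℤ) - v j • (Pi.single i 1 : Fin n → ℤ)) ⬝ᵥ x =
        v i * x j - v j * x i := by
    intro i j x
    have h3 : ∀ l : Fin n, toReal (Pi.single l 1 : Fin n → ℤ) = Pi.single l 1 := fun l => by
      funext a
      by_cases ha : a = l
      · subst ha; simp [toReal]
      · simp [toReal, ha]
    rw [toReal_sub, toReal_smul, toReal_smul, sub_dotProduct, smul_dotProduct, smul_dotProduct,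
      h3, h3]
    simp
  have hge : ∀ i j : Fin n, 0 ≤ (v i : ℝ) * toReal g j - v j * toReal g i := by
    intro i j
    rw [← hdot]
    refine (h2 _ hcs.2 _ (Finset.mem_image.2 ⟨(i, j), Finset.mem_univ _, rfl⟩)).dotProduct_nonneg
      hc ?_ _ (toReal_mem_coneOf hg)
    rw [hdot, hcv]
    simp only [toReal]
    exact le_of_eq (by ring)
  have heq : ∀ i j : Fin n, (v i : ℝ) * toReal g j = v j * toReal g i := fun i j =>
    le_antisymm (by linarith [hge j i]) (by linarith [hge i j])
  obtain ⟨i, hi⟩ : ∃ i, v i ≠ 0 := by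
    by_contra! h; exact hv.ne_zero (funext h)
  have hi' : (v i : ℝ) ≠ 0 := by exact_mod_cast hi
  have hgt : toReal g = (toReal g i / v i) • toReal v := by
    funext j
    simp only [Pi.smul_apply, smul_eq_mul]
    have := heq i j
    simp only [toReal] at this ⊢
    field_simp
    linarith
  refine ⟨_, ?_, hgt⟩
  -- The generator `g` is a multiple of `v`. Its dual form gives `1 = t * c g`, which excludes a
  -- negative factor.
  by_contra! hneg
  set t := toReal g i / v i with ht
  obtain ⟨m, hm, -, hmc⟩ := hcs.1.exists_dual hg
  have h5 : toReal m ⬝ᵥ toReal v = c g := by rw [← hcv]; exact hmc c subset_rfl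
  have h6 : (1 : ℝ) = t * c g := by
    have : toReal m ⬝ᵥ toReal g = t * c g := by rw [hgt, dotProduct_smul, h5, smul_eq_mul]
    rw [← this, toReal_dotProduct, hm]; simp
  nlinarith [hc g]

end ToricB

namespace ToricB

variable {n : ℕ}

/-! ### Conical concave functions -/

/-- Functions that are homogeneous of degree one for nonnegative factors. -/
def IsConical (f : (Fin n → ℝ) → ℝ) : Prop :=
  ∀ (t : ℝ) (x : Fin n → ℝ), 0 ≤ t → f (t • x) = t * f x

theorem IsConical.map_zero {f : (Fin n → ℝ) → ℝ} (hf : IsConical f) : f 0 = 0 := by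
  simpa using hf 0 0 le_rfl

theorem IsConical.add_le {f : (Fin n → ℝ) → ℝ} (hf : IsConical f)
    (hc : ConcaveOn ℝ Set.univ f) (x y : Fin n → ℝ) : f x + f y ≤ f (x + y) := by
  have h := hc.2 (Set.mem_univ ((2 : ℝ) • x)) (Set.mem_univ ((2 : ℝ) • y))
    (by norm_num : (0 : ℝ) ≤ 1 / 2) (by norm_num : (0 : ℝ) ≤ 1 / 2) (by norm_num)
  rw [hf 2 x (by norm_num), hf 2 y (by norm_num), smul_smul, smul_smul] at h
  norm_num at h
  linarith

theorem IsConical.sum_le {f : (Fin n → ℝ) → ℝ} (hf : IsConical f)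
    (hc : ConcaveOn ℝ Set.univ f) {ι : Type*} (s : Finset ι) (x : ι → Fin n → ℝ) :
    ∑ i ∈ s, f (x i) ≤ f (∑ i ∈ s, x i) := by
  classical
  induction s using Finset.induction_on with
  | empty => simp [hf.map_zero]
  | insert i s hi ih =>
    rw [Finset.sum_insert hi, Finset.sum_insert hi]
    exact (add_le_add_right ih _).trans (hf.add_le hc _ _)

theorem IsConical.concaveOn {f : (Fin n → ℝ) → ℝ} (hf : IsConical f)
    (h : ∀ x y, f x + f y ≤ f (x + y)) : ConcaveOn ℝ Set.univ f := by
  refine ⟨convex_univ, fun x _ y _ a b ha hb _ => ?_⟩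
  rw [smul_eq_mul, smul_eq_mul, ← hf a x ha, ← hf b y hb]
  exact h _ _

theorem IsConical.add_neg_le {f : (Fin n → ℝ) → ℝ} (hf : IsConical f)
    (hc : ConcaveOn ℝ Set.univ f) (x : Fin n → ℝ) : f x ≤ -f (-x) := by
  have := hf.add_le hc x (-x)
  rw [add_neg_cancel, hf.map_zero] at this
  linarith

theorem exists_isPrimitive_smul {w : Fin n → ℤ} (hw : w ≠ 0) :
    ∃ (d : ℤ) (v : Fin n → ℤ), 0 ≤ d ∧ IsPrimitive v ∧ w = d • v := by
  obtain ⟨i, hi⟩ : ∃ i, w i ≠ 0 := by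
    by_contra! h; exact hw (funext h)
  obtain ⟨g, hg, hg1⟩ := Finset.extract_gcd w (s := Finset.univ) ⟨i, Finset.mem_univ i⟩
  refine ⟨Finset.univ.gcd w, g, ?_, ?_, funext fun j => hg j (Finset.mem_univ j)⟩
  · rw [← Finset.normalize_gcd]
    exact Int.nonneg_of_normalize_eq_self (normalize_idem _)
  · rintro d u rfl
    rw [isUnit_iff_dvd_one, ← hg1]
    exact Finset.dvd_gcd fun j _ => ⟨u j, rfl⟩

theorem exists_toReal_eq_smul_ratToReal (q : Fin n → ℚ) :
    ∃ (N : ℕ) (m : Fin n → ℤ), 0 < N ∧ toReal m = (N : ℝ) • ratToReal q := by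
  refine ⟨∏ i, (q i).den, fun i => (q i).num * ∏ j ∈ Finset.univ.erase i, ((q j).den : ℤ),
    Finset.prod_pos fun i _ => (q i).den_pos, ?_⟩
  funext i
  simp only [toReal, ratToReal, Pi.smul_apply, smul_eq_mul]
  rw [← Finset.mul_prod_erase Finset.univ _ (Finset.mem_univ i)]
  have h : ((q i : ℚ) : ℝ) * ((q i).den : ℝ) = ((q i).num : ℝ) := by
    exact_mod_cast Rat.mul_den_eq_num (q i)
  push_cast
  rw [← h]
  ring

theorem denseRange_ratToReal : DenseRange (ratToReal : (Fin n → ℚ) → Fin n → ℝ) :=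
  DenseRange.piMap fun _ => Rat.denseRange_cast

/-- An inequality between conical continuous functions may be checked at the primitive vectors. -/
theorem IsConical.le_of_primitive {f g : (Fin n → ℝ) → ℝ} (hf : IsConical f) (hg : IsConical g)
    (hfc : Continuous f) (hgc : Continuous g)
    (h : ∀ v : Fin n → ℤ, IsPrimitive v → f (toReal v) ≤ g (toReal v)) (x : Fin n → ℝ) :
    f x ≤ g x := by
  have h1 : ∀ w : Fin n → ℤ, f (toReal w) ≤ g (toReal w) := by
    intro w
    by_cases hw : w = 0
    · rw [hw, toReal_zero, hf.map_zero, hg.map_zero]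
    · obtain ⟨d, v, hd, hv, rfl⟩ := exists_isPrimitive_smul hw
      have hd' : (0 : ℝ) ≤ d := by exact_mod_cast hd
      rw [toReal_smul, hf _ _ hd', hg _ _ hd']
      exact mul_le_mul_of_nonneg_left (h v hv) hd'
  refine denseRange_ratToReal.induction_on x (isClosed_le hfc hgc) fun q => ?_
  obtain ⟨N, m, hN, hm⟩ := exists_toReal_eq_smul_ratToReal q
  have hN' : (0 : ℝ) < N := by exact_mod_cast hN
  have := h1 m
  rw [hm, hf _ _ hN'.le, hg _ _ hN'.le] at this
  exact le_of_mul_le_mul_left this hN'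

theorem IsConical.eq_of_primitive {f g : (Fin n → ℝ) → ℝ} (hf : IsConical f) (hg : IsConical g)
    (hfc : Continuous f) (hgc : Continuous g)
    (h : ∀ v : Fin n → ℤ, IsPrimitive v → f (toReal v) = g (toReal v)) : f = g :=
  funext fun x => le_antisymm (hf.le_of_primitive hg hfc hgc (fun v hv => (h v hv).le) x)
    (hg.le_of_primitive hf hgc hfc (fun v hv => (h v hv).ge) x)

/-! ### Support functions -/

section SupportFunction

variable {S : Fan n} {D : ToricDivisor S} {ψ : (Fin n → ℝ) → ℝ}

theorem IsSupportFunction.isConical (h : IsSupportFunction D ψ) : IsConical ψ := by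
  intro t x ht
  obtain ⟨σ, hσ, hx⟩ := S.complete x
  obtain ⟨m, hm⟩ := h.linear σ hσ
  rw [hm _ (smul_mem_cone hx ht), hm x hx, dotProduct_smul, smul_eq_mul]

theorem IsSupportFunction.apply_realize (h : IsSupportFunction D ψ) {c : (Fin n → ℤ) →₀ ℝ}
    (hc : ∀ v, 0 ≤ c v) (hcs : coneOf c.support ∈ S.cones) :
    ψ (realize c) = ∑ v ∈ c.support, c v * ψ (toReal v) := by
  obtain ⟨m, hm⟩ := h.linear _ hcs
  rw [hm _ (mem_coneOf.2 ⟨c, hc, subset_rfl, rfl⟩), realize_eq_sum subset_rfl, dotProduct_sum]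
  refine Finset.sum_congr rfl fun v hv => ?_
  rw [dotProduct_smul, hm _ (toReal_mem_coneOf hv), smul_eq_mul]

/-- The support function lies below every concave conical function that is not smaller at the
generators of the rays. -/
theorem IsSupportFunction.le (h : IsSupportFunction D ψ) {f : (Fin n → ℝ) → ℝ} (hf : IsConical f)
    (hc : ConcaveOn ℝ Set.univ f) (hr : ∀ v ∈ S.rays, ψ (toReal v) ≤ f (toReal v))
    (x : Fin n → ℝ) : ψ x ≤ f x := by
  obtain ⟨c, hc0, hcs, rfl⟩ := S.exists_rep x
  rw [h.apply_realize hc0 hcs.2, realize_eq_sum subset_rfl]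
  refine le_trans ?_ (hf.sum_le hc _ _)
  refine Finset.sum_le_sum fun v hv => ?_
  rw [hf _ _ (hc0 v)]
  exact mul_le_mul_of_nonneg_left (hr v (S.rays_of_mem_face hcs.1 hcs.2 hv)) (hc0 v)

theorem IsSupportFunction.unique (h : IsSupportFunction D ψ) {ψ' : (Fin n → ℝ) → ℝ}
    (h' : IsSupportFunction D ψ') : ψ = ψ' := by
  funext x
  obtain ⟨c, hc0, hcs, rfl⟩ := S.exists_rep x
  rw [h.apply_realize hc0 hcs.2, h'.apply_realize hc0 hcs.2]
  refine Finset.sum_congr rfl fun v hv => ?_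
  have hv' := S.rays_of_mem_face hcs.1 hcs.2 hv
  rw [h.ray ⟨v, hv'⟩, h'.ray ⟨v, hv'⟩]

end SupportFunction

/-! ### The concave function of a nef b-divisor -/

section Model

variable {S : Fan n}

theorem Model.exists_common (S₁ S₂ : Model S) :
    ∃ S₃ : Model S, S₃.1.Subdivides S₁.1 ∧ S₃.1.Subdivides S₂.1 := by
  obtain ⟨S₃, h1, h2⟩ := S₁.1.exists_common_subdivision S₂.1
  exact ⟨⟨S₃, h1.trans S₁.2⟩, h1, h2⟩

theorem Model.exists_mem_rays (S₁ : Model S) {v : Fin n → ℤ} (hv : IsPrimitive v) :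
    ∃ S₂ : Model S, S₂.1.Subdivides S₁.1 ∧ v ∈ S₂.1.rays := by
  obtain ⟨S₂, h1, h2⟩ := S₁.1.exists_subdivides_mem_rays hv
  exact ⟨⟨S₂, h1.trans S₁.2⟩, h1, h2⟩

theorem BDivisor.inc_eq_of_subdivides (D : BDivisor S) {S₁ S₂ : Model S}
    (h : S₂.1.Subdivides S₁.1) {v : Fin n → ℤ} (h₁ : v ∈ S₁.1.rays) :
    D.inc S₂ ⟨v, h.rays_subset h₁⟩ = D.inc S₁ ⟨v, h₁⟩ := by
  rw [← D.compat S₂ S₁ h, pushforward, dif_pos]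

end Model

section ConcaveFunction

variable {S : Fan n} {D : BDivisor S}

/-- The function is the supremum of the concave support functions over the cofinal set `C`. They
increase under subdivision, so the family is directed and superadditivity passes to the supremum;
continuity is automatic for a finite concave function on `ℝⁿ`. -/
theorem BDivisor.IsNef.exists_isConcaveFunction (hD : D.IsNef) :
    ∃ φ : (Fin n → ℝ) → ℝ, D.IsConcaveFunction φ := by
  obtain ⟨C, hC, hnef⟩ := hD
  choose! ψ hψ hconc using hnef
  have hcon : ∀ S' ∈ C, IsConical (ψ S') := fun S' h => (hψ S' h).isConical
  have hmono : ∀ S₁ ∈ C, ∀ S₂ ∈ C, S₂.1.Subdivides S₁.1 → ∀ x, ψ S₁ x ≤ ψ S₂ x := by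
    intro S₁ h₁ S₂ h₂ h x
    refine (hψ S₁ h₁).le (hcon S₂ h₂) (hconc S₂ h₂) (fun v hv => ?_) x
    rw [(hψ S₁ h₁).ray ⟨v, hv⟩, (hψ S₂ h₂).ray ⟨v, h.rays_subset hv⟩, D.inc_eq_of_subdivides h hv]
  have hdir : ∀ S₁ ∈ C, ∀ S₂ ∈ C, ∃ S₃ ∈ C, (∀ x, ψ S₁ x ≤ ψ S₃ x) ∧ ∀ x, ψ S₂ x ≤ ψ S₃ x := by
    intro S₁ h₁ S₂ h₂
    obtain ⟨S₃, h3, h4⟩ := Model.exists_common S₁ S₂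
    obtain ⟨S₄, h5, h6⟩ := hC S₃
    exact ⟨S₄, h5, hmono _ h₁ _ h5 (h6.trans h3), hmono _ h₂ _ h5 (h6.trans h4)⟩
  obtain ⟨S₀, hS₀, -⟩ := hC ⟨S, Fan.Subdivides.refl S⟩
  have : Nonempty C := ⟨⟨S₀, hS₀⟩⟩
  have hbdd : ∀ x, BddAbove (Set.range fun S' : C => ψ S' x) := by
    intro x
    -- On a common subdivision `S₂`: `ψ S₁ x ≤ ψ S₂ x ≤ -ψ S₂ (-x) ≤ -ψ S₀ (-x)`.
    refine ⟨-ψ S₀ (-x), ?_⟩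
    rintro _ ⟨⟨S₁, h₁⟩, rfl⟩
    obtain ⟨S₂, h₂, h3, h4⟩ := hdir S₁ h₁ S₀ hS₀
    have h5 := (hcon S₂ h₂).add_neg_le (hconc S₂ h₂) x
    have h6 := h3 x
    have h7 := h4 (-x)
    simp only
    linarith
  have hle : ∀ S₁ (h₁ : S₁ ∈ C) x, ψ S₁ x ≤ ⨆ S' : C, ψ S' x := fun S₁ h₁ x =>
    le_ciSup (hbdd x) ⟨S₁, h₁⟩
  have hφcon : IsConical fun x => ⨆ S' : C, ψ S' x := by
    intro t x ht
    rw [Real.mul_iSup_of_nonneg ht]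
    exact iSup_congr fun S' => hcon S' S'.2 t x ht
  have hφconc : ConcaveOn ℝ Set.univ fun x => ⨆ S' : C, ψ S' x := by
    refine hφcon.concaveOn fun x y => ?_
    rw [← le_sub_iff_add_le]
    refine ciSup_le fun S₁ => ?_
    rw [le_sub_comm]
    refine ciSup_le fun S₂ => ?_
    obtain ⟨S₃, h₃, h4, h5⟩ := hdir S₁ S₁.2 S₂ S₂.2
    have := (hcon S₃ h₃).add_le (hconc S₃ h₃) x y
    linarith [h4 x, h5 y, hle S₃ h₃ (x + y)]
  refine ⟨_, hφconc.locallyLipschitz.continuous, hφconc, hφcon, fun S' v => ?_⟩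
  -- From `S'` onwards the value at a ray of `S'` no longer changes, so the supremum there is
  -- attained.
  have hval : ∀ S₁ ∈ C, S₁.1.Subdivides S'.1 → ψ S₁ (toReal v) = -(D.inc S' v : ℝ) := by
    intro S₁ h₁ h
    rw [(hψ S₁ h₁).ray ⟨v, h.rays_subset v.2⟩, D.inc_eq_of_subdivides h v.2]
  apply le_antisymm
  · refine ciSup_le fun S₁ => ?_
    obtain ⟨S₂, h3, h4⟩ := Model.exists_common S₁.1 S'
    obtain ⟨S₃, h5, h6⟩ := hC S₂
    rw [← hval S₃ h5 (h6.trans h4)]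
    exact hmono _ S₁.2 _ h5 (h6.trans h3) _
  · obtain ⟨S₁, h1, h2⟩ := hC S'
    rw [← hval S₁ h1 h2]
    exact hle S₁ h1 _

variable {φ : (Fin n → ℝ) → ℝ}

theorem BDivisor.IsConcaveFunction.isConical (h : D.IsConcaveFunction φ) : IsConical φ := h.conical

theorem BDivisor.IsConcaveFunction.exists_rat (h : D.IsConcaveFunction φ) (w : Fin n → ℤ) :
    ∃ q : ℚ, φ (toReal w) = q := by
  by_cases hw : w = 0
  · exact ⟨0, by rw [hw, toReal_zero, h.isConical.map_zero]; simp⟩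
  · obtain ⟨d, v, hd, hv, rfl⟩ := exists_isPrimitive_smul hw
    obtain ⟨S', -, hv'⟩ := Model.exists_mem_rays ⟨S, Fan.Subdivides.refl S⟩ hv
    refine ⟨d * -D.inc S' ⟨v, hv'⟩, ?_⟩
    rw [toReal_smul, h.conical _ _ (by exact_mod_cast hd), h.ray S' ⟨v, hv'⟩]
    push_cast; ring

/-- A b-divisor is Cartier if its function is linear on the cones of some model. -/
theorem BDivisor.IsConcaveFunction.isCartier_iff (h : D.IsConcaveFunction φ) :
    D.IsCartier ↔ ∃ S' : Model S, ∀ σ ∈ S'.1.cones, ∃ m : Fin n → ℚ, ∀ u ∈ σ,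
      φ u = ratToReal m ⬝ᵥ u := by
  constructor
  · rintro ⟨S', hS'⟩
    obtain ⟨ψ, hψ, -⟩ := hS' S' (Fan.Subdivides.refl _)
    refine ⟨S', ?_⟩
    have : φ = ψ := by
      -- A primitive vector is a ray of some subdivision of `S'`, where the pull-back still has
      -- support function `ψ`.
      refine h.isConical.eq_of_primitive hψ.isConical h.continuous hψ.continuous fun v hv => ?_
      obtain ⟨S₂, h1, h2⟩ := S'.exists_mem_rays hv
      obtain ⟨ψ', h3, h4⟩ := hS' S₂ h1
      rw [hψ.unique h3, h.ray S₂ ⟨v, h2⟩, h4.ray ⟨v, h2⟩]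
    rw [this]
    exact hψ.linear
  · rintro ⟨S', hS'⟩
    have key : ∀ S'' : Model S, S''.1.Subdivides S'.1 → IsSupportFunction (D.inc S'') φ := by
      intro S'' hsub
      refine ⟨h.continuous, fun σ hσ => ?_, h.ray S''⟩
      obtain ⟨τ, hτ, hle⟩ := hsub σ hσ
      obtain ⟨m, hm⟩ := hS' τ hτ
      exact ⟨m, fun u hu => hm u (hle hu)⟩
    exact ⟨S', fun S'' hsub => ⟨φ, key S' (Fan.Subdivides.refl _), key S'' hsub⟩⟩

end ConcaveFunction

/-! ### Stability sets -/

/-- A negative value of the conical function `m - φ` would tend to `-∞` along its ray, so being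
bounded below means being nonnegative. -/
theorem IsConical.mem_stabilitySet {φ : (Fin n → ℝ) → ℝ} (h : IsConical φ) {m : Fin n → ℝ} :
    m ∈ stabilitySet φ ↔ ∀ v, φ v ≤ m ⬝ᵥ v := by
  constructor
  · rintro ⟨B, hB⟩ v
    by_contra! hv
    obtain ⟨N, hN⟩ := exists_nat_gt ((-B) / (φ v - m ⬝ᵥ v))
    have h1 : B ≤ m ⬝ᵥ ((N : ℝ) • v) - φ ((N : ℝ) • v) := hB ⟨_, rfl⟩
    rw [h _ _ (Nat.cast_nonneg N), dotProduct_smul, smul_eq_mul] at h1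
    rw [div_lt_iff₀ (by linarith)] at hN
    linarith
  · intro hm
    refine ⟨0, ?_⟩
    rintro _ ⟨v, rfl⟩
    simpa using hm v

theorem exists_eq_dotProduct (f : (Fin n → ℝ) →ₗ[ℝ] ℝ) : ∃ m : Fin n → ℝ, ∀ x, f x = m ⬝ᵥ x := by
  refine ⟨(dotProductEquiv ℝ (Fin n)).symm f, fun x => ?_⟩
  conv_lhs => rw [← (dotProductEquiv ℝ (Fin n)).apply_symm_apply f]
  rfl

/-- A concave conical function is the minimum of the linear functions in its stability set. -/
theorem IsConical.exists_mem_stabilitySet {φ : (Fin n → ℝ) → ℝ} (h : IsConical φ)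
    (hc : ConcaveOn ℝ Set.univ φ) (x : Fin n → ℝ) : ∃ m ∈ stabilitySet φ, m ⬝ᵥ x = φ x := by
  -- Hahn–Banach is applied to the sublinear function `-φ`. The functional on the line of `x` with
  -- value `-φ x` is only available for `x ≠ 0`; otherwise the zero subspace serves.
  by_cases hx : x = 0
  · obtain ⟨g, -, hg⟩ := exists_extension_of_le_sublinear ⟨⊥, 0⟩
      (fun y => -φ y) (fun c hc y => by simp only [h c y hc.le]; ring)
      (fun y z => by linarith [h.add_le hc y z])
      (fun y => by
        obtain ⟨y, hy⟩ := y
        rw [Submodule.mem_bot] at hy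
        subst hy
        simp [h.map_zero])
    obtain ⟨m, hm⟩ := exists_eq_dotProduct g
    refine ⟨-m, h.mem_stabilitySet.2 fun v => ?_, by simp [hx, h.map_zero]⟩
    rw [neg_dotProduct, ← hm]
    linarith [hg v]
  · obtain ⟨g, hgx, hg⟩ := exists_extension_of_le_sublinear
      (LinearPMap.mkSpanSingleton x (-φ x) hx)
      (fun y => -φ y) (fun c hc y => by simp only [h c y hc.le]; ring)
      (fun y z => by linarith [h.add_le hc y z])
      (fun y => by
        obtain ⟨y, hy⟩ := y
        obtain ⟨t, rfl⟩ := Submodule.mem_span_singleton.1 hy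
        rw [LinearPMap.mkSpanSingleton'_apply]
        rcases le_total 0 t with ht | ht
        · simp only [h t x ht, smul_eq_mul, RingHom.id_apply]; linarith
        · have h1 := h (-t) (-x) (by linarith)
          rw [neg_smul_neg] at h1
          have h2 := h.add_neg_le hc x
          simp only [h1, smul_eq_mul, RingHom.id_apply]
          nlinarith)
    obtain ⟨m, hm⟩ := exists_eq_dotProduct g
    refine ⟨-m, h.mem_stabilitySet.2 fun v => ?_, ?_⟩
    · rw [neg_dotProduct, ← hm]
      linarith [hg v]
    · have h1 := hgx ⟨x, Submodule.mem_span_singleton_self x⟩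
      have h2 := LinearPMap.mkSpanSingleton_apply ℝ ℝ (σ := RingHom.id ℝ) hx (-φ x)
      have h3 : g x = -φ x := by
        rw [h1]; exact h2
      rw [neg_dotProduct, ← hm, h3, neg_neg]

theorem IsConical.convex_stabilitySet {φ : (Fin n → ℝ) → ℝ} (h : IsConical φ) :
    Convex ℝ (stabilitySet φ) := by
  intro x hx y hy a b ha hb hab
  rw [h.mem_stabilitySet] at hx hy ⊢
  intro v
  rw [add_dotProduct, smul_dotProduct, smul_dotProduct, smul_eq_mul, smul_eq_mul]
  calc φ v = a * φ v + b * φ v := by rw [← add_mul, hab, one_mul]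
    _ ≤ _ := add_le_add (mul_le_mul_of_nonneg_left (hx v) ha) (mul_le_mul_of_nonneg_left (hy v) hb)

/-- The stability set of the minimum of finitely many linear functions. -/
theorem IsConical.stabilitySet_eq_convexHull {φ : (Fin n → ℝ) → ℝ} (h : IsConical φ)
    {s : Set (Fin n → ℝ)} (hs : s.Finite) (hle : ∀ m ∈ s, ∀ v, φ v ≤ m ⬝ᵥ v)
    (heq : ∀ v, ∃ m ∈ s, m ⬝ᵥ v = φ v) : stabilitySet φ = convexHull ℝ s := by
  apply Set.Subset.antisymm
  · intro x hx
    by_contra hxs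
    obtain ⟨f, u, hfx, hfs⟩ := geometric_hahn_banach_point_closed (convex_convexHull ℝ s)
      (hs.isClosed_convexHull ℝ) hxs
    -- The separating functional is a direction `v` in which the point lies below all of `s`,
    -- although the minimum `φ v` is attained on `s`.
    obtain ⟨v, hv⟩ := exists_eq_dotProduct (f : (Fin n → ℝ) →ₗ[ℝ] ℝ)
    obtain ⟨m, hm, hmv⟩ := heq v
    have h1 := hfs m (subset_convexHull ℝ s hm)
    have h2 := h.mem_stabilitySet.1 hx v
    have h3 : f m = v ⬝ᵥ m := hv m
    have h4 : f x = v ⬝ᵥ x := hv x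
    rw [dotProduct_comm] at h3 h4
    linarith
  · exact convexHull_min (fun m hm => h.mem_stabilitySet.2 (hle m hm)) h.convex_stabilitySet

end ToricB

namespace ToricB

variable {n : ℕ}

/-! ### Rational polytopes and Cartier b-divisors -/

theorem ratToReal_sub (p q : Fin n → ℚ) : ratToReal (p - q) = ratToReal p - ratToReal q := by
  funext i; simp [ratToReal]

theorem dualVec_ne_zero (b : Module.Basis (Fin n) ℤ (Fin n → ℤ)) (i : Fin n) :
    toReal (dualVec b i) ≠ 0 := by
  intro h
  have h1 := toReal_dotProduct (dualVec b i) (b i)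
  rw [h, dualVec_dotProduct_self] at h1
  simp at h1

/-- The points that lie on none of finitely many hyperplanes are dense. -/
theorem dense_dotProduct_ne_zero {T : Set (Fin n → ℝ)} (hT : T.Finite) (h0 : ∀ m ∈ T, m ≠ 0) :
    Dense {y : Fin n → ℝ | ∀ m ∈ T, m ⬝ᵥ y ≠ 0} := by
  refine MeasureTheory.Measure.dense_of_ae (μ := MeasureTheory.volume) ?_
  rw [MeasureTheory.ae_ball_iff hT.countable]
  intro m hm
  have h1 : LinearMap.ker (dotProductEquiv ℝ (Fin n) m) ≠ ⊤ := by
    rw [Ne, LinearMap.ker_eq_top]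
    exact fun h => h0 m hm ((dotProductEquiv ℝ (Fin n)).map_eq_zero_iff.1 h)
  have h2 := MeasureTheory.Measure.addHaar_submodule MeasureTheory.volume _ h1
  rw [MeasureTheory.ae_iff]
  convert h2 using 2
  ext y
  simp [dotProductEquiv]

section Cartier

variable {S : Fan n} {D : BDivisor S} {φ : (Fin n → ℝ) → ℝ}

/-- The slope on a full-dimensional cone dominates `φ` everywhere by concavity and equals it on the
cone. Such slopes attain `φ` on a dense set, and everywhere because finitely many slopes give a
closed condition. -/
theorem BDivisor.IsConcaveFunction.isRationalPolytope (h : D.IsConcaveFunction φ)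
    (hD : D.IsCartier) : IsRationalPolytope (stabilitySet φ) := by
  classical
  obtain ⟨S', hS'⟩ := h.isCartier_iff.1 hD
  choose! m hm using hS'
  have hsub : ∀ σ ∈ S'.1.cones, ∃ (b : Module.Basis (Fin n) ℤ (Fin n → ℤ)), ∃ s : Set (Fin n),
    σ = PointedCone.hull ℝ ((fun i => toReal (b i)) '' s) := S'.1.smooth
  have : Nonempty (Module.Basis (Fin n) ℤ (Fin n → ℤ)) := ⟨Pi.basisFun ℤ (Fin n)⟩
  choose! b s hbs using hsub
  -- Off these hyperplanes a point has only nonzero coordinates in its cone, which is therefore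
  -- full-dimensional with the point in its interior.
  let T : Set (Fin n → ℝ) := ⋃ σ ∈ S'.1.cones, Set.range fun i => toReal (dualVec (b σ) i)
  have hT : T.Finite := S'.1.finite.biUnion fun σ _ => Set.finite_range _
  have hT0 : ∀ u ∈ T, u ≠ 0 := by
    intro u hu
    simp only [T, Set.mem_iUnion, Set.mem_range] at hu
    obtain ⟨σ, -, i, rfl⟩ := hu
    exact dualVec_ne_zero _ _
  let G : Set (Fin n → ℚ) := {q | (∃ σ ∈ S'.1.cones, m σ = q) ∧ ∀ z, φ z ≤ ratToReal q ⬝ᵥ z}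
  have hG : G.Finite := (S'.1.finite.image m).subset fun q hq => hq.1
  have hdense : ∀ y ∈ {y : Fin n → ℝ | ∀ u ∈ T, u ⬝ᵥ y ≠ 0}, ∃ q ∈ G, ratToReal q ⬝ᵥ y = φ y := by
    intro y hy
    obtain ⟨σ, hσ, hyσ⟩ := S'.1.complete y
    refine ⟨m σ, ⟨⟨σ, hσ, rfl⟩, fun z => ?_⟩, (hm σ hσ y hyσ).symm⟩
    have hcoord : ∀ x ∈ σ, ∀ i, 0 ≤ toReal (dualVec (b σ) i) ⬝ᵥ x ∧
        (i ∉ s σ → toReal (dualVec (b σ) i) ⬝ᵥ x = 0) := by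
      intro x hx i
      rw [hbs σ hσ] at hx
      exact dualVec_dotProduct_of_mem_hull hx i
    have hpos : ∀ i, 0 < toReal (dualVec (b σ) i) ⬝ᵥ y := fun i =>
      lt_of_le_of_ne (hcoord y hyσ i).1 (hy _ (Set.mem_biUnion hσ ⟨i, rfl⟩)).symm
    have hs : ∀ i, i ∈ s σ := fun i => by
      by_contra hi
      exact (hpos i).ne' ((hcoord y hyσ i).2 hi)
    -- A small step from `y` in the direction `z` stays in `σ`; superadditivity along it bounds `φ
    -- z` by the slope of `σ`.
    obtain ⟨ε, hε, hε'⟩ : ∃ ε : ℝ, 0 < ε ∧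
        ∀ i, 0 ≤ toReal (dualVec (b σ) i) ⬝ᵥ (y + ε • z) := by
      have hev : ∀ᶠ ε : ℝ in nhdsWithin 0 (Set.Ioi 0),
          ∀ i, 0 ≤ toReal (dualVec (b σ) i) ⬝ᵥ (y + ε • z) := by
        rw [Filter.eventually_all]
        intro i
        have hcont : Continuous fun ε : ℝ => toReal (dualVec (b σ) i) ⬝ᵥ (y + ε • z) := by
          simp only [dotProduct_add, dotProduct_smul]
          fun_prop
        have := (hcont.tendsto 0).eventually (lt_mem_nhds (by simpa using hpos i))
        exact (this.filter_mono nhdsWithin_le_nhds).mono fun _ h => h.le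
      obtain ⟨ε, h1, h2⟩ := (hev.and self_mem_nhdsWithin).exists
      exact ⟨ε, h2, h1⟩
    have hmem : y + ε • z ∈ σ := by
      rw [← sum_dualVec_smul (b σ) (y + ε • z)]
      refine Submodule.sum_mem _ fun i _ => smul_mem_cone ?_ (hε' i)
      exact (hbs σ hσ).ge (PointedCone.subset_hull (Set.mem_image_of_mem _ (hs i)))
    have h1 := h.isConical.add_le h.concave y (ε • z)
    rw [hm σ hσ _ hmem, hm σ hσ _ hyσ, h.conical _ _ hε.le, dotProduct_add, dotProduct_smul,
      smul_eq_mul] at h1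
    exact le_of_mul_le_mul_left (by linarith) hε
  refine ⟨hG.toFinset, ?_⟩
  rw [hG.coe_toFinset]
  refine h.isConical.stabilitySet_eq_convexHull (hG.image _) ?_ fun v => ?_
  · rintro _ ⟨q, hq, rfl⟩
    exact hq.2
  · have hclosed : IsClosed {y | ∃ q ∈ G, ratToReal q ⬝ᵥ y = φ y} := by
      have : {y | ∃ q ∈ G, ratToReal q ⬝ᵥ y = φ y} = ⋃ q ∈ G, {y | ratToReal q ⬝ᵥ y = φ y} := by
        ext y; simp
      rw [this]
      exact hG.isClosed_biUnion fun q _ => isClosed_eq (by fun_prop) h.continuous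
    have hv : v ∈ {y | ∃ q ∈ G, ratToReal q ⬝ᵥ y = φ y} :=
      closure_minimal hdense hclosed (dense_dotProduct_ne_zero hT hT0 v)
    obtain ⟨q, hq, hqv⟩ := hv
    exact ⟨_, ⟨q, hq, rfl⟩, hqv⟩

/-- A linear form attains its minimum on a polytope at one of the spanning points, so `φ` is a
minimum of finitely many rational forms. After subdividing along the zero sets of their differences,
one form is minimal on each whole cone. -/
theorem BDivisor.IsConcaveFunction.isCartier (h : D.IsConcaveFunction φ)
    (hP : IsRationalPolytope (stabilitySet φ)) : D.IsCartier := by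
  classical
  obtain ⟨s, hs⟩ := hP
  choose N m hN hm using exists_toReal_eq_smul_ratToReal (n := n)
  have hmem : ∀ q ∈ s, ∀ v, φ v ≤ ratToReal q ⬝ᵥ v := fun q hq =>
    h.isConical.mem_stabilitySet.1 (hs ▸ subset_convexHull ℝ _ ⟨q, hq, rfl⟩)
  have hmin : ∀ v, ∃ q ∈ s, ratToReal q ⬝ᵥ v = φ v := by
    intro v
    obtain ⟨p, hp, hpv⟩ := h.isConical.exists_mem_stabilitySet h.concave v
    by_contra! hne
    rw [hs] at hp
    have hconv : Convex ℝ {x : Fin n → ℝ | φ v < x ⬝ᵥ v} :=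
      convex_halfSpace_gt ⟨fun x y => add_dotProduct x y v, fun c x => smul_dotProduct c x v⟩ _
    have : p ∈ {x : Fin n → ℝ | φ v < x ⬝ᵥ v} := by
      refine convexHull_min ?_ hconv hp
      rintro _ ⟨q, hq, rfl⟩
      exact lt_of_le_of_ne (hmem q hq v) (hne q hq).symm
    exact absurd hpv (ne_of_gt this)
  obtain ⟨S', hS', hside⟩ := S.exists_subdivides_oneSided
    ((s ×ˢ s).image fun p => m (p.1 - p.2))
  refine h.isCartier_iff.2 ⟨⟨S', hS'⟩, fun σ hσ => ?_⟩
  obtain ⟨F, hF, rfl⟩ := isSmoothCone_iff.1 (S'.smooth σ hσ)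
  obtain ⟨c, hc, rfl⟩ := exists_realize_eq F
  -- The form that is minimal at a relatively interior point stays minimal on the cone, as all
  -- differences `p - q` have constant sign there.
  obtain ⟨q, hq, hqc⟩ := hmin (realize c)
  refine ⟨q, fun u hu => le_antisymm (hmem q hq u) ?_⟩
  obtain ⟨p, hp, hpu⟩ := hmin u
  rw [← hpu]
  have hN' : (0 : ℝ) < N (p - q) := by exact_mod_cast hN (p - q)
  have key : ∀ x : Fin n → ℝ, toReal (m (p - q)) ⬝ᵥ x =
      N (p - q) * (ratToReal p ⬝ᵥ x - ratToReal q ⬝ᵥ x) := by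
    intro x
    rw [hm, smul_dotProduct, ratToReal_sub, sub_dotProduct, smul_eq_mul]
  have h1 := (hside _ hσ (m (p - q)) (Finset.mem_image.2
    ⟨(p, q), Finset.mem_product.2 ⟨hp, hq⟩, rfl⟩)).dotProduct_nonneg hc (by
      rw [key, hqc]
      exact mul_nonneg hN'.le (sub_nonneg.2 (hmem p hp _))) u hu
  rw [key] at h1
  linarith [nonneg_of_mul_nonneg_right h1 hN']

end Cartier

/-! ### Density of rational points -/

/-- In a convex set with rational affine hull the rational points are dense. -/
theorem subset_closure_rational {P : Set (Fin n → ℝ)} (hP : Convex ℝ P)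
    (h : HasRationalAffineHull P) : P ⊆ closure (P ∩ Set.range ratToReal) := by
  classical
  obtain ⟨s, hs⟩ := h
  rcases P.eq_empty_or_nonempty with rfl | hne
  · exact Set.empty_subset _
  obtain ⟨q₀, hq₀⟩ : s.Nonempty := by
    rw [Set.nonempty_iff_ne_empty]
    rintro rfl
    rw [Set.image_empty, AffineSubspace.span_empty, eq_comm, affineSpan_eq_bot] at hs
    exact hne.ne_empty hs
  -- A basis of the direction of the affine hull made of rational vectors; the map `g` below
  -- parametrizes the hull by `ℝ^B` and sends rational points to rational points.
  obtain ⟨B, hBs, hBspan, hBli⟩ := exists_linearIndependent ℝ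
    ((fun x => x -ᵥ ratToReal q₀) '' (ratToReal '' s))
  have hBfin : B.Finite := hBli.setFinite
  have := hBfin.fintype
  have hBrat : ∀ t : B, ∃ q : Fin n → ℚ, ratToReal q = t := by
    rintro ⟨t, ht⟩
    obtain ⟨_, ⟨q, -, rfl⟩, rfl⟩ := hBs ht
    exact ⟨q - q₀, ratToReal_sub _ _⟩
  choose r hr using hBrat
  have hdir : (affineSpan ℝ P).direction = Submodule.span ℝ B := by
    rw [← hs, direction_affineSpan, hBspan,
      vectorSpan_eq_span_vsub_set_right ℝ (Set.mem_image_of_mem ratToReal hq₀)]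
  have hq₀A : ratToReal q₀ ∈ affineSpan ℝ P := hs ▸ subset_affineSpan ℝ _ ⟨q₀, hq₀, rfl⟩
  let L : (B → ℝ) →ₗ[ℝ] (Fin n → ℝ) := Fintype.linearCombination ℝ (fun t : B => (t : Fin n → ℝ))
  let g : (B → ℝ) →ᵃ[ℝ] (Fin n → ℝ) := L.toAffineMap + AffineMap.const ℝ _ (ratToReal q₀)
  have hg : ∀ y, g y = L y + ratToReal q₀ := fun y => rfl
  have hrange : LinearMap.range L = Submodule.span ℝ B := by
    rw [Fintype.range_linearCombination, Subtype.range_coe]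
  have hsurj : ∀ x ∈ affineSpan ℝ P, ∃ y, g y = x := by
    intro x hx
    have h1 : x -ᵥ ratToReal q₀ ∈ (affineSpan ℝ P).direction :=
      AffineSubspace.vsub_mem_direction hx hq₀A
    rw [hdir, ← hrange] at h1
    obtain ⟨y, hy⟩ := h1
    exact ⟨y, by rw [hg, hy]; simp⟩
  have hgmem : ∀ y, g y ∈ affineSpan ℝ P := by
    intro y
    have h1 : L y ∈ (affineSpan ℝ P).direction := by
      rw [hdir, ← hrange]; exact ⟨y, rfl⟩
    exact AffineSubspace.vadd_mem_of_mem_direction h1 hq₀A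
  have hgcont : Continuous g := by
    have : Continuous L := L.continuous_of_finiteDimensional
    exact this.add continuous_const
  have hconv : Convex ℝ (g ⁻¹' P) := hP.affine_preimage g
  have himage : g '' (g ⁻¹' P) = P := by
    rw [Set.image_preimage_eq_iff]
    exact fun x hx => hsurj x (subset_affineSpan ℝ _ hx)
  -- The preimage of `P` is invariant under the kernel of `L`, so its span is determined by the span
  -- of its image. Once this is everything, convexity yields interior points.
  have hspan : affineSpan ℝ (g ⁻¹' P) = ⊤ := by
    rw [eq_top_iff]
    intro y _
    have h1 : g y ∈ (affineSpan ℝ (g ⁻¹' P)).map g := by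
      rw [AffineSubspace.map_span, himage]; exact hgmem y
    obtain ⟨y', hy', hyy'⟩ := AffineSubspace.mem_map.1 h1
    obtain ⟨x, hx⟩ := hne
    obtain ⟨z, rfl⟩ := hsurj x (subset_affineSpan ℝ _ hx)
    have hk : L (y - y') = 0 := by
      rw [map_sub, sub_eq_zero]
      rw [hg, hg] at hyy'
      exact (add_right_cancel hyy').symm
    have hz : z + (y - y') ∈ g ⁻¹' P := by
      rw [Set.mem_preimage, hg, map_add, hk, add_zero, ← hg]; exact hx
    have h2 := AffineSubspace.vsub_mem_direction (subset_affineSpan ℝ _ hz)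
      (subset_affineSpan ℝ _ (show z ∈ g ⁻¹' P from hx))
    have h3 := AffineSubspace.vadd_mem_of_mem_direction h2 hy'
    simpa using h3
  have hinterior : (interior (g ⁻¹' P)).Nonempty := by
    rwa [hconv.interior_nonempty_iff_affineSpan_eq_top]
  have hrat : DenseRange (fun y : B → ℚ => fun t => ((y t : ℚ) : ℝ)) :=
    DenseRange.piMap fun _ => Rat.denseRange_cast
  intro x hx
  obtain ⟨y, rfl⟩ := hsurj x (subset_affineSpan ℝ _ hx)
  have h1 : y ∈ closure (interior (g ⁻¹' P)) := by
    rw [hconv.closure_interior_eq_closure_of_nonempty_interior hinterior]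
    exact subset_closure hx
  have h2 : y ∈ closure (interior (g ⁻¹' P) ∩
      Set.range (fun y : B → ℚ => fun t => ((y t : ℚ) : ℝ))) := by
    have := Dense.open_subset_closure_inter hrat (isOpen_interior (s := g ⁻¹' P))
    exact closure_minimal this isClosed_closure h1
  refine closure_mono ?_ (image_closure_subset_closure_image hgcont ⟨y, h2, rfl⟩)
  rintro _ ⟨_, ⟨hy', ⟨z, rfl⟩⟩, rfl⟩
  refine ⟨(interior_subset hy' : _ ∈ g ⁻¹' P), ⟨q₀ + ∑ t, z t • r t, ?_⟩⟩
  rw [hg, Fintype.linearCombination_apply]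
  funext i
  simp only [ratToReal, Pi.add_apply, Finset.sum_apply, Pi.smul_apply, smul_eq_mul, ← hr]
  push_cast
  ring

theorem hasRationalAffineHull_of_eq_top {P : Set (Fin n → ℝ)} (h : affineSpan ℝ P = ⊤) :
    HasRationalAffineHull P := by
  refine ⟨Set.univ, ?_⟩
  rw [h, eq_top_iff]
  intro x _
  have h1 : IsClosed (affineSpan ℝ (ratToReal '' (Set.univ : Set (Fin n → ℚ))) : Set (Fin n → ℝ)) :=
    AffineSubspace.closed_of_finiteDimensional _
  rw [← SetLike.mem_coe, ← h1.closure_eq]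
  refine closure_mono (subset_affineSpan ℝ _) ?_
  rw [Set.image_univ]
  exact denseRange_ratToReal x

/-- A stability set of dimension at most one of a function with rational values at lattice points
has rational affine hull. -/
theorem hasRationalAffineHull_of_line {φ : (Fin n → ℝ) → ℝ} (h : IsConical φ)
    (hc : ConcaveOn ℝ Set.univ φ) (hrat : ∀ w : Fin n → ℤ, ∃ q : ℚ, φ (toReal w) = q)
    {d : Fin n → ℝ} (hd : ∀ x ∈ stabilitySet φ, ∀ y ∈ stabilitySet φ, ∃ t : ℝ, y - x = t • d) :
    HasRationalAffineHull (stabilitySet φ) := by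
  obtain ⟨m₁, hm₁, hm₁d⟩ := h.exists_mem_stabilitySet hc d
  obtain ⟨m₂, hm₂, hm₂d⟩ := h.exists_mem_stabilitySet hc (-d)
  -- Minimality in the directions `d` and `-d` makes `m₁` and `m₂` the two endpoints of the segment.
  obtain ⟨T, hT, hTall⟩ : ∃ T : ℝ, m₂ = m₁ + T • d ∧
      ∀ x ∈ stabilitySet φ, ∃ t : ℝ, 0 ≤ t ∧ t ≤ T ∧ x = m₁ + t • d := by
    by_cases hd0 : d = 0
    · have : ∀ x ∈ stabilitySet φ, x = m₁ := fun x hx => by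
        obtain ⟨t, ht⟩ := hd m₁ hm₁ x hx
        rw [hd0, smul_zero, sub_eq_zero] at ht
        exact ht
      exact ⟨0, by rw [this m₂ hm₂]; simp, fun x hx => ⟨0, le_rfl, le_rfl, by rw [this x hx]; simp⟩⟩
    · have hdd : 0 < d ⬝ᵥ d := lt_of_le_of_ne
        (Finset.sum_nonneg fun i _ => mul_self_nonneg _) fun h' =>
          hd0 (dotProduct_self_eq_zero.1 h'.symm)
      obtain ⟨T, hT⟩ := hd m₁ hm₁ m₂ hm₂
      rw [sub_eq_iff_eq_add'] at hT
      refine ⟨T, hT, fun x hx => ?_⟩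
      obtain ⟨t, ht⟩ := hd m₁ hm₁ x hx
      rw [sub_eq_iff_eq_add'] at ht
      have h1 := h.mem_stabilitySet.1 hx d
      have h2 := h.mem_stabilitySet.1 hx (-d)
      rw [← hm₁d, ht, add_dotProduct, smul_dotProduct, smul_eq_mul] at h1
      rw [← hm₂d, ht, hT, add_dotProduct, add_dotProduct, smul_dotProduct, smul_dotProduct,
        smul_eq_mul, smul_eq_mul, dotProduct_neg, dotProduct_neg] at h2
      exact ⟨t, by nlinarith, by nlinarith, ht⟩
  -- `φ` equals `m₁` on one half-space and `m₂` on the other. A lattice vector or its negative lies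
  -- in a given half-space, so both endpoints take rational values on the lattice.
  have hval : ∀ v : Fin n → ℝ, 0 ≤ d ⬝ᵥ v → m₁ ⬝ᵥ v = φ v := by
    intro v hv
    obtain ⟨m, hm, hmv⟩ := h.exists_mem_stabilitySet hc v
    obtain ⟨t, ht, -, rfl⟩ := hTall m hm
    rw [add_dotProduct, smul_dotProduct, smul_eq_mul] at hmv
    exact le_antisymm (by nlinarith) (h.mem_stabilitySet.1 hm₁ v)
  have hval' : ∀ v : Fin n → ℝ, d ⬝ᵥ v ≤ 0 → m₂ ⬝ᵥ v = φ v := by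
    intro v hv
    obtain ⟨m, hm, hmv⟩ := h.exists_mem_stabilitySet hc v
    obtain ⟨t, -, ht, rfl⟩ := hTall m hm
    refine le_antisymm ?_ (h.mem_stabilitySet.1 hm₂ v)
    rw [← hmv, hT, add_dotProduct, add_dotProduct, smul_dotProduct, smul_dotProduct, smul_eq_mul,
      smul_eq_mul]
    nlinarith
  have hneg : ∀ v : Fin n → ℤ, -toReal v = toReal (-v) := fun v => by
    funext i; simp [toReal]
  have hr₁ : ∀ v : Fin n → ℤ, ∃ q : ℚ, m₁ ⬝ᵥ toReal v = q := by
    intro v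
    rcases le_total 0 (d ⬝ᵥ toReal v) with hv | hv
    · rw [hval _ hv]; exact hrat v
    · have h1 := hval (-toReal v) (by rw [dotProduct_neg]; linarith)
      obtain ⟨q, hq⟩ := hrat (-v)
      rw [hneg, hq, ← hneg, dotProduct_neg] at h1
      exact ⟨-q, by push_cast; linarith⟩
  have hr₂ : ∀ v : Fin n → ℤ, ∃ q : ℚ, m₂ ⬝ᵥ toReal v = q := by
    intro v
    rcases le_total (d ⬝ᵥ toReal v) 0 with hv | hv
    · rw [hval' _ hv]; exact hrat v
    · have h1 := hval' (-toReal v) (by rw [dotProduct_neg]; linarith)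
      obtain ⟨q, hq⟩ := hrat (-v)
      rw [hneg, hq, ← hneg, dotProduct_neg] at h1
      exact ⟨-q, by push_cast; linarith⟩
  have hcoord : ∀ m : Fin n → ℝ, (∀ v : Fin n → ℤ, ∃ q : ℚ, m ⬝ᵥ toReal v = q) →
      ∃ q, ratToReal q = m := by
    intro m hm
    choose q hq using fun i : Fin n => hm (Pi.single i 1)
    refine ⟨q, funext fun i => ?_⟩
    rw [ratToReal, ← hq i]
    have : toReal (Pi.single i 1 : Fin n → ℤ) = Pi.single i 1 := by
      funext a
      by_cases ha : a = i
      · subst ha; simp [toReal]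
      · simp [toReal, ha]
    rw [this]; simp
  obtain ⟨q₁, rfl⟩ := hcoord m₁ hr₁
  obtain ⟨q₂, rfl⟩ := hcoord m₂ hr₂
  refine ⟨{q₁, q₂}, ?_⟩
  rw [Set.image_pair]
  apply le_antisymm
  · refine affineSpan_mono ℝ ?_
    rintro x (rfl | rfl) <;> assumption
  · refine affineSpan_le.2 fun x hx => ?_
    obtain ⟨t, ht0, htT, rfl⟩ := hTall x hx
    have h1 : ratToReal q₁ + t • d =
        AffineMap.lineMap (ratToReal q₁) (ratToReal q₂) (t / T) := by
      rw [AffineMap.lineMap_apply, hT]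
      simp only [vsub_eq_sub, add_sub_cancel_left, vadd_eq_add, smul_smul]
      rcases eq_or_ne T 0 with h0 | h0
      · rw [show t = 0 by linarith]; simp
      · rw [div_mul_cancel₀ _ h0, add_comm]
    rw [SetLike.mem_coe, h1]
    exact AffineMap.lineMap_mem_affineSpan_pair _ _ _

/-- If the affine hull is not the whole space, its dimension is at most one. -/
theorem hasRationalAffineHull_of_le_two {φ : (Fin n → ℝ) → ℝ} (h : IsConical φ)
    (hc : ConcaveOn ℝ Set.univ φ) (hrat : ∀ w : Fin n → ℤ, ∃ q : ℚ, φ (toReal w) = q)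
    (hn : n ≤ 2) : HasRationalAffineHull (stabilitySet φ) := by
  by_cases htop : affineSpan ℝ (stabilitySet φ) = ⊤
  · exact hasRationalAffineHull_of_eq_top htop
  · obtain ⟨m, hm, -⟩ := h.exists_mem_stabilitySet hc 0
    have hdir : (affineSpan ℝ (stabilitySet φ)).direction ≠ ⊤ := by
      rwa [Ne, AffineSubspace.direction_eq_top_iff_of_nonempty ⟨m, subset_affineSpan ℝ _ hm⟩]
    have hlt := Submodule.finrank_lt hdir
    rw [Module.finrank_fin_fun] at hlt
    obtain ⟨d, hd⟩ := finrank_le_one_iff.1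
      (show Module.finrank ℝ (affineSpan ℝ (stabilitySet φ)).direction ≤ 1 by omega)
    refine hasRationalAffineHull_of_line h hc hrat (d := d) fun x hx y hy => ?_
    obtain ⟨t, ht⟩ := hd ⟨y -ᵥ x, AffineSubspace.vsub_mem_direction (subset_affineSpan ℝ _ hy)
      (subset_affineSpan ℝ _ hx)⟩
    exact ⟨t, by simpa using (congrArg Subtype.val ht).symm⟩

end ToricB

namespace ToricB

/-! ### Principal primes in domains -/

/-- A prime `q` strictly below `(x)` omits `x`. Dividing all factors `x` out of a nonzero element of
`q` would leave an element of `q` that is not divisible by `x`. Finite multiplicity takes the role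
of Krull's theorem. -/
theorem height_span_singleton_eq_one {A : Type*} [CommRing A] [IsDomain A] {x : A} (hx : Prime x)
    (hfin : ∀ a : A, a ≠ 0 → FiniteMultiplicity x a) : (Ideal.span {x}).height = 1 := by
  have hp : (Ideal.span {x}).IsPrime := (Ideal.span_singleton_prime hx.ne_zero).2 hx
  apply le_antisymm
  · refine (Ideal.height_le_iff (n := 1)).2 fun q hq hlt => ?_
    have : q = ⊥ := by
      rw [eq_bot_iff]
      intro a ha
      rw [Ideal.mem_bot]
      by_contra ha0
      obtain ⟨c, hac, hxc⟩ := (hfin a ha0).exists_eq_pow_mul_and_not_dvd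
      have hxq : x ∉ q := fun h => hlt.not_ge ((Ideal.span_singleton_le_iff_mem q).2 h)
      rw [hac] at ha
      rcases hq.mem_or_mem ha with h | h
      · exact hxq (hq.mem_of_pow_mem _ h)
      · exact hxc (Ideal.mem_span_singleton.1 (hlt.le h))
    rw [Ideal.height_eq_zero_iff_eq_bot.2 this]
    norm_num
  · rw [Order.one_le_iff_pos, pos_iff_ne_zero, Ne, Ideal.height_eq_zero_iff_eq_bot,
      Ideal.span_singleton_eq_bot]
    exact hx.ne_zero

/-! ### Localization of a unique factorization domain at a prime element. -/

section PrimeSubring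

variable {A : Type*} [CommRing A] [IsDomain A] [UniqueFactorizationMonoid A] (K : Type*) [Field K]
  [Algebra A K] [IsFractionRing A K]

/-- The localization of a unique factorization domain at a prime element. -/
def primeSubring {x : A} (hx : Prime x) : ValuationSubring K where
  carrier := {f | ∃ a b : A, ¬ x ∣ b ∧ f * algebraMap A K b = algebraMap A K a}
  mul_mem' := by
    rintro f g ⟨a, b, hb, h⟩ ⟨c, d, hd, h'⟩
    refine ⟨a * c, b * d, fun hbd => (hx.dvd_or_dvd hbd).elim hb hd, ?_⟩
    rw [map_mul, map_mul, ← h, ← h']; ring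
  one_mem' := ⟨1, 1, fun h => hx.not_isUnit (isUnit_of_dvd_one h), by simp⟩
  add_mem' := by
    rintro f g ⟨a, b, hb, h⟩ ⟨c, d, hd, h'⟩
    refine ⟨a * d + c * b, b * d, fun hbd => (hx.dvd_or_dvd hbd).elim hb hd, ?_⟩
    rw [map_add, map_mul, map_mul, map_mul, ← h, ← h']; ring
  zero_mem' := ⟨0, 1, fun h => hx.not_isUnit (isUnit_of_dvd_one h), by simp⟩
  neg_mem' := by
    rintro f ⟨a, b, hb, h⟩
    exact ⟨-a, b, hb, by rw [map_neg, ← h]; ring⟩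
  mem_or_inv_mem' := by
    intro f
    obtain ⟨a, b, hab, rfl⟩ := IsFractionRing.exists_reduced_fraction A f
    rw [IsFractionRing.mk'_eq_div]
    have hb0 : algebraMap A K b ≠ 0 := IsFractionRing.to_map_ne_zero_of_mem_nonZeroDivisors b.2
    by_cases hb : x ∣ (b : A)
    · have ha : ¬ x ∣ a := fun ha => hx.not_isUnit (hab ha hb)
      have ha0 : algebraMap A K a ≠ 0 := by
        rw [Ne, IsFractionRing.to_map_eq_zero_iff]
        rintro rfl; exact ha (dvd_zero x)
      refine Or.inr ⟨b, a, ha, ?_⟩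
      rw [inv_div, div_mul_cancel₀ _ ha0]
    · exact Or.inl ⟨a, b, hb, by rw [div_mul_cancel₀ _ hb0]⟩

variable {K}

theorem mem_primeSubring {x : A} {hx : Prime x} {f : K} : f ∈ primeSubring K hx ↔
    ∃ a b : A, ¬ x ∣ b ∧ f * algebraMap A K b = algebraMap A K a := Iff.rfl

theorem algebraMap_mem_primeSubring {x : A} (hx : Prime x) (a : A) :
    algebraMap A K a ∈ primeSubring K hx :=
  ⟨a, 1, fun h => hx.not_isUnit (isUnit_of_dvd_one h), by simp⟩

/-- `OrdGE` quantifies over uniformizers and says nothing when there are none; here `x` is one. -/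
theorem irreducible_primeSubring {x : A} (hx : Prime x) :
    Irreducible (⟨algebraMap A K x, algebraMap_mem_primeSubring hx x⟩ : primeSubring K hx) := by
  have hinj := IsFractionRing.injective A K
  have hxK : algebraMap A K x ≠ 0 := (map_ne_zero_iff _ hinj).2 hx.ne_zero
  have hunit : ∀ (z : primeSubring K hx) (c d : A), ¬ x ∣ c → ¬ x ∣ d →
      (z : K) * algebraMap A K d = algebraMap A K c → IsUnit z := by
    intro z c d hc hd h
    have hc0 : algebraMap A K c ≠ 0 := by
      rw [Ne, IsFractionRing.to_map_eq_zero_iff]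
      rintro rfl; exact hc (dvd_zero x)
    have hmem : algebraMap A K d / algebraMap A K c ∈ primeSubring K hx :=
      ⟨d, c, hc, by rw [div_mul_cancel₀ _ hc0]⟩
    refine IsUnit.of_mul_eq_one ⟨_, hmem⟩ (Subtype.ext ?_)
    change (z : K) * (algebraMap A K d / algebraMap A K c) = 1
    rw [← mul_div_assoc, h, div_self hc0]
  refine ⟨fun hu => ?_, fun y z hyz => ?_⟩
  · obtain ⟨y, hy⟩ := hu.exists_right_inv
    obtain ⟨a, b, hb, h⟩ := y.2
    have h1 : algebraMap A K x * (y : K) = 1 := congrArg Subtype.val hy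
    refine hb ⟨a, hinj ?_⟩
    rw [map_mul, ← h, ← mul_assoc, h1, one_mul]
  · obtain ⟨a, b, hb, h⟩ := y.2
    obtain ⟨c, d, hd, h'⟩ := z.2
    have h1 : algebraMap A K x = (y : K) * z := congrArg Subtype.val hyz
    have h2 : x * (b * d) = a * c := by
      apply hinj
      rw [map_mul, map_mul, map_mul, ← h, ← h', h1]; ring
    have hbd : ¬ x ∣ b * d := fun hbd => (hx.dvd_or_dvd hbd).elim hb hd
    rcases hx.dvd_or_dvd (Dvd.intro _ h2) with ⟨a', rfl⟩ | ⟨c', rfl⟩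
    · right
      rw [mul_assoc] at h2
      have h3 := mul_left_cancel₀ hx.ne_zero h2
      exact hunit z c d (fun hc => hbd (h3 ▸ hc.mul_left _)) hd h'
    · left
      rw [mul_left_comm a] at h2
      have h3 := mul_left_cancel₀ hx.ne_zero h2
      exact hunit y a b (fun ha => hbd (h3 ▸ ha.mul_right _)) hb h

/-- An element of the fraction field that lies in the local rings of all prime elements is
integral. -/
theorem exists_algebraMap_eq {f : K} (h : ∀ (x : A) (hx : Prime x), f ∈ primeSubring K hx) :
    ∃ a : A, algebraMap A K a = f := by
  refine IsFractionRing.isInteger_of_isUnit_den (A := A) ?_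
  by_contra hu
  have hd0 : (IsFractionRing.den A f : A) ≠ 0 := nonZeroDivisors.ne_zero (IsFractionRing.den A f).2
  obtain ⟨x, hx, hxd⟩ := WfDvdMonoid.exists_irreducible_factor hu hd0
  have hxp := UniqueFactorizationMonoid.irreducible_iff_prime.1 hx
  obtain ⟨a, b, hb, hab⟩ := h x hxp
  have h1 : f * algebraMap A K (IsFractionRing.den A f) = algebraMap A K (IsFractionRing.num A f) :=
    IsFractionRing.num_mul_den_eq_num_iff_eq.2 rfl
  have h2 : IsFractionRing.num A f * b = a * IsFractionRing.den A f := by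
    apply IsFractionRing.injective A K
    rw [map_mul, map_mul, ← h1, ← hab]; ring
  have h3 : x ∣ IsFractionRing.num A f :=
    (hxp.dvd_or_dvd (h2 ▸ hxd.mul_left a)).resolve_right hb
  exact hx.not_isUnit (IsFractionRing.num_den_reduced A f h3 hxd)

end PrimeSubring

/-! ### Characters -/

variable {k : Type*} [Field k] {n : ℕ}

theorem character_add (m m' : Fin n → ℤ) :
    character k (m + m') = character k m * character k m' := by
  rw [character, character, character, AddMonoidAlgebra.single_mul_single, one_mul]

theorem character_zero : character k (0 : Fin n → ℤ) = 1 := rfl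

theorem coeff_mul_character (f : TorusRing k n) (m l : Fin n → ℤ) :
    (f * character k m).coeff l = f.coeff (l - m) := by
  rw [character, AddMonoidAlgebra.coeff_mul_single_apply, mul_one, sub_eq_add_neg]

/-- The inclusion of the exponents of monomials into the character lattice. -/
def exponentHom (n : ℕ) : (Fin n →₀ ℕ) →+ (Fin n → ℤ) where
  toFun s i := s i
  map_zero' := by funext i; simp
  map_add' s t := by funext i; simp

/-- The Laurent polynomial ring is the localization of the polynomial ring at the monomials, and
localization preserves unique factorization. -/
instance : UniqueFactorizationMonoid (TorusRing k n) := by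
  let ι : MvPolynomial (Fin n) k →+* TorusRing k n :=
    AddMonoidAlgebra.mapDomainRingHom k (exponentHom n)
  let : Algebra (MvPolynomial (Fin n) k) (TorusRing k n) := ι.toAlgebra
  have hι : ∀ s : Fin n →₀ ℕ, ι (MvPolynomial.monomial s 1) = character k (exponentHom n s) :=
    fun s => AddMonoidAlgebra.mapDomain_single
  have hinj : Function.Injective ι := AddMonoidAlgebra.mapDomain_injective fun s t h => by
    ext i
    exact Int.ofNat_inj.1 (congrFun h i)
  let M : Submonoid (MvPolynomial (Fin n) k) := MonoidHom.mrange (MvPolynomial.monomialOneHom k (Fin n))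
  have hloc : IsLocalization M (TorusRing k n) := by
    rw [isLocalization_iff]
    refine ⟨?_, fun f => ?_, fun {x y} hxy => ⟨1, by rw [hinj hxy]⟩⟩
    · rintro ⟨_, s, rfl⟩
      refine IsUnit.of_mul_eq_one (character k (-exponentHom n s.toAdd)) ?_
      change ι (MvPolynomial.monomial _ 1) * _ = 1
      rw [hι, ← character_add, add_neg_cancel, character_zero]
    · suffices H : ∃ (s : Fin n →₀ ℕ) (a : MvPolynomial (Fin n) k),
          f * character k (exponentHom n s) = ι a by
        obtain ⟨s, a, h⟩ := H
        refine ⟨(a, ⟨_, Multiplicative.ofAdd s, rfl⟩), ?_⟩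
        change f * ι (MvPolynomial.monomial s 1) = ι a
        rw [← h, ← hι]
      induction f using AddMonoidAlgebra.induction_linear with
      | zero => exact ⟨0, 0, by simp⟩
      | add f g hf hg =>
        obtain ⟨s, a, h⟩ := hf
        obtain ⟨t, b, h'⟩ := hg
        refine ⟨s + t, a * MvPolynomial.monomial t 1 + b * MvPolynomial.monomial s 1, ?_⟩
        rw [map_add ι, map_mul, map_mul, ← h, ← h', hι, hι, map_add, character_add]; ring
      | single m c =>
        refine ⟨Finsupp.equivFunOnFinite.symm fun i => (-m i).toNat,
          MvPolynomial.monomial (Finsupp.equivFunOnFinite.symm fun i => (m i).toNat) c, ?_⟩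
        change _ = AddMonoidAlgebra.mapDomain _ (AddMonoidAlgebra.single _ c)
        rw [AddMonoidAlgebra.mapDomain_single, character, AddMonoidAlgebra.single_mul_single,
          mul_one]
        congr 1
        funext i
        simp only [exponentHom, Pi.add_apply, AddMonoidHom.coe_mk, ZeroHom.coe_mk,
          Finsupp.equivFunOnFinite_symm_apply_apply]
        omega
  exact UniqueFactorizationMonoid.of_isLocalization M (TorusRing k n)

end ToricB

namespace ToricB

variable {k : Type*} [Field k] {n : ℕ}

/-! ### The order of a rational function along a toric divisor -/

/-- The inclusion of the ring of the torus into the field of rational functions. -/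
abbrev torusMap (k : Type*) [Field k] (n : ℕ) : TorusRing k n →+* FunctionField k n :=
  algebraMap (TorusRing k n) (FunctionField k n)

theorem torusMap_injective : Function.Injective (torusMap k n) :=
  IsFractionRing.injective _ _

/-- The ring of the torus, graded by the pairing with `v`, as a subring of the ring of
(generalized) Laurent series. -/
def weightHom (k : Type*) [Field k] {n : ℕ} (v : Fin n → ℤ) :
    TorusRing k n →+* HahnSeries ℤ (FunctionField k n) :=
  AddMonoidAlgebra.liftNCRingHom (HahnSeries.C.comp (algebraMap k (FunctionField k n)))
    -- The coefficient is the character itself and not `1`, so distinct characters of equal weight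
    -- do not cancel and the map is injective.
    { toFun := fun m => HahnSeries.single (m.toAdd ⬝ᵥ v) (torusMap k n (character k m.toAdd))
      map_one' := by
        rw [toAdd_one, zero_dotProduct, character_zero, map_one]; rfl
      map_mul' := fun a b => by
        rw [toAdd_mul, add_dotProduct, character_add, map_mul, HahnSeries.single_mul_single] }
    fun _ _ => Commute.all _ _

theorem torusMap_single (m : Fin n → ℤ) (c : k) :
    torusMap k n (AddMonoidAlgebra.single m c) = c • torusMap k n (character k m) := by
  have : AddMonoidAlgebra.single m c = c • character k m := by
    rw [character, AddMonoidAlgebra.smul_single, smul_eq_mul, mul_one]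
  rw [this, Algebra.smul_def, map_mul, Algebra.smul_def,
    IsScalarTower.algebraMap_apply k (TorusRing k n) (FunctionField k n)]

theorem weightHom_single (v m : Fin n → ℤ) (c : k) :
    weightHom k v (AddMonoidAlgebra.single m c) =
      HahnSeries.single (m ⬝ᵥ v) (torusMap k n (AddMonoidAlgebra.single m c)) := by
  rw [torusMap_single, Algebra.smul_def, weightHom, AddMonoidAlgebra.liftNCRingHom_single]
  change HahnSeries.single 0 _ * HahnSeries.single (m ⬝ᵥ v) _ = _
  rw [HahnSeries.single_mul_single, zero_add]
  rfl

theorem coeff_weightHom (v : Fin n → ℤ) (f : TorusRing k n) (j : ℤ) :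
    (weightHom k v f).coeff j =
      torusMap k n (AddMonoidAlgebra.ofCoeff (f.coeff.filter fun m => m ⬝ᵥ v = j)) := by
  induction f using AddMonoidAlgebra.induction_linear with
  | zero => rw [map_zero, AddMonoidAlgebra.coeff_zero, Finsupp.filter_zero,
      AddMonoidAlgebra.ofCoeff_zero, map_zero, HahnSeries.coeff_zero]
  | add f g hf hg =>
    rw [map_add, HahnSeries.coeff_add, hf, hg, ← map_add, AddMonoidAlgebra.coeff_add,
      Finsupp.filter_add, AddMonoidAlgebra.ofCoeff_add]
  | single m c =>
    rw [weightHom_single, AddMonoidAlgebra.coeff_single]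
    by_cases h : m ⬝ᵥ v = j
    · rw [Finsupp.filter_single_of_pos (fun m => m ⬝ᵥ v = j) h, h, HahnSeries.coeff_single_same]
      rfl
    · rw [Finsupp.filter_single_of_neg (fun m => m ⬝ᵥ v = j) h,
        HahnSeries.coeff_single_of_ne (Ne.symm h), AddMonoidAlgebra.ofCoeff_zero, map_zero]

theorem coeff_weightHom_eq_zero {v : Fin n → ℤ} {f : TorusRing k n} {j : ℤ} :
    (weightHom k v f).coeff j = 0 ↔ ∀ m ∈ f.coeff.support, m ⬝ᵥ v ≠ j := by
  rw [coeff_weightHom, map_eq_zero_iff _ torusMap_injective, AddMonoidAlgebra.ofCoeff_eq_zero,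
    Finsupp.filter_eq_zero_iff]
  constructor
  · intro h m hm hj
    exact Finsupp.mem_support_iff.1 hm (h m hj)
  · intro h m hj
    by_contra hm
    exact h m (Finsupp.mem_support_iff.2 hm) hj

theorem weightHom_injective (v : Fin n → ℤ) : Function.Injective (weightHom k v) := by
  rw [injective_iff_map_eq_zero]
  intro f hf
  rw [← AddMonoidAlgebra.coeff_eq_zero, ← Finsupp.support_eq_empty, Finset.eq_empty_iff_forall_notMem]
  intro m hm
  have h : (weightHom k v f).coeff (m ⬝ᵥ v) = 0 := by rw [hf]; rfl
  exact coeff_weightHom_eq_zero.1 h m hm rfl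

/-- The order of rational functions along the toric divisor of `v`. -/
def toricOrd (k : Type*) [Field k] {n : ℕ} (v : Fin n → ℤ) :
    AddValuation (FunctionField k n) (WithTop ℤ) :=
  (HahnSeries.addVal ℤ (FunctionField k n)).comap
    (IsFractionRing.lift (A := TorusRing k n) (g := weightHom k v)
      (weightHom_injective v))

/-- The coefficient at `j` of the series of `f` is the part of `f` of weight `j`, so the order is
the least weight in the support. -/
theorem le_toricOrd_torusMap {v : Fin n → ℤ} {f : TorusRing k n} {j : ℤ} :
    (j : WithTop ℤ) ≤ toricOrd k v (torusMap k n f) ↔ ∀ m ∈ f.coeff.support, j ≤ m ⬝ᵥ v := by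
  have h1 : toricOrd k v (torusMap k n f) = (weightHom k v f).orderTop := by
    change HahnSeries.addVal _ _ (IsFractionRing.lift _ _) = _
    rw [IsFractionRing.lift_algebraMap, HahnSeries.addVal_apply]
  rw [h1, HahnSeries.le_orderTop_iff_forall]
  constructor
  · intro h m hm
    by_contra! hlt
    exact coeff_weightHom_eq_zero.1 (h (m ⬝ᵥ v) (by exact_mod_cast hlt)) m hm rfl
  · intro h i hi
    refine coeff_weightHom_eq_zero.2 fun m hm hmi => ?_
    have := h m hm
    have hi' : i < j := by exact_mod_cast hi
    omega

theorem support_character (m : Fin n → ℤ) : (character k m).coeff.support = {m} := by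
  rw [character, AddMonoidAlgebra.coeff_single, Finsupp.support_single _ one_ne_zero]

theorem torusMap_character_ne_zero (m : Fin n → ℤ) : torusMap k n (character k m) ≠ 0 := by
  rw [Ne, map_eq_zero_iff _ torusMap_injective]
  intro h
  have := support_character (k := k) m
  rw [h] at this
  simp at this

theorem exists_toricOrd_eq (v : Fin n → ℤ) {f : FunctionField k n} (hf : f ≠ 0) :
    ∃ j : ℤ, toricOrd k v f = j := by
  have := (AddValuation.ne_top_iff (toricOrd k v)).2 hf
  exact ⟨_, (WithTop.coe_untop _ this).symm⟩

theorem toricOrd_character (v m : Fin n → ℤ) :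
    toricOrd k v (torusMap k n (character k m)) = ((m ⬝ᵥ v : ℤ) : WithTop ℤ) := by
  obtain ⟨j, hj⟩ := exists_toricOrd_eq v (torusMap_character_ne_zero (k := k) m)
  have h : ∀ i : ℤ, i ≤ j ↔ i ≤ m ⬝ᵥ v := fun i => by
    have := le_toricOrd_torusMap (k := k) (v := v) (f := character k m) (j := i)
    rw [hj, support_character] at this
    simpa using this
  rw [hj, le_antisymm ((h j).1 le_rfl) ((h _).2 le_rfl)]

theorem torusMap_character_zpow (m : Fin n → ℤ) (j : ℤ) :
    torusMap k n (character k m) ^ j = torusMap k n (character k (j • m)) := by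
  let χ : Multiplicative (Fin n → ℤ) →* FunctionField k n :=
    { toFun := fun m => torusMap k n (character k m.toAdd)
      map_one' := by rw [toAdd_one, character_zero, map_one]
      map_mul' := fun a b => by rw [toAdd_mul, character_add, map_mul] }
  have h := congrArg Units.val (map_zpow χ.toHomUnits (Multiplicative.ofAdd m) j)
  rw [Units.val_zpow_eq_zpow_val] at h
  exact h.symm

/-- The local ring of a toric divisor. -/
def toricSubring (k : Type*) [Field k] {n : ℕ} (v : Fin n → ℤ) :
    ValuationSubring (FunctionField k n) where
  carrier := {f | 0 ≤ toricOrd k v f}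
  mul_mem' {f g} hf hg := by
    rw [Set.mem_ofPred_eq, AddValuation.map_mul]; exact add_nonneg hf hg
  one_mem' := by
    rw [Set.mem_ofPred_eq]
    exact (AddValuation.map_one _).ge
  add_mem' {f g} hf hg := by
    rw [Set.mem_ofPred_eq] at hf hg ⊢
    exact AddValuation.map_le_add _ hf hg
  zero_mem' := by rw [Set.mem_ofPred_eq, AddValuation.map_zero]; exact le_top
  neg_mem' {f} hf := by rw [Set.mem_ofPred_eq, AddValuation.map_neg]; exact hf
  mem_or_inv_mem' f := by
    by_cases hf : f = 0
    · left; rw [hf, Set.mem_ofPred_eq, AddValuation.map_zero]; exact le_top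
    obtain ⟨j, hj⟩ := exists_toricOrd_eq v hf
    obtain ⟨i, hi⟩ := exists_toricOrd_eq v (inv_ne_zero hf)
    have h := AddValuation.map_mul (toricOrd k v) f f⁻¹
    rw [mul_inv_cancel₀ hf, AddValuation.map_one, hj, hi] at h
    have h' : (0 : ℤ) = j + i := by exact_mod_cast h
    simp only [Set.mem_ofPred_eq, hj, hi]
    rcases le_total 0 j with h0 | h0
    · left; exact_mod_cast h0
    · right
      have : 0 ≤ i := by omega
      exact_mod_cast this

theorem mem_toricSubring {v : Fin n → ℤ} {f : FunctionField k n} :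
    f ∈ toricSubring k v ↔ 0 ≤ toricOrd k v f := by
  rw [← ValuationSubring.mem_carrier]
  exact Set.mem_ofPred

theorem toricSubring_valuation_le_iff {v : Fin n → ℤ} {f g : FunctionField k n} (hg : g ≠ 0) :
    (toricSubring k v).valuation f ≤ (toricSubring k v).valuation g ↔
      toricOrd k v g ≤ toricOrd k v f := by
  have h0 : 0 < (toricSubring k v).valuation g := zero_lt_iff.2 ((Valuation.ne_zero_iff _).2 hg)
  rw [← div_le_one₀ h0, ← map_div₀, ValuationSubring.valuation_le_one_iff, mem_toricSubring]
  obtain ⟨j, hj⟩ := exists_toricOrd_eq v hg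
  have h : toricOrd k v f = toricOrd k v (f / g) + toricOrd k v g := by
    rw [← AddValuation.map_mul, div_mul_cancel₀ _ hg]
  rw [h, hj]
  by_cases hf : f / g = 0
  · rw [hf, AddValuation.map_zero]; simp
  · obtain ⟨i, hi⟩ := exists_toricOrd_eq v hf
    rw [hi]
    norm_cast
    omega

theorem mem_of_ordGE_zero {K : Type*} [Field K] {V : ValuationSubring K} {f : K}
    (hV : ∃ ϖ : V, Irreducible ϖ) (h : OrdGE V 0 f) : f ∈ V := by
  obtain ⟨ϖ, hϖ⟩ := hV
  have := h ϖ hϖ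
  rwa [zpow_zero, V.valuation_le_one_iff] at this

theorem isUnit_of_toricOrd_eq_zero {v : Fin n → ℤ} {y : toricSubring k v}
    (h : toricOrd k v y = 0) : IsUnit y := by
  have hy : (y : FunctionField k n) ≠ 0 := fun h0 => by
    rw [h0, AddValuation.map_zero] at h
    exact absurd h (by simp)
  have h1 := AddValuation.map_mul (toricOrd k v) (y : FunctionField k n) (y : FunctionField k n)⁻¹
  rw [mul_inv_cancel₀ hy, AddValuation.map_one, h, zero_add] at h1
  exact IsUnit.of_mul_eq_one ⟨_, mem_toricSubring.2 h1.le⟩ (Subtype.ext (mul_inv_cancel₀ hy))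

theorem toricOrd_eq_zero_of_isUnit {v : Fin n → ℤ} {y : toricSubring k v} (h : IsUnit y) :
    toricOrd k v y = 0 := by
  obtain ⟨z, hz⟩ := h.exists_right_inv
  have h1 : (y : FunctionField k n) * z = 1 := congrArg Subtype.val hz
  have h2 := AddValuation.map_mul (toricOrd k v) (y : FunctionField k n) z
  rw [h1, AddValuation.map_one] at h2
  have hy : (y : FunctionField k n) ≠ 0 := left_ne_zero_of_mul_eq_one h1
  have hz' : (z : FunctionField k n) ≠ 0 := right_ne_zero_of_mul_eq_one h1
  have hy0 := mem_toricSubring.1 y.2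
  have hz0 := mem_toricSubring.1 z.2
  obtain ⟨i, hi⟩ := exists_toricOrd_eq v hy
  obtain ⟨j, hj⟩ := exists_toricOrd_eq v hz'
  rw [hi] at hy0 h2 ⊢
  rw [hj] at hz0 h2
  norm_cast at hy0 hz0 h2 ⊢
  omega

/-- The uniformizers of the local ring of a toric divisor. -/
theorem irreducible_toricSubring_iff {v m : Fin n → ℤ} (hm : m ⬝ᵥ v = 1) {y : toricSubring k v} :
    Irreducible y ↔ toricOrd k v y = 1 := by
  have hcm := toricOrd_character (k := k) v m
  rw [hm] at hcm
  have hmem : torusMap k n (character k m) ∈ toricSubring k v := by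
    rw [mem_toricSubring, hcm]; exact_mod_cast zero_le_one
  constructor
  · intro hy
    obtain ⟨j, hj⟩ := exists_toricOrd_eq v (f := (y : FunctionField k n))
      fun h => hy.ne_zero (Subtype.ext h)
    have hj0 : 0 ≤ j := by
      have := mem_toricSubring.1 y.2
      rw [hj] at this
      exact_mod_cast this
    have hj1 : j ≠ 0 := by
      rintro rfl
      exact hy.not_isUnit (isUnit_of_toricOrd_eq_zero hj)
    have hz : toricOrd k v ((y : FunctionField k n) * torusMap k n (character k (-m))) =
        ((j - 1 : ℤ) : WithTop ℤ) := by
      rw [AddValuation.map_mul, hj, toricOrd_character, neg_dotProduct, hm, ← WithTop.coe_add]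
      rfl
    have hzmem : (y : FunctionField k n) * torusMap k n (character k (-m)) ∈ toricSubring k v := by
      rw [mem_toricSubring, hz]
      have : 0 ≤ j - 1 := by omega
      exact_mod_cast this
    have hfac : y = ⟨_, hmem⟩ * ⟨_, hzmem⟩ := by
      apply Subtype.ext
      change (y : FunctionField k n) = torusMap k n (character k m) *
        ((y : FunctionField k n) * torusMap k n (character k (-m)))
      rw [mul_left_comm, ← map_mul, ← character_add, add_neg_cancel, character_zero, map_one,
        mul_one]
    rcases hy.isUnit_or_isUnit hfac with h | h
    · have := toricOrd_eq_zero_of_isUnit h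
      rw [hcm] at this
      exact absurd this (by norm_num)
    · have h1 := toricOrd_eq_zero_of_isUnit h
      rw [hz] at h1
      have : j - 1 = 0 := by exact_mod_cast h1
      rw [hj, show j = 1 by omega]; rfl
  · intro hy
    refine ⟨fun h => ?_, fun a b hab => ?_⟩
    · rw [toricOrd_eq_zero_of_isUnit h] at hy
      exact absurd hy (by norm_num)
    · have h1 : (y : FunctionField k n) = a * b := congrArg Subtype.val hab
      have hy0 : (y : FunctionField k n) ≠ 0 := fun h => by
        rw [h, AddValuation.map_zero] at hy
        exact absurd hy (by decide)
      rw [h1] at hy0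
      obtain ⟨i, hi⟩ := exists_toricOrd_eq v (left_ne_zero_of_mul hy0)
      obtain ⟨j, hj⟩ := exists_toricOrd_eq v (right_ne_zero_of_mul hy0)
      have ha := mem_toricSubring.1 a.2
      have hb := mem_toricSubring.1 b.2
      rw [h1, AddValuation.map_mul, hi, hj] at hy
      rw [hi] at ha
      rw [hj] at hb
      norm_cast at ha hb hy
      rcases (show i = 0 ∨ j = 0 by omega) with h | h
      · left; exact isUnit_of_toricOrd_eq_zero (by rw [hi, h]; rfl)
      · right; exact isUnit_of_toricOrd_eq_zero (by rw [hj, h]; rfl)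

/-- All uniformizers have order one, hence the same valuation as `χ^m`; and `(χ^m)^j = χ^(jm)` has
order `j`. -/
theorem ordGE_toricSubring_iff {v m : Fin n → ℤ} (hm : m ⬝ᵥ v = 1) {j : ℤ}
    {f : FunctionField k n} : OrdGE (toricSubring k v) j f ↔ (j : WithTop ℤ) ≤ toricOrd k v f := by
  have hcm := toricOrd_character (k := k) v m
  rw [hm] at hcm
  have hmem : torusMap k n (character k m) ∈ toricSubring k v := by
    rw [mem_toricSubring, hcm]; exact_mod_cast zero_le_one
  have hirr : Irreducible (⟨_, hmem⟩ : toricSubring k v) := (irreducible_toricSubring_iff hm).2 hcm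
  have key : (toricSubring k v).valuation f ≤
      (toricSubring k v).valuation (torusMap k n (character k m)) ^ j ↔
      (j : WithTop ℤ) ≤ toricOrd k v f := by
    rw [← map_zpow₀, torusMap_character_zpow,
      toricSubring_valuation_le_iff (torusMap_character_ne_zero _), toricOrd_character,
      smul_dotProduct, hm, smul_eq_mul, mul_one]
  rw [← key]
  constructor
  · intro h; exact h _ hirr
  · intro h ϖ hϖ
    refine h.trans (le_of_eq ?_)
    congr 1
    have h1 := (irreducible_toricSubring_iff hm).1 hϖ
    have h0 : (ϖ : FunctionField k n) ≠ 0 := fun h => hϖ.ne_zero (Subtype.ext h)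
    exact le_antisymm
      ((toricSubring_valuation_le_iff h0).2 (by rw [h1, hcm]; rfl))
      ((toricSubring_valuation_le_iff (torusMap_character_ne_zero _)).2 (by rw [h1, hcm]; rfl))

end ToricB

namespace ToricB

variable {k : Type*} [Field k] {n : ℕ}

/-! ### The rings of the charts -/

theorem mem_support_mul_character {f : TorusRing k n} {l m : Fin n → ℤ} :
    m ∈ (f * character k l).coeff.support ↔ m - l ∈ f.coeff.support := by
  rw [Finsupp.mem_support_iff, Finsupp.mem_support_iff, coeff_mul_character]

theorem mem_chart {σ : Cone n} {f : TorusRing k n} :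
    f ∈ chart k σ ↔ ∀ m ∈ f.coeff.support, ∀ u ∈ σ, 0 ≤ toReal m ⬝ᵥ u := by
  classical
  constructor
  · intro hf
    induction hf using Algebra.adjoin_induction with
    | mem f hf =>
      obtain ⟨m, hm, rfl⟩ := hf
      intro m' hm'
      rw [support_character, Finset.mem_singleton] at hm'
      rw [hm']; exact hm
    | algebraMap c =>
      intro m hm u _
      rw [AddMonoidAlgebra.coe_algebraMap, Function.comp_apply,
        AddMonoidAlgebra.coeff_single] at hm
      have := Finset.mem_singleton.1 (Finsupp.support_single_subset hm)
      rw [this, toReal_zero, zero_dotProduct]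
    | add f g _ _ hf hg =>
      intro m hm
      rw [AddMonoidAlgebra.coeff_add] at hm
      rcases Finset.mem_union.1 (Finsupp.support_add hm) with h | h
      · exact hf m h
      · exact hg m h
    | mul f g _ _ hf hg =>
      intro m hm u hu
      obtain ⟨a, ha, b, hb, rfl⟩ := Finset.mem_add.1
        (AddMonoidAlgebra.support_coeff_mul_subset f g hm)
      rw [toReal_add, add_dotProduct]
      exact add_nonneg (hf a ha u hu) (hg b hb u hu)
  · intro h
    refine (Submodule.span_le (p := Subalgebra.toSubmodule (chart k σ))).2 ?_
      (AddMonoidAlgebra.mem_span_support_coeff f)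
    rintro _ ⟨m, hm, rfl⟩
    exact Algebra.subset_adjoin ⟨m, h m hm, rfl⟩

theorem mem_chart_coneOf {F : Finset (Fin n → ℤ)} {f : TorusRing k n} :
    f ∈ chart k (coneOf F) ↔ ∀ m ∈ f.coeff.support, ∀ w ∈ F, 0 ≤ m ⬝ᵥ w := by
  rw [mem_chart]
  refine forall₂_congr fun m _ => ⟨fun h w hw => ?_, fun h u hu => dotProduct_nonneg_of_coneOf h hu⟩
  have := h _ (toReal_mem_coneOf hw)
  rw [toReal_dotProduct] at this
  exact_mod_cast this

theorem character_mem_chart_coneOf {F : Finset (Fin n → ℤ)} {m : Fin n → ℤ} :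
    character k m ∈ chart k (coneOf F) ↔ ∀ w ∈ F, 0 ≤ m ⬝ᵥ w := by
  rw [mem_chart_coneOf, support_character]
  simp

/-! ### The divisor of one generator in the chart of a smooth cone. -/

section Chart

variable {F : Finset (Fin n → ℤ)} {v m : Fin n → ℤ}

theorem toricOrd_nonneg_of_mem_chart (hv : v ∈ F) {f : TorusRing k n}
    (hf : f ∈ chart k (coneOf F)) : 0 ≤ toricOrd k v (torusMap k n f) := by
  have := (le_toricOrd_torusMap (v := v) (f := f) (j := 0)).2
    fun m hm => mem_chart_coneOf.1 hf m hm v hv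
  exact_mod_cast this

/-- The ideal of a toric divisor in a chart is generated by a character. -/
theorem mem_span_character_iff (hv : v ∈ F) (hm1 : m ⬝ᵥ v = 1)
    (hm0 : ∀ w ∈ F, w ≠ v → m ⬝ᵥ w = 0) (hm : character k m ∈ chart k (coneOf F))
    (a : chart k (coneOf F)) :
    a ∈ Ideal.span {(⟨character k m, hm⟩ : chart k (coneOf F))} ↔
      1 ≤ toricOrd k v (torusMap k n a) := by
  rw [Ideal.mem_span_singleton]
  constructor
  · rintro ⟨b, rfl⟩
    change 1 ≤ toricOrd k v (torusMap k n (character k m * b))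
    rw [map_mul, AddValuation.map_mul, toricOrd_character, hm1]
    exact le_add_of_nonneg_right (toricOrd_nonneg_of_mem_chart hv b.2)
  · intro h
    have h1 := (le_toricOrd_torusMap (v := v) (f := (a : TorusRing k n)) (j := 1)).1 h
    have hmem : (a : TorusRing k n) * character k (-m) ∈ chart k (coneOf F) := by
      refine mem_chart_coneOf.2 fun l hl w hw => ?_
      rw [mem_support_mul_character, sub_neg_eq_add] at hl
      have h2 := mem_chart_coneOf.1 a.2 _ hl w hw
      rw [add_dotProduct] at h2
      by_cases hwv : w = v
      · have h3 := h1 _ hl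
        rw [add_dotProduct, hm1] at h3
        rw [hwv]; omega
      · rw [hm0 w hw hwv] at h2; omega
    refine ⟨⟨_, hmem⟩, Subtype.ext ?_⟩
    change (a : TorusRing k n) = character k m * (a * character k (-m))
    rw [mul_left_comm, ← character_add, add_neg_cancel, character_zero, mul_one]

/-- Divisibility by `χ^m` means order at least one. Orders are additive and nonnegative on the
chart, so one factor of a product of positive order has positive order. -/
theorem prime_character (hv : v ∈ F) (hm1 : m ⬝ᵥ v = 1)
    (hm0 : ∀ w ∈ F, w ≠ v → m ⬝ᵥ w = 0) (hm : character k m ∈ chart k (coneOf F)) :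
    Prime (⟨character k m, hm⟩ : chart k (coneOf F)) := by
  have hdvd := fun a => Ideal.mem_span_singleton.symm.trans
    (mem_span_character_iff hv hm1 hm0 hm a)
  refine ⟨fun h => ?_, fun h => ?_, fun a b h => ?_⟩
  · have h1 : character k m = 0 := congrArg Subtype.val h
    exact torusMap_character_ne_zero (k := k) m (by rw [h1, map_zero])
  · have h1 := (hdvd 1).1 (isUnit_iff_dvd_one.1 h)
    change 1 ≤ toricOrd k v (torusMap k n 1) at h1
    rw [map_one, AddValuation.map_one] at h1
    exact absurd h1 (by norm_num)
  · rw [hdvd] at h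
    change 1 ≤ toricOrd k v (torusMap k n (a * b)) at h
    rw [map_mul, AddValuation.map_mul] at h
    by_contra! hab
    rw [hdvd, hdvd, not_le, not_le] at hab
    have ha := toricOrd_nonneg_of_mem_chart hv a.2
    have hb := toricOrd_nonneg_of_mem_chart hv b.2
    obtain ⟨i, hi⟩ := WithTop.ne_top_iff_exists.1 hab.1.ne_top
    obtain ⟨j, hj⟩ := WithTop.ne_top_iff_exists.1 hab.2.ne_top
    rw [← hi, ← hj] at h hab
    rw [← hi] at ha
    rw [← hj] at hb
    norm_cast at h hab ha hb
    omega

/-- The order along `v` bounds the multiplicity of `χ^m` in a nonzero element. -/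
theorem height_span_character (hv : v ∈ F) (hm1 : m ⬝ᵥ v = 1)
    (hm0 : ∀ w ∈ F, w ≠ v → m ⬝ᵥ w = 0) (hm : character k m ∈ chart k (coneOf F)) :
    (Ideal.span {(⟨character k m, hm⟩ : chart k (coneOf F))}).height = 1 := by
  refine height_span_singleton_eq_one (prime_character hv hm1 hm0 hm) fun a ha => ?_
  obtain ⟨j, hj⟩ := exists_toricOrd_eq v (f := torusMap k n a) (by
    rw [Ne, map_eq_zero_iff _ torusMap_injective]
    exact fun h => ha (Subtype.ext h))
  refine ⟨j.toNat, ?_⟩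
  rintro ⟨b, rfl⟩
  change toricOrd k v (torusMap k n (character k m ^ (j.toNat + 1) * b)) = j at hj
  rw [map_mul, AddValuation.map_mul, map_pow, AddValuation.map_pow, toricOrd_character, hm1] at hj
  have hb := toricOrd_nonneg_of_mem_chart hv b.2
  have h1 : ((j.toNat + 1 : ℕ) : WithTop ℤ) ≤ j := by
    rw [← hj]
    refine le_trans (le_of_eq ?_) (le_add_of_nonneg_right hb)
    simp
  have h2 : ((j.toNat + 1 : ℕ) : ℤ) ≤ j := by exact_mod_cast h1
  omega

/-- The local ring of a chart at the ideal of a toric divisor. -/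
theorem exists_fraction_iff (hF : IsUnimodular F) (hv : v ∈ F) (hm1 : m ⬝ᵥ v = 1)
    (hm0 : ∀ w ∈ F, w ≠ v → m ⬝ᵥ w = 0) (hm : character k m ∈ chart k (coneOf F))
    (f : FunctionField k n) :
    (∃ a b : chart k (coneOf F), b ∉ Ideal.span {(⟨character k m, hm⟩ : chart k (coneOf F))} ∧
      f * torusMap k n b = torusMap k n a) ↔ 0 ≤ toricOrd k v f := by
  constructor
  · rintro ⟨a, b, hb, hab⟩
    rw [mem_span_character_iff hv hm1 hm0, not_le] at hb
    have h1 := congrArg (toricOrd k v) hab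
    rw [AddValuation.map_mul] at h1
    have ha0 := toricOrd_nonneg_of_mem_chart hv a.2
    have hb0 := toricOrd_nonneg_of_mem_chart hv b.2
    obtain ⟨j, hj⟩ := WithTop.ne_top_iff_exists.1 hb.ne_top
    rw [← hj] at hb hb0 h1
    norm_cast at hb hb0
    have : j = 0 := by omega
    rw [this, WithTop.coe_zero, add_zero] at h1
    rw [h1]; exact ha0
  · intro hf
    obtain ⟨g, h, hh, rfl⟩ := IsFractionRing.div_surjective (A := TorusRing k n) f
    have hh0 : torusMap k n h ≠ 0 := IsFractionRing.to_map_ne_zero_of_mem_nonZeroDivisors hh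
    obtain ⟨c, hc⟩ := exists_toricOrd_eq v hh0
    have hg : (c : WithTop ℤ) ≤ toricOrd k v (torusMap k n g) := by
      have h1 : torusMap k n g = torusMap k n g / torusMap k n h * torusMap k n h := by
        rw [div_mul_cancel₀ _ hh0]
      rw [h1, AddValuation.map_mul, hc]
      exact le_add_of_nonneg_left hf
    have hdual : ∀ w ∈ F, ∃ m' : Fin n → ℤ, m' ⬝ᵥ w = 1 ∧ ∀ w' ∈ F, w' ≠ w → m' ⬝ᵥ w' = 0 :=
      fun w hw => by
        obtain ⟨m', h1, h2, -⟩ := hF.exists_dual hw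
        exact ⟨m', h1, h2⟩
    choose! μ hμ1 hμ0 using hdual
    classical
    let N : ℕ := ∑ l ∈ g.coeff.support ∪ h.coeff.support, ∑ w ∈ F, (l ⬝ᵥ w).natAbs
    have hN : ∀ l ∈ g.coeff.support ∪ h.coeff.support, ∀ w ∈ F, (l ⬝ᵥ w).natAbs ≤ N :=
      fun l hl w hw => (Finset.single_le_sum (f := fun w => (l ⬝ᵥ w).natAbs)
        (fun _ _ => Nat.zero_le _) hw).trans
        (Finset.single_le_sum (f := fun l => ∑ w ∈ F, (l ⬝ᵥ w).natAbs)
          (fun _ _ => Nat.zero_le _) hl)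
    -- Multiplying numerator and denominator by `χ^M` brings the denominator to order zero along
    -- `v`, while `N` makes all weights at the other generators nonnegative.
    let M : Fin n → ℤ := (-c) • m + ∑ w ∈ F.erase v, (N : ℤ) • μ w
    have hsum : ∀ w ∈ F, (∑ w' ∈ F.erase v, (N : ℤ) • μ w') ⬝ᵥ w = if w = v then 0 else (N : ℤ) := by
      intro w hw
      rw [sum_dotProduct]
      simp only [smul_dotProduct, smul_eq_mul]
      split_ifs with hwv
      · refine Finset.sum_eq_zero fun w' hw' => ?_
        rw [hμ0 w' (Finset.mem_of_mem_erase hw') w hw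
          (fun h => Finset.ne_of_mem_erase hw' (h ▸ hwv)), mul_zero]
      · rw [Finset.sum_eq_single_of_mem w (Finset.mem_erase.2 ⟨hwv, hw⟩), hμ1 w hw, mul_one]
        intro w' hw' hne
        rw [hμ0 w' (Finset.mem_of_mem_erase hw') w hw hne.symm, mul_zero]
    have hMv : M ⬝ᵥ v = -c := by
      rw [add_dotProduct, hsum v hv, if_pos rfl, smul_dotProduct, hm1]; simp
    have hMw : ∀ w ∈ F, w ≠ v → M ⬝ᵥ w = N := by
      intro w hw hwv
      rw [add_dotProduct, hsum w hw, if_neg hwv, smul_dotProduct, hm0 w hw hwv]; simp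
    have hmem : ∀ p : TorusRing k n, p.coeff.support ⊆ g.coeff.support ∪ h.coeff.support →
        (c : WithTop ℤ) ≤ toricOrd k v (torusMap k n p) →
        p * character k M ∈ chart k (coneOf F) := by
      intro p hp hpc
      refine mem_chart_coneOf.2 fun l hl w hw => ?_
      rw [mem_support_mul_character] at hl
      by_cases hwv : w = v
      · have h1 := le_toricOrd_torusMap.1 hpc _ hl
        rw [sub_dotProduct, hMv] at h1
        rw [hwv]; omega
      · have h1 := hN _ (hp hl) w hw
        rw [sub_dotProduct, hMw w hw hwv] at h1
        omega
    refine ⟨⟨_, hmem g Finset.subset_union_left hg⟩,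
      ⟨_, hmem h Finset.subset_union_right hc.ge⟩, ?_, ?_⟩
    · rw [mem_span_character_iff hv hm1 hm0, not_le, map_mul, AddValuation.map_mul, hc,
        toricOrd_character, hMv, ← WithTop.coe_add, add_neg_cancel]
      norm_num
    · change torusMap k n g / torusMap k n h * torusMap k n (h * character k M) =
        torusMap k n (g * character k M)
      rw [map_mul, map_mul, ← mul_assoc, div_mul_cancel₀ _ hh0]

end Chart

theorem toricIdeal_eq_span {v m : Fin n → ℤ} (hm1 : m ⬝ᵥ v = 1) {σ : Cone n}
    (hσ : coneOf {v} = σ) (hm : character k m ∈ chart k σ) :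
    Ideal.span {a : chart k σ | ∃ m : Fin n → ℤ, 0 < m ⬝ᵥ v ∧ (a : TorusRing k n) = character k m} =
      Ideal.span {(⟨character k m, hm⟩ : chart k σ)} := by
  subst hσ
  have hv : v ∈ ({v} : Finset (Fin n → ℤ)) := by simp
  have hm0 : ∀ w ∈ ({v} : Finset (Fin n → ℤ)), w ≠ v → m ⬝ᵥ w = 0 :=
    fun w hw hne => absurd (Finset.mem_singleton.1 hw) hne
  apply le_antisymm
  · refine Ideal.span_le.2 ?_
    rintro a ⟨l, hl, ha⟩
    rw [SetLike.mem_coe, mem_span_character_iff hv hm1 hm0, ha, toricOrd_character]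
    exact_mod_cast hl
  · refine Ideal.span_le.2 ?_
    rintro _ rfl
    exact Ideal.subset_span ⟨m, by omega, rfl⟩

theorem toricIdeal_properties {v : Fin n → ℤ} (hF : IsUnimodular {v}) :
    (toricIdeal k v).IsPrime ∧ (toricIdeal k v).height = 1 ∧
      ∀ V : ValuationSubring (FunctionField k n), IsToricPrime v V ↔ V = toricSubring k v := by
  have hv : v ∈ ({v} : Finset (Fin n → ℤ)) := by simp
  obtain ⟨m, hm1, hm0, -⟩ := hF.exists_dual hv
  -- The chart ring depends on the cone; generalizing it allows `rayCone v` to be replaced by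
  -- `coneOf {v}` inside the types.
  suffices H : ∀ σ : Cone n, coneOf {v} = σ → ∀ I : Ideal (chart k σ),
      I = Ideal.span {a : chart k σ | ∃ m : Fin n → ℤ, 0 < m ⬝ᵥ v ∧
        (a : TorusRing k n) = character k m} →
      I.IsPrime ∧ I.height = 1 ∧ ∀ V : ValuationSubring (FunctionField k n),
        IsLocalRingAt (chart k σ) I V ↔ V = toricSubring k v from
    H _ (coneOf_singleton v) _ rfl
  rintro σ rfl I rfl
  have hm : character k m ∈ chart k (coneOf {v}) := character_mem_chart_coneOf.2 fun w hw => by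
    rw [Finset.mem_singleton.1 hw, hm1]; norm_num
  rw [toricIdeal_eq_span hm1 rfl hm]
  have hp := prime_character hv hm1 hm0 hm
  refine ⟨(Ideal.span_singleton_prime hp.ne_zero).2 hp, height_span_character hv hm1 hm0 hm,
    fun V => ⟨fun h => ?_, ?_⟩⟩
  · ext f
    rw [h f, mem_toricSubring]
    exact exists_fraction_iff hF hv hm1 hm0 hm f
  · rintro rfl f
    rw [mem_toricSubring]
    exact (exists_fraction_iff hF hv hm1 hm0 hm f).symm

theorem isToricPrime_iff {v : Fin n → ℤ} (hF : IsUnimodular {v})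
    {V : ValuationSubring (FunctionField k n)} : IsToricPrime v V ↔ V = toricSubring k v :=
  (toricIdeal_properties hF).2.2 V

theorem isPrimeDivisor_toricSubring {S : Fan n} {v : Fin n → ℤ} (hv : v ∈ S.rays) :
    IsPrimeDivisor S (toricSubring k v) := by
  have hF := (S.mem_rays_iff.1 hv).1
  obtain ⟨h1, h2, h3⟩ := toricIdeal_properties (k := k) hF
  exact ⟨rayCone v, hv.2, toricIdeal k v, h1, h2, (h3 _).2 rfl⟩

/-- A prime divisor is toric, or the characters are units in its local ring. -/
theorem IsPrimeDivisor.torusMap_mem_or {S : Fan n} {V : ValuationSubring (FunctionField k n)}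
    (hV : IsPrimeDivisor S V) :
    (∃ v : S.rays, IsToricPrime (v : Fin n → ℤ) V) ∨ ∀ g, torusMap k n g ∈ V := by
  classical
  obtain ⟨σ, hσ, p, hp, hp1, hloc⟩ := hV
  obtain ⟨F, hF, rfl⟩ := isSmoothCone_iff.1 (S.smooth σ hσ)
  have hdual : ∀ w ∈ F, ∃ m' : Fin n → ℤ, m' ⬝ᵥ w = 1 ∧ ∀ w' ∈ F, w' ≠ w → m' ⬝ᵥ w' = 0 :=
    fun w hw => by
      obtain ⟨m', h1, h2, -⟩ := hF.exists_dual hw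
      exact ⟨m', h1, h2⟩
  choose! μ hμ1 hμ0 using hdual
  have hμ : ∀ w ∈ F, character k (μ w) ∈ chart k (coneOf F) := fun w hw =>
    character_mem_chart_coneOf.2 fun w' hw' => by
      by_cases h : w' = w
      · rw [h, hμ1 w hw]; norm_num
      · rw [hμ0 w hw w' hw' h]
  -- A prime of height one containing the prime element `χ^(μ w)` is generated by it. If `p`
  -- contains none of these, they are units at `p` and can be used to clear denominators.
  by_cases hex : ∃ (w : Fin n → ℤ) (hw : w ∈ F), (⟨_, hμ w hw⟩ : chart k (coneOf F)) ∈ p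
  · left
    obtain ⟨w, hw, hwp⟩ := hex
    have hray := S.rays_of_mem_face hF hσ hw
    refine ⟨⟨w, hray⟩, (isToricPrime_iff (S.mem_rays_iff.1 hray).1).2 ?_⟩
    have hpe := Ideal.eq_span_singleton_of_height_eq_one hp1 hwp
      (prime_character hw (hμ1 w hw) (hμ0 w hw) (hμ w hw))
    ext f
    rw [hloc f, mem_toricSubring, hpe]
    exact exists_fraction_iff hF hw (hμ1 w hw) (hμ0 w hw) (hμ w hw) f
  · right
    push Not at hex
    intro g
    let N : ℕ := ∑ l ∈ g.coeff.support, ∑ w ∈ F, (l ⬝ᵥ w).natAbs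
    have hN : ∀ l ∈ g.coeff.support, ∀ w ∈ F, (l ⬝ᵥ w).natAbs ≤ N :=
      fun l hl w hw => (Finset.single_le_sum (f := fun w => (l ⬝ᵥ w).natAbs)
        (fun _ _ => Nat.zero_le _) hw).trans
        (Finset.single_le_sum (f := fun l => ∑ w ∈ F, (l ⬝ᵥ w).natAbs)
          (fun _ _ => Nat.zero_le _) hl)
    let b : chart k (coneOf F) := ∏ w : F, (⟨_, hμ w w.2⟩ : chart k (coneOf F)) ^ N
    have hb : b ∉ p := by
      intro hbp
      obtain ⟨w, -, hw⟩ := (Ideal.IsPrime.prod_mem_iff (hp := hp)).1 hbp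
      exact hex w w.2 (hp.mem_of_pow_mem _ hw)
    have hbval : (b : TorusRing k n) = character k (∑ w ∈ F, (N : ℤ) • μ w) := by
      have hpow : ∀ (m : Fin n → ℤ) (j : ℕ), character k m ^ j = character k ((j : ℤ) • m) := by
        intro m j
        rw [character, AddMonoidAlgebra.single_pow, one_pow, natCast_zsmul, character]
      have hprod : ∀ s : Finset (Fin n → ℤ),
          ∏ w ∈ s, character k (μ w) ^ N = character k (∑ w ∈ s, (N : ℤ) • μ w) := by
        intro s
        induction s using Finset.induction_on with
        | empty => rw [Finset.prod_empty, Finset.sum_empty, character_zero]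
        | insert w s hw ih => rw [Finset.prod_insert hw, Finset.sum_insert hw, ih, character_add, hpow]
      rw [← hprod, ← Finset.prod_coe_sort]
      simp [b]
    have hmem : g * character k (∑ w ∈ F, (N : ℤ) • μ w) ∈ chart k (coneOf F) := by
      refine mem_chart_coneOf.2 fun l hl w hw => ?_
      rw [mem_support_mul_character] at hl
      have h1 := hN _ hl w hw
      have h2 : (∑ w ∈ F, (N : ℤ) • μ w) ⬝ᵥ w = N := by
        rw [sum_dotProduct]
        simp only [smul_dotProduct, smul_eq_mul]
        rw [Finset.sum_eq_single_of_mem w hw, hμ1 w hw, mul_one]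
        intro w' hw' hne
        rw [hμ0 w' hw' w hw hne.symm, mul_zero]
      rw [sub_dotProduct, h2] at h1
      omega
    refine (hloc _).2 ⟨⟨_, hmem⟩, b, hb, ?_⟩
    rw [hbval, ← map_mul]

/-! ### Global sections -/

theorem Fan.bot_mem_cones (S : Fan n) : coneOf ∅ ∈ S.cones := by
  obtain ⟨σ, hσ, -⟩ := S.complete 0
  obtain ⟨F, hF, rfl⟩ := isSmoothCone_iff.1 (S.smooth σ hσ)
  exact S.face_mem _ hσ _ (isFaceOf_coneOf hF (Finset.empty_subset F))

theorem mem_chart_empty (f : TorusRing k n) : f ∈ chart k (coneOf (∅ : Finset (Fin n → ℤ))) :=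
  mem_chart_coneOf.2 fun _ _ w hw => absurd hw (Finset.notMem_empty w)

/-- The torus is the chart of the zero cone, which belongs to every fan, and the ring of this chart
is all of `k[M]`. -/
theorem isPrimeDivisor_primeSubring (S : Fan n) {x : TorusRing k n} (hx : Prime x) :
    IsPrimeDivisor S (primeSubring (FunctionField k n) hx) := by
  let e : chart k (coneOf (∅ : Finset (Fin n → ℤ))) ≃+* TorusRing k n :=
    RingEquiv.ofBijective (chart k (coneOf (∅ : Finset (Fin n → ℤ)))).val.toRingHom
      ⟨Subtype.val_injective, fun f => ⟨⟨f, mem_chart_empty f⟩, rfl⟩⟩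
  have he : ∀ a, e a = a := fun a => rfl
  let y : chart k (coneOf (∅ : Finset (Fin n → ℤ))) := ⟨x, mem_chart_empty x⟩
  have hy : Prime y := (MulEquiv.prime_iff e.toMulEquiv).1 hx
  have hdvd : ∀ a : chart k (coneOf (∅ : Finset (Fin n → ℤ))), y ∣ a ↔ x ∣ (a : TorusRing k n) := by
    intro a
    constructor
    · rintro ⟨b, rfl⟩; exact ⟨b, rfl⟩
    · rintro ⟨b, hb⟩; exact ⟨⟨b, mem_chart_empty b⟩, Subtype.ext hb⟩
  refine ⟨_, S.bot_mem_cones, Ideal.span {y}, (Ideal.span_singleton_prime hy.ne_zero).2 hy, ?_, ?_⟩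
  · refine height_span_singleton_eq_one hy fun a ha => ?_
    obtain ⟨j, hj⟩ := FiniteMultiplicity.of_prime_left hx
      (show (a : TorusRing k n) ≠ 0 from fun h => ha (Subtype.ext h))
    refine ⟨j, fun h => hj ?_⟩
    obtain ⟨b, rfl⟩ := h
    exact ⟨b, rfl⟩
  · intro f
    rw [mem_primeSubring]
    constructor
    · rintro ⟨a, b, hb, h⟩
      refine ⟨⟨a, mem_chart_empty a⟩, ⟨b, mem_chart_empty b⟩, ?_, h⟩
      rwa [Ideal.mem_span_singleton, hdvd]
    · rintro ⟨a, b, hb, h⟩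
      rw [Ideal.mem_span_singleton, hdvd] at hb
      exact ⟨a, b, hb, h⟩

/-- The character `χ^(-m)`, with `m` dual to `v`, lies in `k[M]` but has order `-1` along `D_v`. -/
theorem not_isToricPrime_primeSubring {S : Fan n} {x : TorusRing k n} (hx : Prime x)
    (v : S.rays) : ¬ IsToricPrime (v : Fin n → ℤ) (primeSubring (FunctionField k n) hx) := by
  intro h
  have hF := (S.mem_rays_iff.1 v.2).1
  rw [isToricPrime_iff hF] at h
  obtain ⟨m, hm1, -⟩ := hF.exists_dual (Finset.mem_singleton_self _)
  have h1 := algebraMap_mem_primeSubring (K := FunctionField k n) hx (character k (-m))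
  rw [h, mem_toricSubring, toricOrd_character, neg_dotProduct, hm1] at h1
  exact absurd h1 (by decide)

/-- The sections of a toric divisor are the combinations of the characters among them. -/
theorem isSection_iff {S : Fan n} {D : ToricDivisor S} {f : FunctionField k n} :
    IsSection D f ↔ ∃ g : TorusRing k n, torusMap k n g = f ∧
      ∀ m ∈ g.coeff.support, ∀ v : S.rays, -⌊D v⌋ ≤ m ⬝ᵥ (v : Fin n → ℤ) := by
  constructor
  · intro hf
    obtain ⟨g, rfl⟩ : ∃ g, torusMap k n g = f := by
      -- The prime elements of `k[M]` give non-toric prime divisors, where a section is regular;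
      -- this puts `f` in `k[M]`.
      refine exists_algebraMap_eq fun x hx => ?_
      exact mem_of_ordGE_zero ⟨_, irreducible_primeSubring hx⟩
        ((hf _ (isPrimeDivisor_primeSubring S hx)).2 (not_isToricPrime_primeSubring hx))
    refine ⟨g, rfl, fun m hm v => ?_⟩
    have hF := (S.mem_rays_iff.1 v.2).1
    obtain ⟨l, hl, -⟩ := hF.exists_dual (Finset.mem_singleton_self _)
    have h1 := (hf _ (isPrimeDivisor_toricSubring v.2)).1 v ((isToricPrime_iff hF).2 rfl)
    rw [ordGE_toricSubring_iff hl, le_toricOrd_torusMap] at h1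
    exact h1 m hm
  · rintro ⟨g, rfl, hg⟩ V hV
    refine ⟨fun v hv => ?_, fun hnot => ?_⟩
    · have hF := (S.mem_rays_iff.1 v.2).1
      obtain ⟨l, hl, -⟩ := hF.exists_dual (Finset.mem_singleton_self _)
      rw [isToricPrime_iff hF] at hv
      rw [hv, ordGE_toricSubring_iff hl, le_toricOrd_torusMap]
      exact fun m hm => hg m hm v
    · rcases hV.torusMap_mem_or with ⟨v, hv⟩ | h
      · exact absurd hv (hnot v)
      · exact ordGE_of_mem (h g)

theorem BDivisor.mem_H0_iff {S : Fan n} {D : BDivisor S} {f : FunctionField k n} :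
    f ∈ D.H0 k ↔ ∃ g : TorusRing k n, torusMap k n g = f ∧
      ∀ m ∈ g.coeff.support, ∀ (S' : Model S) (v : S'.1.rays),
        -⌊D.inc S' v⌋ ≤ m ⬝ᵥ (v : Fin n → ℤ) := by
  change (∀ S' : Model S, IsSection (D.inc S') f) ↔ _
  constructor
  · intro h
    obtain ⟨g, rfl, -⟩ := isSection_iff.1 (h ⟨S, Fan.Subdivides.refl S⟩)
    refine ⟨g, rfl, fun m hm S' v => ?_⟩
    obtain ⟨g', hg', h'⟩ := isSection_iff.1 (h S')
    rw [torusMap_injective hg'] at h'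
    exact h' m hm v
  · rintro ⟨g, rfl, h⟩ S'
    exact isSection_iff.2 ⟨g, rfl, fun m hm v => h m hm S' v⟩

end ToricB

namespace ToricB

variable {k : Type*} [Field k] {n : ℕ}

/-! ### Graded semigroup rings -/

/-- The monomial `χ^m t^l`. -/
def gradedMonomial (k : Type*) [Field k] {n : ℕ} (p : ℕ × (Fin n → ℤ)) : (FunctionField k n)[X] :=
  Polynomial.monomial p.1 (torusMap k n (character k p.2))

theorem gradedMonomial_zero : gradedMonomial k (0 : ℕ × (Fin n → ℤ)) = 1 := by
  rw [gradedMonomial, Prod.snd_zero, character_zero, map_one, Prod.fst_zero,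
    Polynomial.monomial_zero_one]

theorem gradedMonomial_add (p q : ℕ × (Fin n → ℤ)) :
    gradedMonomial k (p + q) = gradedMonomial k p * gradedMonomial k q := by
  rw [gradedMonomial, Prod.snd_add, character_add, map_mul, Prod.fst_add, gradedMonomial,
    gradedMonomial, Polynomial.monomial_mul_monomial]

/-- The polynomials `∑ f_l t^l` such that the characters `χ^m` of `f_l` satisfy `(l, m) ∈ Γ`. -/
def semigroupRing (k : Type*) [Field k] {n : ℕ} (Γ : AddSubmonoid (ℕ × (Fin n → ℤ))) :
    Subalgebra k (FunctionField k n)[X] where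
  carrier := {F | ∀ l, ∃ g : TorusRing k n, torusMap k n g = F.coeff l ∧
    ∀ m ∈ g.coeff.support, (l, m) ∈ Γ}
  add_mem' {F G} hF hG l := by
    classical
    obtain ⟨f, hf, hf'⟩ := hF l
    obtain ⟨g, hg, hg'⟩ := hG l
    refine ⟨f + g, by rw [map_add, hf, hg, Polynomial.coeff_add], fun m hm => ?_⟩
    rcases Finset.mem_union.1 (Finsupp.support_add hm) with h | h
    · exact hf' m h
    · exact hg' m h
  mul_mem' {F G} hF hG l := by
    classical
    choose f hf hf' using hF
    choose g hg hg' using hG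
    refine ⟨∑ x ∈ Finset.HasAntidiagonal.antidiagonal l, f x.1 * g x.2, ?_, fun m hm => ?_⟩
    · rw [map_sum, Polynomial.coeff_mul]
      exact Finset.sum_congr rfl fun x _ => by rw [map_mul, hf, hg]
    · rw [AddMonoidAlgebra.coeff_sum] at hm
      obtain ⟨x, hx, hmx⟩ := Finset.mem_biUnion.1 (Finsupp.support_finsetSum hm)
      obtain ⟨a, ha, b, hb, rfl⟩ :=
        Finset.mem_add.1 (AddMonoidAlgebra.support_coeff_mul_subset _ _ hmx)
      rw [← Finset.HasAntidiagonal.mem_antidiagonal.1 hx]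
      exact Γ.add_mem (hf' _ _ ha) (hg' _ _ hb)
  algebraMap_mem' c l := by
    rw [Polynomial.algebraMap_apply, Polynomial.coeff_C]
    split_ifs with h
    · refine ⟨AddMonoidAlgebra.single 0 c, ?_, fun m hm => ?_⟩
      · rw [torusMap_single, character_zero, map_one, Algebra.algebraMap_eq_smul_one]
      · rw [AddMonoidAlgebra.coeff_single] at hm
        rw [h, Finset.mem_singleton.1 (Finsupp.support_single_subset hm)]
        exact Γ.zero_mem
    · exact ⟨0, map_zero _, fun m hm => by simp at hm⟩

variable {Γ : AddSubmonoid (ℕ × (Fin n → ℤ))}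

theorem mem_semigroupRing {F : (FunctionField k n)[X]} : F ∈ semigroupRing k Γ ↔
    ∀ l, ∃ g : TorusRing k n, torusMap k n g = F.coeff l ∧ ∀ m ∈ g.coeff.support, (l, m) ∈ Γ :=
  Iff.rfl

theorem gradedMonomial_mem {p : ℕ × (Fin n → ℤ)} :
    gradedMonomial k p ∈ semigroupRing k Γ ↔ p ∈ Γ := by
  rw [mem_semigroupRing]
  constructor
  · intro h
    obtain ⟨g, hg, hg'⟩ := h p.1
    rw [gradedMonomial, Polynomial.coeff_monomial_same] at hg
    rw [torusMap_injective hg, support_character] at hg'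
    exact hg' _ (Finset.mem_singleton_self _)
  · intro h l
    rw [gradedMonomial, Polynomial.coeff_monomial]
    split_ifs with hl
    · refine ⟨_, rfl, fun m hm => ?_⟩
      rw [support_character, Finset.mem_singleton] at hm
      rw [hm, ← hl]
      exact h
    · exact ⟨0, map_zero _, fun m hm => by simp at hm⟩

theorem mem_span_gradedMonomial {F : (FunctionField k n)[X]} (hF : F ∈ semigroupRing k Γ) :
    F ∈ Submodule.span k (gradedMonomial k '' (Γ : Set (ℕ × (Fin n → ℤ)))) := by
  rw [F.as_sum_support]
  refine Submodule.sum_mem _ fun l _ => ?_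
  obtain ⟨g, hg, hg'⟩ := hF l
  have h1 : g = ∑ m ∈ g.coeff.support, AddMonoidAlgebra.single m (g.coeff m) := by
    conv_lhs => rw [← AddMonoidAlgebra.sum_coeff_single g]
    rfl
  rw [← hg, h1, map_sum, map_sum]
  refine Submodule.sum_mem _ fun m hm => ?_
  rw [torusMap_single, ← Polynomial.smul_monomial]
  exact Submodule.smul_mem _ _ (Submodule.subset_span ⟨(l, m), hg' m hm, rfl⟩)

theorem semigroupRing_closure (G : Set (ℕ × (Fin n → ℤ))) :
    Algebra.adjoin k (gradedMonomial k '' G) = semigroupRing k (AddSubmonoid.closure G) := by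
  refine le_antisymm (Algebra.adjoin_le ?_) fun F hF => ?_
  · rintro _ ⟨p, hp, rfl⟩
    exact gradedMonomial_mem.2 (AddSubmonoid.subset_closure hp)
  · have h : Submodule.span k (gradedMonomial k '' (AddSubmonoid.closure G : Set _)) ≤
        Subalgebra.toSubmodule (Algebra.adjoin k (gradedMonomial k '' G)) := by
      rw [Submodule.span_le]
      rintro _ ⟨p, hp, rfl⟩
      change gradedMonomial k p ∈ Algebra.adjoin k (gradedMonomial k '' G)
      induction hp using AddSubmonoid.closure_induction with
      | mem p hp => exact Algebra.subset_adjoin ⟨p, hp, rfl⟩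
      | zero => rw [gradedMonomial_zero]; exact Subalgebra.one_mem _
      | add p q _ _ hp hq => rw [gradedMonomial_add]; exact Subalgebra.mul_mem _ hp hq
    exact h (mem_span_gradedMonomial hF)

theorem semigroupRing_fg (hΓ : Γ.FG) : (semigroupRing k Γ).FG := by
  classical
  obtain ⟨G, rfl⟩ := hΓ
  exact ⟨G.image (gradedMonomial k), by rw [Finset.coe_image, semigroupRing_closure]⟩

/-- The exponents occurring in finitely many algebra generators generate a submonoid whose semigroup
ring contains the whole algebra; a monomial of the algebra then has its exponent in this submonoid.
-/
theorem fg_of_semigroupRing_fg (h : (semigroupRing k Γ).FG) : Γ.FG := by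
  classical
  obtain ⟨T, hT⟩ := h
  have hmem : ∀ F ∈ T, F ∈ semigroupRing k Γ := fun F hF => hT ▸ Algebra.subset_adjoin hF
  have hspan : ∀ F : T, ∃ G : Finset (ℕ × (Fin n → ℤ)), (G : Set (ℕ × (Fin n → ℤ))) ⊆ Γ ∧
      (F : (FunctionField k n)[X]) ∈ semigroupRing k (AddSubmonoid.closure (G : Set _)) := by
    intro F
    have hF := hmem F F.2
    choose g hg hg' using hF
    refine ⟨F.1.support.biUnion fun l => (g l).coeff.support.image fun m => (l, m), ?_, ?_⟩
    · intro p hp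
      obtain ⟨l, -, hp⟩ := Finset.mem_biUnion.1 hp
      obtain ⟨m, hm, rfl⟩ := Finset.mem_image.1 hp
      exact hg' l m hm
    · intro l
      refine ⟨g l, hg l, fun m hm => AddSubmonoid.subset_closure ?_⟩
      refine Finset.mem_biUnion.2 ⟨l, ?_, Finset.mem_image_of_mem _ hm⟩
      rw [Polynomial.mem_support_iff, ← hg l, Ne, map_eq_zero_iff _ torusMap_injective]
      intro h0
      rw [h0] at hm
      simp at hm
  choose G hG hFG using hspan
  refine ⟨Finset.univ.biUnion G, le_antisymm ?_ fun p hp => ?_⟩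
  · rw [AddSubmonoid.closure_le]
    intro p hp
    obtain ⟨F, -, hp⟩ := Finset.mem_biUnion.1 hp
    exact hG F hp
  · rw [← gradedMonomial_mem (k := k)] at hp ⊢
    rw [← hT] at hp
    refine Algebra.adjoin_le (fun F hF l => ?_) hp
    obtain ⟨g, hg, hg'⟩ := hFG ⟨F, hF⟩ l
    refine ⟨g, hg, fun m hm => AddSubmonoid.closure_mono ?_ (hg' m hm)⟩
    exact Finset.coe_subset.2 (Finset.subset_biUnion_of_mem G (Finset.mem_univ _))

/-! ### The semigroup of a concave function -/

/-- The pairs `(l, m)` with `m ∈ l Δ`, where `Δ` is the stability set of `φ`. -/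
def sectionSemigroup {n : ℕ} (φ : (Fin n → ℝ) → ℝ) : AddSubmonoid (ℕ × (Fin n → ℤ)) where
  carrier := {p | ∀ x, (p.1 : ℝ) * φ x ≤ toReal p.2 ⬝ᵥ x}
  zero_mem' x := by simp [toReal_zero]
  add_mem' {p q} hp hq x := by
    rw [Prod.fst_add, Prod.snd_add, toReal_add, add_dotProduct, Nat.cast_add, add_mul]
    exact add_le_add (hp x) (hq x)

theorem mem_sectionSemigroup {φ : (Fin n → ℝ) → ℝ} {p : ℕ × (Fin n → ℤ)} :
    p ∈ sectionSemigroup φ ↔ ∀ x, (p.1 : ℝ) * φ x ≤ toReal p.2 ⬝ᵥ x := Iff.rfl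

theorem eq_zero_of_mem_sectionSemigroup {φ : (Fin n → ℝ) → ℝ} {p : ℕ × (Fin n → ℤ)}
    (h : p ∈ sectionSemigroup φ) (h0 : p.1 = 0) : p.2 = 0 := by
  have h1 : ∀ x, 0 ≤ toReal p.2 ⬝ᵥ x := fun x => by simpa [h0] using h x
  have h2 : toReal p.2 = 0 := dotProduct_eq_zero _ fun x => by
    have := h1 (-x)
    rw [dotProduct_neg] at this
    linarith [h1 x]
  exact toReal_injective (h2.trans toReal_zero.symm)

theorem mem_sectionSemigroup_iff {φ : (Fin n → ℝ) → ℝ} (hφ : IsConical φ)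
    {p : ℕ × (Fin n → ℤ)} (hp : 0 < p.1) :
    p ∈ sectionSemigroup φ ↔ (p.1 : ℝ)⁻¹ • toReal p.2 ∈ stabilitySet φ := by
  rw [mem_sectionSemigroup, hφ.mem_stabilitySet]
  have h0 : (0 : ℝ) < p.1 := by exact_mod_cast hp
  refine forall_congr' fun x => ?_
  rw [smul_dotProduct, smul_eq_mul, le_inv_mul_iff₀ h0]

/-- The rounding disappears because `⟨m, v⟩` is an integer. The inequalities at the rays of all
models are those at all primitive vectors, and they extend to `N_ℝ` by homogeneity and density. -/
theorem BDivisor.IsConcaveFunction.sectionRing_eq {S : Fan n} {D : BDivisor S}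
    {φ : (Fin n → ℝ) → ℝ} (h : D.IsConcaveFunction φ) :
    D.sectionRing k = semigroupRing k (sectionSemigroup φ) := by
  ext F
  change (∀ l, F.coeff l ∈ (BDivisor.mul l D).H0 k) ↔ _
  rw [mem_semigroupRing]
  refine forall_congr' fun l => ?_
  rw [BDivisor.mem_H0_iff]
  refine exists_congr fun g => and_congr_right fun _ => forall₂_congr fun m _ => ?_
  have key : ∀ (S' : Model S) (v : S'.1.rays),
      -⌊(BDivisor.mul l D).inc S' v⌋ ≤ m ⬝ᵥ (v : Fin n → ℤ) ↔
        (l : ℝ) * φ (toReal (v : Fin n → ℤ)) ≤ toReal m ⬝ᵥ toReal (v : Fin n → ℤ) := by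
    intro S' v
    rw [h.ray, toReal_dotProduct, neg_le, Int.le_floor, ← Rat.cast_le (K := ℝ)]
    simp only [BDivisor.mul]
    push_cast
    constructor <;> intro h <;> linarith
  rw [mem_sectionSemigroup]
  constructor
  · intro hm
    refine IsConical.le_of_primitive (f := fun x => (l : ℝ) * φ x) (g := fun x => toReal m ⬝ᵥ x)
      ?_ ?_ ?_ ?_ ?_
    · intro t x ht
      simp only [h.conical t x ht]
      ring
    · intro t x _
      simp only [dotProduct_smul, smul_eq_mul]
    · exact continuous_const.mul h.continuous
    · fun_prop
    · intro v hv
      obtain ⟨S', -, hv'⟩ := Model.exists_mem_rays ⟨S, Fan.Subdivides.refl S⟩ hv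
      exact (key S' ⟨v, hv'⟩).1 (hm S' ⟨v, hv'⟩)
  · exact fun hm S' v => (key S' v).2 (hm _)

/-- Gordan's lemma for the cone over a rational polytope. -/
theorem sectionSemigroup_fg {φ : (Fin n → ℝ) → ℝ} (hφ : IsConical φ)
    (hP : IsRationalPolytope (stabilitySet φ)) : (sectionSemigroup φ).FG := by
  classical
  obtain ⟨s, hs⟩ := hP
  choose N m hN hm using fun q : Fin n → ℚ => exists_toReal_eq_smul_ratToReal q
  have hmem : ∀ q ∈ s, (N q, m q) ∈ sectionSemigroup φ := by
    intro q hq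
    have h0 : (0 : ℝ) < N q := by exact_mod_cast hN q
    rw [mem_sectionSemigroup_iff hφ (hN q), hm, inv_smul_smul₀ h0.ne', hs]
    exact subset_convexHull _ _ ⟨q, hq, rfl⟩
  -- A finite box that contains every lattice point whose coefficients at the `(N q, m q)` can be
  -- chosen in `[0, 1]`.
  let B : Set (ℕ × (Fin n → ℤ)) := Set.Iic (∑ q ∈ s, N q) ×ˢ
    Set.Icc (-∑ q ∈ s, |m q|) (∑ q ∈ s, |m q|)
  have hB : B.Finite := (Set.finite_Iic _).prod (Set.finite_Icc _ _)
  let G : Set (ℕ × (Fin n → ℤ)) := (fun q => (N q, m q)) '' s ∪ B ∩ sectionSemigroup φ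
  have hG : G.Finite := (s.finite_toSet.image _).union (hB.inter_of_left _)
  have hGle : AddSubmonoid.closure G ≤ sectionSemigroup φ := by
    rw [AddSubmonoid.closure_le]
    rintro p (⟨q, hq, rfl⟩ | hp)
    · exact hmem q hq
    · exact hp.2
  refine (AddSubmonoid.fg_iff _).2 ⟨G, le_antisymm hGle fun p hp => ?_, hG⟩
  rcases Nat.eq_zero_or_pos p.1 with h0 | h0
  · have : p = 0 := Prod.ext h0 (eq_zero_of_mem_sectionSemigroup hp h0)
    rw [this]
    exact AddSubmonoid.zero_mem _
  have hp0 : (0 : ℝ) < p.1 := by exact_mod_cast h0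
  have hp1 := (mem_sectionSemigroup_iff hφ h0).1 hp
  have hinj : Function.Injective (ratToReal : (Fin n → ℚ) → Fin n → ℝ) := fun a b hab => by
    funext i
    exact Rat.cast_injective (congrFun hab i)
  rw [hs, ← Finset.coe_image, Finset.mem_convexHull'] at hp1
  obtain ⟨w, hw0, hw1, hw⟩ := hp1
  rw [Finset.sum_image hinj.injOn] at hw1 hw
  -- Barycentric weights rescaled so that `p` is the combination of the `(N q, m q)` with
  -- coefficients `c q`. The integral parts use generators, and the fractional parts give the
  -- remainder `r` in the box.
  let c : (Fin n → ℚ) → ℝ := fun q => p.1 * w (ratToReal q) / N q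
  have hNr : ∀ q, (0 : ℝ) < N q := fun q => by exact_mod_cast hN q
  have hc0 : ∀ q ∈ s, 0 ≤ c q := fun q hq =>
    div_nonneg (mul_nonneg hp0.le (hw0 _ (Finset.mem_image_of_mem _ hq))) (hNr q).le
  have hcN : ∑ q ∈ s, c q * N q = p.1 := by
    rw [← mul_one (p.1 : ℝ), ← hw1, Finset.mul_sum]
    exact Finset.sum_congr rfl fun q _ => div_mul_cancel₀ _ (hNr q).ne'
  have hcm : ∑ q ∈ s, c q • toReal (m q) = toReal p.2 := by
    rw [← smul_inv_smul₀ hp0.ne' (toReal p.2), ← hw, Finset.smul_sum]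
    refine Finset.sum_congr rfl fun q _ => ?_
    rw [hm, smul_smul, smul_smul, div_mul_cancel₀ _ (hNr q).ne']
  have hfl : ∀ q ∈ s, (⌊c q⌋₊ : ℝ) ≤ c q := fun q hq => Nat.floor_le (hc0 q hq)
  have hfr : ∀ q, c q - ⌊c q⌋₊ ≤ 1 := fun q => by linarith [Nat.lt_floor_add_one (c q)]
  have hle : ∑ q ∈ s, ⌊c q⌋₊ * N q ≤ p.1 := by
    have : ((∑ q ∈ s, ⌊c q⌋₊ * N q : ℕ) : ℝ) ≤ p.1 := by
      rw [← hcN]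
      push_cast
      exact Finset.sum_le_sum fun q hq => mul_le_mul_of_nonneg_right (hfl q hq) (hNr q).le
    exact_mod_cast this
  let r : ℕ × (Fin n → ℤ) :=
    (p.1 - ∑ q ∈ s, ⌊c q⌋₊ * N q, p.2 - ∑ q ∈ s, ⌊c q⌋₊ • m q)
  have hpr : p = r + ∑ q ∈ s, ⌊c q⌋₊ • (N q, m q) := by
    refine Prod.ext ?_ ?_
    · simp only [r, Prod.fst_add, Prod.fst_sum, Prod.smul_fst, smul_eq_mul]
      omega
    · simp only [r, Prod.snd_add, Prod.snd_sum, Prod.smul_snd, sub_add_cancel]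
  have hr1 : (r.1 : ℝ) = ∑ q ∈ s, (c q - ⌊c q⌋₊) * N q := by
    simp only [r, Nat.cast_sub hle, ← hcN, sub_mul, Finset.sum_sub_distrib]
    push_cast
    rfl
  have hr2 : ∀ i, (r.2 i : ℝ) = ∑ q ∈ s, (c q - ⌊c q⌋₊) * m q i := by
    intro i
    have := congrFun hcm i
    simp only [Finset.sum_apply, Pi.smul_apply, smul_eq_mul, toReal] at this
    simp only [r, Pi.sub_apply, Finset.sum_apply, Pi.smul_apply, Int.cast_sub, ← this, sub_mul,
      Finset.sum_sub_distrib, Int.cast_sum, nsmul_eq_mul (α := ℤ), Int.cast_mul, Int.cast_natCast]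
  have hr2' : toReal r.2 = ∑ q ∈ s, (c q - ⌊c q⌋₊) • toReal (m q) := by
    funext i
    simp only [Finset.sum_apply, Pi.smul_apply, smul_eq_mul, toReal, hr2]
  have habs : ∀ i, |r.2 i| ≤ ∑ q ∈ s, |m q i| := by
    intro i
    have : (|r.2 i| : ℝ) ≤ ∑ q ∈ s, |(m q i : ℝ)| := by
      rw [hr2]
      refine (Finset.abs_sum_le_sum_abs _ _).trans (Finset.sum_le_sum fun q hq => ?_)
      rw [abs_mul, abs_of_nonneg (sub_nonneg.2 (hfl q hq))]
      exact mul_le_of_le_one_left (abs_nonneg _) (hfr q)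
    exact_mod_cast this
  have hrG : r ∈ G := by
    refine Or.inr ⟨⟨?_, ?_⟩, ?_⟩
    · have : (r.1 : ℝ) ≤ ∑ q ∈ s, (N q : ℝ) := by
        rw [hr1]
        exact Finset.sum_le_sum fun q _ => mul_le_of_le_one_left (hNr q).le (hfr q)
      exact_mod_cast this
    · refine ⟨fun i => ?_, fun i => ?_⟩
      · simpa using (abs_le.1 (habs i)).1
      · simpa using (abs_le.1 (habs i)).2
    · intro x
      rw [hr1, hr2', sum_dotProduct, Finset.sum_mul]
      refine Finset.sum_le_sum fun q hq => ?_
      rw [smul_dotProduct, smul_eq_mul, mul_assoc]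
      exact mul_le_mul_of_nonneg_left (hmem q hq x) (sub_nonneg.2 (hfl q hq))
  rw [hpr]
  refine AddSubmonoid.add_mem _ (AddSubmonoid.subset_closure hrG)
    (AddSubmonoid.sum_mem _ fun q hq => AddSubmonoid.nsmul_mem _ ?_ _)
  exact AddSubmonoid.subset_closure (Or.inl ⟨q, hq, rfl⟩)

/-- Divided by its degree, a sum in the semigroup becomes a convex combination, so all normalized
elements lie in the hull `P` of the normalized generators. Clearing denominators shows that every
rational point of the stability set is such an element; density and closedness of `P` do the rest.
-/
theorem isRationalPolytope_of_fg {φ : (Fin n → ℝ) → ℝ} (hφ : IsConical φ)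
    (hΔ : HasRationalAffineHull (stabilitySet φ)) (hfg : (sectionSemigroup φ).FG) :
    IsRationalPolytope (stabilitySet φ) := by
  classical
  obtain ⟨G, hG⟩ := hfg
  have hGmem : ∀ p ∈ G, p ∈ sectionSemigroup φ := fun p hp => hG ▸ AddSubmonoid.subset_closure hp
  -- In degree zero the division returns the meaningless value `0`; the filter in `s` discards such
  -- generators.
  let quot : ℕ × (Fin n → ℤ) → Fin n → ℚ := fun p i => (p.2 i : ℚ) / p.1
  have hquot : ∀ p, ratToReal (quot p) = (p.1 : ℝ)⁻¹ • toReal p.2 := fun p => by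
    funext i
    simp only [quot, ratToReal, toReal, Pi.smul_apply, smul_eq_mul]
    push_cast
    rw [div_eq_inv_mul]
  let s : Finset (Fin n → ℚ) := (G.filter fun p => 0 < p.1).image quot
  let P : Set (Fin n → ℝ) := convexHull ℝ (ratToReal '' (s : Set (Fin n → ℚ)))
  have hconv : Convex ℝ P := convex_convexHull ℝ _
  have hP : IsClosed P := ((s.finite_toSet.image _).isClosed_convexHull ℝ)
  have hclos : ∀ p ∈ sectionSemigroup φ, p = 0 ∨ 0 < p.1 ∧ (p.1 : ℝ)⁻¹ • toReal p.2 ∈ P := by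
    intro p hp
    rw [← hG] at hp
    induction hp using AddSubmonoid.closure_induction with
    | mem p hp =>
      rcases Nat.eq_zero_or_pos p.1 with h0 | h0
      · exact Or.inl (Prod.ext h0 (eq_zero_of_mem_sectionSemigroup (hGmem p hp) h0))
      · refine Or.inr ⟨h0, subset_convexHull _ _ ⟨quot p, ?_, hquot p⟩⟩
        exact Finset.mem_image_of_mem _ (Finset.mem_filter.2 ⟨hp, h0⟩)
    | zero => exact Or.inl rfl
    | add p q _ _ hp hq =>
      rcases hp with rfl | ⟨hp0, hp⟩
      · rwa [zero_add]
      rcases hq with rfl | ⟨hq0, hq⟩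
      · rw [add_zero]
        exact Or.inr ⟨hp0, hp⟩
      · refine Or.inr ⟨Nat.add_pos_left hp0 _, ?_⟩
        have hp0' : (0 : ℝ) < p.1 := by exact_mod_cast hp0
        have hq0' : (0 : ℝ) < q.1 := by exact_mod_cast hq0
        have hsum := add_pos hp0' hq0'
        convert hconv hp hq (a := p.1 / (p.1 + q.1)) (b := q.1 / (p.1 + q.1))
          (by positivity) (by positivity) (by field_simp) using 1
        rw [Prod.fst_add, Prod.snd_add, toReal_add, smul_add, smul_smul, smul_smul, Nat.cast_add]
        congr 2 <;> field_simp
  refine ⟨s, Set.Subset.antisymm ?_ (convexHull_min ?_ hφ.convex_stabilitySet)⟩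
  · refine (subset_closure_rational hφ.convex_stabilitySet hΔ).trans
      (closure_minimal ?_ hP)
    rintro _ ⟨hq, q, rfl⟩
    obtain ⟨N, m, hN, hm⟩ := exists_toReal_eq_smul_ratToReal q
    have hN' : (0 : ℝ) < N := by exact_mod_cast hN
    have hq' : ratToReal q = (N : ℝ)⁻¹ • toReal m := by rw [hm, inv_smul_smul₀ hN'.ne']
    rw [hq'] at hq ⊢
    rcases hclos (N, m) ((mem_sectionSemigroup_iff hφ hN).2 hq) with h | h
    · exact absurd (congrArg Prod.fst h) hN.ne'
    · exact h.2
  · rintro _ ⟨_, hq, rfl⟩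
    obtain ⟨p, hp, rfl⟩ := Finset.mem_image.1 hq
    rw [hquot]
    exact (mem_sectionSemigroup_iff hφ (Finset.mem_filter.1 hp).2).1
      (hGmem p (Finset.mem_filter.1 hp).1)

end ToricB

end

/-! ### The main theorem. -/

theorem mainTheorem8 (k : Type*) [Field k] [IsAlgClosed k] {n : ℕ} (S : ToricB.Fan n)
    (D : ToricB.BDivisor S) (hD : D.IsNef) :
    ∃ φ : (Fin n → ℝ) → ℝ, D.IsConcaveFunction φ ∧
      (D.IsCartier ↔ ToricB.IsRationalPolytope (ToricB.stabilitySet φ)) ∧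
      (D.IsCartier → (D.sectionRing k).FG) ∧
      ((n ≤ 2 ∨ ToricB.HasRationalAffineHull (ToricB.stabilitySet φ)) →
        (D.sectionRing k).FG → D.IsCartier) := by
  obtain ⟨φ, h⟩ := hD.exists_isConcaveFunction
  refine ⟨φ, h, ⟨h.isRationalPolytope, h.isCartier⟩, fun hC => ?_, fun hn hfg => ?_⟩
  · rw [h.sectionRing_eq]
    exact ToricB.semigroupRing_fg (ToricB.sectionSemigroup_fg h.isConical (h.isRationalPolytope hC))
  · rw [h.sectionRing_eq] at hfg
    have hΔ : ToricB.HasRationalAffineHull (ToricB.stabilitySet φ) := hn.elim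
      (ToricB.hasRationalAffineHull_of_le_two h.isConical h.concave h.exists_rat) id
    exact h.isCartier
      (ToricB.isRationalPolytope_of_fg h.isConical hΔ (ToricB.fg_of_semigroupRing_fg hfg))
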